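/- Let $d\ge 0$, $I=\{+,z,-\}$, with involution $\overline{(\pm)}=\mp$, $\overline z=z$. Let $\tilde\epsilon_{\pm\mp z}=\pm1$, $\tilde\epsilon_{\pm z\pm}=\mp1$, $\tilde\epsilon_{z\pm\pm}=\pm1$, and $\tilde\epsilon_{ijk}=0$ otherwise. For a vector $M\in\mathbb R^3$ write $M_\pm=(M_1\pm iM_2)/\sqrt2$, $M_z=M_3$. Multi-indices are finitely supported $\alpha\in\mathbb N^{I\times\mathbb Z^d}$; $|\alpha(x)|=\sum_{i\in I}\alpha_i(x)$, $|\alpha|=\sum_x|\alpha(x)|$, $\overline\alpha_i(x)=\alpha_{\bar i}(x)$, and $M^\alpha=\prod_{x,i}M_i(x)^{\alpha_i(x)}$. Let $V$ assign to each multi-index a complex number such that $\overline{V(\alpha)}=V(\overline\alpha)$ and $$\|V\|=\sum_{n\in\mathbb N}\ \sup_{x\in\mathbb Z^d}\sum_{|\alpha|=n}|\alpha(x)|\,|V(\alpha)|\,e^n<\infty .$$ Let $\mathfrak P=\mathbb C[\{M_i(x): i\in I,\ x\in\mathbb Z^d\}]$. Classical evolution. For $M_0:\mathbb Z^d\to\mathbb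 S^2$, $M:\mathbb R\times\mathbb Z^d\to\mathbb S^2$ denotes the solution, continuously differentiable in $t$ with respect to the $l^\infty$-norm, of $$\frac{d}{dt}M_i(t,x)=\sum_{\alpha}V(\alpha)\sum_{j,k\in I} i\,\tilde\epsilon_{jik}\,\alpha_j(x)\,M^{\alpha-\delta_j(x)+\delta_k(x)}(t),\qquad M(0,x)=M_0(x),$$ where $\delta_i(x)$ is the multi-index equal to $1$ at $(i,x)$ and $0$ elsewhere. Quantum evolution. For $s\in\frac12\mathbb N$, $s>0$, and finite $\Lambda\subset\mathbb Z^d$ let $\widehat{\mathfrak A}_\Lambda$ be the algebra of operators on $\bigotimes_{x\in\Lambda}\mathbb C^{2s+1}$ with the operator norm, $\widehat{\mathfrak A}_{\Lambda_1}\subset\widehat{\mathfrak A}_{\Lambda_2}$ for $\Lambda_1\subset\Lambda_2$ through $\mathcal A\mapsto\mathcal A\otimes 1$, and let $\widehat{\mathfrak A}$ be the norm completion of $\bigcup_\Lambda\widehat{\mathfrak A}_\Lambda$. Let $S_1,S_2,S_3$ be the generators of the spin-$s$ representation of $su(2)$, $S_\pm=(S_1\pm iS_2)/\sqrt2$, $S_z=S_3$,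 and let $\widehat S_i(x)$ be $s^{-1}S_i$ acting at the site $x$. Quantization $A\mapsto\widehat A$ is the linear map $\mathfrak P\to\widehat{\mathfrak A}$ replacing each $M_i(x)$ in a monomial by $\widehat S_i(x)$ and ordering all $\widehat S_+$ to the left of all $\widehat S_z$, and these to the left of all $\widehat S_-$; $\widehat 1=1$. Put $\widehat H_\Lambda=\sum_{\alpha\in\mathbb N^{I\times\Lambda}}V(\alpha)\widehat{M^\alpha}$, $\widehat\alpha^t_\Lambda\mathcal A=e^{is\widehat H_\Lambda t}\mathcal A\,e^{-is\widehat H_\Lambda t}$, and $\widehat\alpha^t\mathcal A=\lim_{\Lambda\to\mathbb Z^d}\widehat\alpha^t_\Lambda\mathcal A$ in norm, along the directed set of finite subsets. Coherent states. For $m\in\mathbb S^2$ with polar angles $(\theta,\varphi)$ let $|m\rangle=\exp\big(\tfrac{\theta}{\sqrt2}[e^{i\varphi}S_--e^{-i\varphi}S_+]\big)|s\rangle\in\mathbb C^{2s+1}$, where $S_z|s\rangle=s|s\rangle$, $\||s\rangle\|=1$. For $M_0:\mathbb Z^d\to\mathbb S^2$ let $\rho_{M_0}$ be the continuous extension to $\widehat{\mathfrak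 A}$ of $\mathcal A\mapsto\langle M_\Lambda,\mathcal A M_\Lambda\rangle$, $\mathcal A\in\widehat{\mathfrak A}_\Lambda$, with $|M_\Lambda\rangle=\bigotimes_{x\in\Lambda}|M_0(x)\rangle$. Theorem. The norm limits $\widehat\alpha^t\widehat A$ exist for all $A\in\mathfrak P$, $t\in\mathbb R$ and $s$, the classical solution $M$ exists and is unique for every $M_0$, and for all $A\in\mathfrak P$ and $M_0:\mathbb Z^d\to\mathbb S^2$ $$\lim_{s\to\infty}\rho_{M_0}(\widehat\alpha^t\widehat A)=A(M(t)),$$ uniformly in $t$ on compact time intervals. Moreover, for every $A\in\mathfrak P$ and every $T$ with $T\|V\|<1$ there is a constant $C$, independent of $s$ and of $M_0$, such that $$\big|\rho_{M_0}(\widehat\alpha^t\widehat A)-A(M(t))\big|\le\frac{C}{\sqrt s}\qquad\text{for all }|t|\le T\text{ and all }s .$$ -/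

import Mathlib

open Filter Topology
open scoped Matrix.Norms.L2Operator ENNReal

noncomputable section

namespace SpinSystem

/-! ### Lattice, ladder indices, structure constants, multi-indices -/

/-- The sites of the lattice `ℤ^d`. -/
abbrev Site (d : ℕ) : Type := Fin d → ℤ

/-- The index set `I = {+, z, -}`. -/
inductive Ladder : Type
  | plus
  | z
  | minus
  deriving DecidableEq

instance : Fintype Ladder := ⟨{.plus, .z, .minus}, fun i => by cases i <;> decide⟩

/-- The involution `(+, z, -) ↦ (-, z, +)`. -/
def Ladder.conj : Ladder → Ladder
  | .plus => .minus
  | .z => .z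
  | .minus => .plus

/-- The symbol `ε̃ i j k`: `ε̃(±,∓,z) = ±1`, `ε̃(±,z,±) = ∓1`, `ε̃(z,±,±) = ±1`, and `0` otherwise. -/
def epsTilde : Ladder → Ladder → Ladder → ℂ
  | .plus, .minus, .z => 1
  | .minus, .plus, .z => -1
  | .plus, .z, .plus => -1
  | .minus, .z, .minus => 1
  | .z, .plus, .plus => 1
  | .z, .minus, .minus => -1
  | _, _, _ => 0

/-- Multi-indices `α ∈ ℕ^{I × ℤ^d}` with `|α| < ∞`. -/
abbrev MultiIndex (d : ℕ) : Type := (Site d × Ladder) →₀ ℕ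

/-- `|α(x)| = ∑_i α_i(x)`. -/
def siteDegree {d : ℕ} (α : MultiIndex d) (x : Site d) : ℕ := ∑ i : Ladder, α (x, i)

/-- The conjugate multi-index, `(conj α)_i(x) = α_{conj i}(x)`. -/
def conjIndex {d : ℕ} (α : MultiIndex d) : MultiIndex d :=
  α.mapDomain fun p => (p.1, p.2.conj)

/-- The finite set of sites on which `α` does not vanish. -/
def sites {d : ℕ} (α : MultiIndex d) : Finset (Site d) := α.support.image Prod.fst

/-! ### Interaction potentials -/

/-- `‖V‖ = ∑_n sup_x ∑_{|α| = n} |α(x)| |V(α)| e^n`, as an extended nonnegative number. -/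
def potentialENorm {d : ℕ} (V : MultiIndex d → ℂ) : ℝ≥0∞ :=
  ∑' n : ℕ, ⨆ x : Site d, ∑' α : {α : MultiIndex d // α.degree = n},
    ENNReal.ofReal (siteDegree α.1 x * ‖V α.1‖ * Real.exp n)

/-- The real number `‖V‖`, meaningful when `potentialENorm V` is finite. -/
def potentialNorm {d : ℕ} (V : MultiIndex d → ℂ) : ℝ := (potentialENorm V).toReal

/-- An admissible interaction potential: the Hamilton functions are real, and `‖V‖ < ∞`. -/
structure IsPotential {d : ℕ} (V : MultiIndex d → ℂ) : Prop where
  conj_eq : ∀ α, V (conjIndex α) = (starRingEnd ℂ) (V α)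
  norm_lt_top : potentialENorm V < ⊤

/-! ### Classical spins -/

/-- Euclidean three-space. -/
abbrev Vec3 : Type := EuclideanSpace ℝ (Fin 3)

/-- The complex coordinates `M_± = (M_1 ± i M_2)/√2`, `M_z = M_3` of a vector. -/
def ladderCoord (v : Vec3) : Ladder → ℂ
  | .plus => ((v 0 : ℂ) + Complex.I * (v 1 : ℂ)) / (Real.sqrt 2 : ℂ)
  | .z => (v 2 : ℂ)
  | .minus => ((v 0 : ℂ) - Complex.I * (v 1 : ℂ)) / (Real.sqrt 2 : ℂ)

/-- The monomial `M^α` evaluated at a configuration. -/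
def classicalMonomial {d : ℕ} (m : Site d → Vec3) (α : MultiIndex d) : ℂ :=
  α.prod fun p n => ladderCoord (m p.1) p.2 ^ n

/-- The algebra `𝔓` of complex polynomials in the variables `M_i(x)`, `x ∈ ℤ^d`, `i ∈ I`. -/
abbrev PolyObs (d : ℕ) : Type := MvPolynomial (Site d × Ladder) ℂ

/-- The value `A(m)` of a polynomial observable at a configuration. -/
def PolyObs.evalAt {d : ℕ} (A : PolyObs d) (m : Site d → Vec3) : ℂ :=
  MvPolynomial.eval (fun p => ladderCoord (m p.1) p.2) A

/-- The right-hand side of the Hamiltonian equation of motion on `ℤ^d`,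
`∑_α V(α) ∑_{j,k} i ε̃_{jik} α_j(x) M^{α - δ_j(x) + δ_k(x)}`. -/
def hamiltonField {d : ℕ} (V : MultiIndex d → ℂ) (m : Site d → Vec3) (x : Site d) (i : Ladder) :
    ℂ :=
  ∑' α : MultiIndex d, V α * ∑ j : Ladder, ∑ k : Ladder,
    Complex.I * epsTilde j i k * (α (x, j) : ℂ) *
      classicalMonomial m (α - Finsupp.single (x, j) 1 + Finsupp.single (x, k) 1)

/-- `M : ℝ × ℤ^d → S²` is a global solution, continuously differentiable in time for the `l^∞`-norm,
of the Hamiltonian equation of motion on `ℤ^d` with initial configuration `M₀`. -/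
structure IsHamiltonianEvolution {d : ℕ} (V : MultiIndex d → ℂ)
    (M₀ : Site d → Metric.sphere (0 : Vec3) 1)
    (M : ℝ → lp (fun _ : Site d => Vec3) ∞) : Prop where
  contDiff : ContDiff ℝ 1 M
  initial : ∀ x, M 0 x = M₀ x
  norm_eq_one : ∀ t x, ‖M t x‖ = 1
  hasDerivAt : ∀ t x i,
    HasDerivAt (fun τ : ℝ => ladderCoord (M τ x) i) (hamiltonField V (M t) x i) t

/-! ### Local algebras of quantum spins

The spin is `s = N / 2` with `N = 2s` a natural number; `ℂ^{2s+1}` has the orthonormal basis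
`|0⟩, …, |N⟩` in which `S_3 |k⟩ = (s - k) |k⟩`. -/

/-- Operators on the space `ℂ^{2s+1}` of a single spin. -/
abbrev SpinMat (N : ℕ) : Type := Matrix (Fin (N + 1)) (Fin (N + 1)) ℂ

/-- The algebra `𝔄_Λ` of operators on `⨂_{x ∈ Λ} ℂ^{2s+1}`, written as matrices in the product
basis, with the operator norm. -/
abbrev LocalAlgebra {d : ℕ} (N : ℕ) (Λ : Finset (Site d)) : Type :=
  Matrix (Λ → Fin (N + 1)) (Λ → Fin (N + 1)) ℂ

section Embedding

variable {d : ℕ} {N : ℕ} {Λ₁ Λ₂ : Finset (Site d)}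

/-- Split a basis label of `Λ₂` into its parts on `Λ₁` and on `Λ₂ \ Λ₁`. -/
def splitConfig (N : ℕ) (h : Λ₁ ⊆ Λ₂) :
    (Λ₂ → Fin (N + 1)) ≃
      (Λ₁ → Fin (N + 1)) × ({y : Λ₂ // (y : Site d) ∉ Λ₁} → Fin (N + 1)) where
  toFun σ := (fun x => σ ⟨x, h x.2⟩, fun y => σ y)
  invFun p := fun y => if hy : (y : Site d) ∈ Λ₁ then p.1 ⟨y, hy⟩ else p.2 ⟨y, hy⟩
  left_inv σ := by
    funext y
    by_cases hy : (y : Site d) ∈ Λ₁ <;> simp [hy]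
  right_inv p := by
    ext x
    · simp
    · simp [x.2]

/-- The identification `𝒜 ↦ 𝒜 ⊗ 1_{Λ₂ \ Λ₁}` of operators on `Λ₁` with operators on `Λ₂`. -/
def localEmbed (h : Λ₁ ⊆ Λ₂) : LocalAlgebra N Λ₁ →⋆ₐ[ℂ] LocalAlgebra N Λ₂ where
  toFun A := (Matrix.kronecker A 1).submatrix (splitConfig N h) (splitConfig N h)
  map_one' := by
    simp [Matrix.kronecker]
  map_mul' A B := by
    rw [Matrix.submatrix_mul_equiv]
    simp [Matrix.kronecker, ← Matrix.mul_kronecker_mul]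
  map_zero' := by simp [Matrix.kronecker]
  map_add' A B := by
    ext σ τ
    simp [Matrix.kronecker, add_mul]
  commutes' c := by
    simp only [Algebra.algebraMap_eq_smul_one]
    ext σ τ
    have : (1 : LocalAlgebra N Λ₂) = (Matrix.kronecker (1 : LocalAlgebra N Λ₁)
      (1 : Matrix ({y : Λ₂ // (y : Site d) ∉ Λ₁} → Fin (N + 1)) _ ℂ)).submatrix
        (splitConfig N h) (splitConfig N h) := by simp [Matrix.kronecker]
    have h' := congrFun (congrFun this σ) τ
    simp only [Matrix.kronecker, Matrix.submatrix_apply, Matrix.kroneckerMap_apply,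
      Matrix.smul_apply, smul_eq_mul] at h' ⊢
    rw [h', mul_assoc]
  map_star' A := by
    simp [Matrix.star_eq_conjTranspose, Matrix.kronecker, Matrix.conjTranspose_kronecker]

theorem localEmbed_apply (h : Λ₁ ⊆ Λ₂) (A : LocalAlgebra N Λ₁) (σ τ : Λ₂ → Fin (N + 1)) :
    localEmbed h A σ τ =
      if ∀ y : Λ₂, (y : Site d) ∉ Λ₁ → σ y = τ y then
        A (fun x => σ ⟨x, h x.2⟩) (fun x => τ ⟨x, h x.2⟩) else 0 := by
  have key : ((splitConfig N h σ).2 = (splitConfig N h τ).2) ↔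
      ∀ y : Λ₂, (y : Site d) ∉ Λ₁ → σ y = τ y := by
    simp [splitConfig, funext_iff]
  change A _ _ * (1 : Matrix _ _ ℂ) (splitConfig N h σ).2 (splitConfig N h τ).2 = _
  rw [Matrix.one_apply]
  simp only [key, mul_ite, mul_one, mul_zero]
  rfl

theorem localEmbed_injective (h : Λ₁ ⊆ Λ₂) :
    Function.Injective (localEmbed (N := N) h) := by
  intro A B hAB
  ext σ τ
  have := congrFun (congrFun hAB ((splitConfig N h).symm (σ, fun _ => 0)))
    ((splitConfig N h).symm (τ, fun _ => 0))
  simp only [localEmbed_apply] at this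
  simpa +contextual [splitConfig] using this

theorem norm_localEmbed (h : Λ₁ ⊆ Λ₂) (A : LocalAlgebra N Λ₁) : ‖localEmbed h A‖ = ‖A‖ :=
  NonUnitalStarAlgHom.norm_map (localEmbed h) (localEmbed_injective h) A

end Embedding

instance localDirected (d N : ℕ) :
    DirectedSystem (fun Λ : Finset (Site d) => LocalAlgebra N Λ)
      fun _ _ h => (localEmbed h : _ → _) where
  map_self Λ A := by
    ext σ τ
    rw [localEmbed_apply, if_pos]
    intro y hy
    exact absurd y.2 hy
  map_map Λ₃ Λ₂ Λ₁ h₁₂ h₂₃ A := by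
    ext σ τ
    simp only [localEmbed_apply]
    by_cases h : ∀ y : Λ₃, (y : Site d) ∉ Λ₁ → σ y = τ y
    · rw [if_pos h, if_pos, if_pos]
      · intro y hy
        exact h _ hy
      · intro y hy
        exact h _ fun hy' => hy (h₁₂ hy')
    · rw [if_neg h]
      by_cases h' : ∀ y : Λ₃, (y : Site d) ∉ Λ₂ → σ y = τ y
      · rw [if_pos h', if_neg]
        intro h''
        apply h
        intro y hy
        by_cases hy' : (y : Site d) ∈ Λ₂
        · exact h'' ⟨y, hy'⟩ hy
        · exact h' y hy'
      · rw [if_neg h']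

/-! ### The quasi-local algebra -/

/-- The union of all local algebras, i.e. the inductive limit of the `𝔄_Λ` over finite `Λ ⊂ ℤ^d`
along `𝒜 ↦ 𝒜 ⊗ 1`. -/
def LocalUnion (d N : ℕ) : Type :=
  DirectLimit (fun Λ : Finset (Site d) => LocalAlgebra N Λ)
    fun _ _ h => (localEmbed h : _ →⋆ₐ[ℂ] _)

namespace LocalUnion

variable {d N : ℕ}

instance : Ring (LocalUnion d N) :=
  inferInstanceAs (Ring (DirectLimit (fun Λ : Finset (Site d) => LocalAlgebra N Λ)
    fun _ _ h => (localEmbed h : _ →⋆ₐ[ℂ] _)))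

instance : Algebra ℂ (LocalUnion d N) :=
  inferInstanceAs (Algebra ℂ (DirectLimit (fun Λ : Finset (Site d) => LocalAlgebra N Λ)
    fun _ _ h => (localEmbed h : _ →⋆ₐ[ℂ] _)))

instance : StarRing (LocalUnion d N) :=
  inferInstanceAs (StarRing (DirectLimit (fun Λ : Finset (Site d) => LocalAlgebra N Λ)
    fun _ _ h => (localEmbed h : _ →⋆ₐ[ℂ] _)))

/-- The inclusion of `𝔄_Λ` in the union of all local algebras. -/
def of (Λ : Finset (Site d)) : LocalAlgebra N Λ →⋆ₐ[ℂ] LocalUnion d N where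
  toFun A := (⟦⟨Λ, A⟩⟧ : DirectLimit (fun Λ : Finset (Site d) => LocalAlgebra N Λ)
    fun _ _ h => (localEmbed h : _ →⋆ₐ[ℂ] _))
  map_one' := (DirectLimit.one_def Λ).symm
  map_mul' A B := (DirectLimit.mul_def Λ A B).symm
  map_zero' := (DirectLimit.zero_def Λ).symm
  map_add' A B := (DirectLimit.add_def Λ A B).symm
  commutes' c := (DirectLimit.algebraMap_def (R := ℂ) Λ c).symm
  map_star' A := (DirectLimit.star_def Λ A).symm

theorem of_localEmbed {Λ₁ Λ₂ : Finset (Site d)} (h : Λ₁ ⊆ Λ₂) (A : LocalAlgebra N Λ₁) :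
    of Λ₂ (localEmbed h A) = of Λ₁ A :=
  (DirectLimit.eq_of_le (f := fun _ _ h => (localEmbed h : LocalAlgebra N _ →⋆ₐ[ℂ] _))
    ⟨Λ₁, A⟩ Λ₂ h).symm

theorem exists_of (a : LocalUnion d N) : ∃ (Λ : Finset (Site d)) (A : LocalAlgebra N Λ),
    a = of Λ A :=
  DirectLimit.exists_eq_mk _ a

theorem exists_of₂ (a b : LocalUnion d N) : ∃ (Λ : Finset (Site d)) (A B : LocalAlgebra N Λ),
    a = of Λ A ∧ b = of Λ B :=
  DirectLimit.exists_eq_mk₂ _ a b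

/-- A function on the union of the local algebras from a compatible family. -/
def lift {C : Type*} (g : ∀ Λ : Finset (Site d), LocalAlgebra N Λ → C)
    (hg : ∀ (Λ₁ Λ₂ : Finset (Site d)) (h : Λ₁ ⊆ Λ₂) (A : LocalAlgebra N Λ₁),
      g Λ₁ A = g Λ₂ (localEmbed h A)) : LocalUnion d N → C :=
  DirectLimit.lift _ g hg

theorem lift_of {C : Type*} (g : ∀ Λ : Finset (Site d), LocalAlgebra N Λ → C)
    (hg : ∀ (Λ₁ Λ₂ : Finset (Site d)) (h : Λ₁ ⊆ Λ₂) (A : LocalAlgebra N Λ₁),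
      g Λ₁ A = g Λ₂ (localEmbed h A)) (Λ : Finset (Site d)) (A : LocalAlgebra N Λ) :
    lift g hg (of Λ A) = g Λ A :=
  rfl

instance : Norm (LocalUnion d N) where
  norm := lift (fun _ A => ‖A‖) fun _ _ h A => (norm_localEmbed h A).symm

theorem norm_of (Λ : Finset (Site d)) (A : LocalAlgebra N Λ) : ‖of Λ A‖ = ‖A‖ := rfl

instance : NormedRing (LocalUnion d N) :=
  { (inferInstance : Ring (LocalUnion d N)),
    NormedAddCommGroup.ofCore (𝕜 := ℂ) (E := LocalUnion d N)
      { norm_nonneg := fun a => by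
          obtain ⟨Λ, A, rfl⟩ := exists_of a
          rw [norm_of]
          exact norm_nonneg A
        norm_smul := fun c a => by
          obtain ⟨Λ, A, rfl⟩ := exists_of a
          rw [← map_smul, norm_of, norm_of, norm_smul]
        norm_triangle := fun a b => by
          obtain ⟨Λ, A, B, rfl, rfl⟩ := exists_of₂ a b
          rw [← map_add, norm_of, norm_of, norm_of]
          exact norm_add_le A B
        norm_eq_zero_iff := fun a => by
          obtain ⟨Λ, A, rfl⟩ := exists_of a
          rw [norm_of, norm_eq_zero]
          refine ⟨fun h => by rw [h, map_zero], fun h => ?_⟩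
          rw [← norm_eq_zero, ← norm_of, h, ← map_zero (of Λ), norm_of, norm_zero] } with
    norm_mul_le := fun a b => by
      obtain ⟨Λ, A, B, rfl, rfl⟩ := exists_of₂ a b
      rw [← map_mul, norm_of, norm_of, norm_of]
      exact norm_mul_le A B }

instance : NormedAlgebra ℂ (LocalUnion d N) where
  norm_smul_le c a := by
    obtain ⟨Λ, A, rfl⟩ := exists_of a
    rw [← map_smul, norm_of, norm_of, norm_smul]

instance : StarModule ℂ (LocalUnion d N) where
  star_smul c a := by
    obtain ⟨Λ, A, rfl⟩ := exists_of a
    rw [← map_smul, ← map_star, star_smul, map_smul, map_star]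

instance : CStarRing (LocalUnion d N) where
  norm_mul_self_le a := by
    obtain ⟨Λ, A, rfl⟩ := exists_of a
    rw [← map_star, ← map_mul, norm_of, norm_of]
    exact CStarRing.norm_mul_self_le A

end LocalUnion

/-- The quasi-local algebra: the norm completion of the union of all local algebras. -/
def QuasiLocal (d N : ℕ) : Type := UniformSpace.Completion (LocalUnion d N)

namespace QuasiLocal

open UniformSpace

variable {d N : ℕ}

instance : NormedRing (QuasiLocal d N) :=
  inferInstanceAs (NormedRing (Completion (LocalUnion d N)))

instance : Algebra ℂ (QuasiLocal d N) :=
  inferInstanceAs (Algebra ℂ (Completion (LocalUnion d N)))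

instance : CompleteSpace (QuasiLocal d N) :=
  inferInstanceAs (CompleteSpace (Completion (LocalUnion d N)))

instance : NormedAlgebra ℂ (QuasiLocal d N) where
  norm_smul_le := (inferInstance : NormedSpace ℂ (Completion (LocalUnion d N))).norm_smul_le

/-- The inclusion of the union of the local algebras in the quasi-local algebra. -/
def ofUnion : LocalUnion d N →ₗᵢ[ℂ] QuasiLocal d N :=
  (Completion.toComplₗᵢ : LocalUnion d N →ₗᵢ[ℂ] Completion (LocalUnion d N))

theorem denseRange_ofUnion : DenseRange (ofUnion : LocalUnion d N → QuasiLocal d N) :=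
  Completion.denseRange_coe

theorem ofUnion_mul (a b : LocalUnion d N) : ofUnion (a * b) = ofUnion a * ofUnion b :=
  Completion.coe_mul a b

theorem ofUnion_one : ofUnion (1 : LocalUnion d N) = 1 :=
  Completion.coe_one _

instance : Star (QuasiLocal d N) where
  star := Completion.map (star : LocalUnion d N → LocalUnion d N)

theorem continuous_star' : Continuous (star : QuasiLocal d N → QuasiLocal d N) :=
  Completion.continuous_map

theorem star_ofUnion (a : LocalUnion d N) : star (ofUnion a) = ofUnion (star a) :=
  Completion.map_coe star_isometry.uniformContinuous a

theorem induction_on {p : QuasiLocal d N → Prop} (a : QuasiLocal d N)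
    (hp : IsClosed {a | p a}) (ih : ∀ a, p (ofUnion a)) : p a :=
  denseRange_ofUnion.induction_on a hp ih

theorem induction_on₂ {p : QuasiLocal d N → QuasiLocal d N → Prop} (a b : QuasiLocal d N)
    (hp : IsClosed {x : QuasiLocal d N × QuasiLocal d N | p x.1 x.2})
    (ih : ∀ a b, p (ofUnion a) (ofUnion b)) : p a b :=
  denseRange_ofUnion.induction_on₂ (p := p) hp ih a b

instance : StarRing (QuasiLocal d N) where
  star_involutive a := by
    refine induction_on (p := fun a => star (star a) = a) a ?_ fun a => ?_
    · exact isClosed_eq (continuous_star'.comp continuous_star') continuous_id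
    · rw [star_ofUnion, star_ofUnion, star_star]
  star_mul a b := by
    refine induction_on₂ (p := fun a b => star (a * b) = star b * star a) a b ?_ fun a b => ?_
    · exact isClosed_eq (continuous_star'.comp continuous_mul)
        ((continuous_star'.comp continuous_snd).mul (continuous_star'.comp continuous_fst))
    · simp only [star_ofUnion, ← ofUnion_mul, star_mul]
  star_add a b := by
    refine induction_on₂ (p := fun a b => star (a + b) = star a + star b) a b ?_ fun a b => ?_
    · exact isClosed_eq (continuous_star'.comp continuous_add)
        ((continuous_star'.comp continuous_fst).add (continuous_star'.comp continuous_snd))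
    · simp only [star_ofUnion, ← map_add, star_add]

instance : StarModule ℂ (QuasiLocal d N) where
  star_smul c a := by
    refine induction_on (p := fun a => star (c • a) = star c • star a) a ?_ fun a => ?_
    · exact isClosed_eq (continuous_star'.comp (continuous_const_smul c))
        (continuous_star'.const_smul (star c))
    · rw [← map_smul, star_ofUnion, star_ofUnion, star_smul, map_smul]

instance : CStarRing (QuasiLocal d N) where
  norm_mul_self_le a := by
    refine induction_on (p := fun a => ‖a‖ * ‖a‖ ≤ ‖star a * a‖) a ?_ fun a => ?_
    · exact isClosed_le (continuous_norm.mul continuous_norm)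
        (continuous_norm.comp (continuous_star'.mul continuous_id))
    · rw [star_ofUnion, ← ofUnion_mul, LinearIsometry.norm_map, LinearIsometry.norm_map]
      exact CStarRing.norm_mul_self_le a

instance : CStarAlgebra (QuasiLocal d N) where

/-- The inclusion of the local algebra `𝔄_Λ` in the quasi-local algebra. -/
def ofLocal (Λ : Finset (Site d)) : LocalAlgebra N Λ →⋆ₐ[ℂ] QuasiLocal d N where
  toFun A := ofUnion (LocalUnion.of Λ A)
  map_one' := by rw [map_one, ofUnion_one]
  map_mul' A B := by rw [map_mul, ofUnion_mul]
  map_zero' := by rw [map_zero, map_zero]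
  map_add' A B := by rw [map_add, map_add]
  commutes' c := by
    rw [Algebra.algebraMap_eq_smul_one, map_smul, map_one, map_smul, ofUnion_one,
      Algebra.algebraMap_eq_smul_one]
  map_star' A := by rw [map_star, star_ofUnion]

end QuasiLocal

/-! ### Spin operators and quantization -/

/-- The (unscaled) ladder components `S_± = (S_1 ± i S_2)/√2`, `S_z = S_3` of the generators of the
spin-`s` representation of `su(2)` on `ℂ^{2s+1}`, `s = N/2`, in the basis with
`S_3 |k⟩ = (s - k) |k⟩`; thus `S_+ |k⟩ = √(k (2s + 1 - k) / 2) |k - 1⟩` and `S_- = S_+^*`. -/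
def spinMatrix (N : ℕ) : Ladder → SpinMat N
  | .plus => Matrix.of fun j k =>
      if (j : ℕ) + 1 = k then ((Real.sqrt ((k : ℝ) * (N + 1 - k) / 2) : ℝ) : ℂ) else 0
  | .z => Matrix.diagonal fun k => (N : ℂ) / 2 - (k : ℂ)
  | .minus => Matrix.of fun j k =>
      if (k : ℕ) + 1 = j then ((Real.sqrt ((j : ℝ) * (N + 1 - j) / 2) : ℝ) : ℂ) else 0

section SpinOperators

variable {d : ℕ} (N : ℕ) {Λ : Finset (Site d)}

/-- The elementary tensor `⨂_{x ∈ Λ} B x`. -/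
def tensorOp (B : Λ → SpinMat N) : LocalAlgebra N Λ :=
  Matrix.of fun σ τ => ∏ x, B x (σ x) (τ x)

theorem tensorOp_mul (B C : Λ → SpinMat N) :
    tensorOp N B * tensorOp N C = tensorOp N fun x => B x * C x := by
  ext σ τ
  simp only [tensorOp, Matrix.mul_apply, Matrix.of_apply, ← Finset.prod_mul_distrib]
  rw [Finset.prod_univ_sum, Fintype.piFinset_univ]

/-- The rescaled spin operator `Ŝ_i(x) = s^{-1} S_i` acting on the factor at the site `x`. -/
def spinOp (x : Λ) (i : Ladder) : LocalAlgebra N Λ :=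
  tensorOp N (Function.update (fun _ => 1) x (((N : ℂ) / 2)⁻¹ • spinMatrix N i))

theorem commute_spinOp {x y : Λ} (h : x ≠ y) (i j : Ladder) :
    Commute (spinOp N x i) (spinOp N y j) := by
  rw [Commute, SemiconjBy, spinOp, spinOp, tensorOp_mul, tensorOp_mul]
  congr 1
  funext w
  by_cases hx : w = x
  · subst hx
    simp [Function.update_of_ne h]
  · simp [Function.update_of_ne hx]

/-- The product over the sites of `Λ` of the (commuting) operators `Ŝ_i(x)^{α_i(x)}`, `i` fixed. -/
def ladderProd (i : Ladder) (α : MultiIndex d) (Λ : Finset (Site d)) : LocalAlgebra N Λ :=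
  (Finset.univ : Finset Λ).noncommProd (fun x => spinOp N x i ^ α (x, i))
    fun _ _ _ _ h => (commute_spinOp N h i i).pow_pow _ _

/-- The normal-ordered quantization of the monomial `M^α`, for `α` supported in `Λ`: all factors
`Ŝ_+` stand to the left of all `Ŝ_z`, and these to the left of all `Ŝ_-`. -/
def normalMonomial (Λ : Finset (Site d)) (α : MultiIndex d) : LocalAlgebra N Λ :=
  ladderProd N .plus α Λ * ladderProd N .z α Λ * ladderProd N .minus α Λ

/-- Quantization `A ↦ Â` of polynomials, with values in the quasi-local algebra. -/
def quantize (A : PolyObs d) : QuasiLocal d N :=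
  ∑ α ∈ A.support, A.coeff α • QuasiLocal.ofLocal (sites α) (normalMonomial N (sites α) α)

/-! ### Quantum dynamics -/

/-- The Hamiltonian `Ĥ_Λ`, the term by term quantization of `∑_{α ∈ ℕ^{I × Λ}} V(α) M^α`. -/
def quantumHamiltonian (V : MultiIndex d → ℂ) (Λ : Finset (Site d)) : LocalAlgebra N Λ :=
  ∑' α : {α : MultiIndex d // sites α ⊆ Λ}, V α.1 • normalMonomial N Λ α.1

/-- The propagator `e^{-i s Ĥ_Λ t}`, `s = N/2`. -/
def propagator (V : MultiIndex d → ℂ) (Λ : Finset (Site d)) (t : ℝ) : LocalAlgebra N Λ :=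
  NormedSpace.exp ((-(Complex.I * ((N : ℂ) / 2) * (t : ℂ))) • quantumHamiltonian N V Λ)

/-- The finite-volume dynamics `𝒜 ↦ U^* 𝒜 U` with `U = e^{-i s Ĥ_Λ t} ∈ 𝔄_Λ`. -/
def finiteVolumeEvolution (V : MultiIndex d → ℂ) (Λ : Finset (Site d)) (t : ℝ)
    (a : QuasiLocal d N) : QuasiLocal d N :=
  star (QuasiLocal.ofLocal Λ (propagator N V Λ t)) * a *
    QuasiLocal.ofLocal Λ (propagator N V Λ t)

/-- The infinite-volume dynamics `α̂^t`: the norm limit of the finite-volume dynamics as `Λ`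
increases to `ℤ^d` along the directed set of all finite subsets. -/
def quantumEvolution (V : MultiIndex d → ℂ) (t : ℝ) (a : QuasiLocal d N) : QuasiLocal d N :=
  limUnder atTop fun Λ : Finset (Site d) => finiteVolumeEvolution N V Λ t a

end SpinOperators

/-! ### Coherent states -/

/-- The generator `(θ/√2) (e^{iφ} S_- - e^{-iφ} S_+)`, where `θ`, `φ` are polar angles of `v`. -/
def coherentGenerator (N : ℕ) (v : Vec3) : SpinMat N :=
  ((Real.arccos (v 2) / Real.sqrt 2 : ℝ) : ℂ) •
    (Complex.exp (Complex.I * (Complex.arg ((v 0 : ℂ) + Complex.I * (v 1 : ℂ)) : ℂ)) •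
        spinMatrix N .minus -
      Complex.exp (-(Complex.I * (Complex.arg ((v 0 : ℂ) + Complex.I * (v 1 : ℂ)) : ℂ))) •
        spinMatrix N .plus)

/-- The spin coherent state `|v⟩ = exp((θ/√2) (e^{iφ} S_- - e^{-iφ} S_+)) |s⟩`, with `|s⟩` the
highest-weight vector. -/
def coherentVector (N : ℕ) (v : Vec3) : Fin (N + 1) → ℂ :=
  Matrix.mulVec (NormedSpace.exp (coherentGenerator N v)) (Pi.single 0 1)

theorem star_coherentGenerator (N : ℕ) (v : Vec3) :
    star (coherentGenerator N v) = -coherentGenerator N v := by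
  have h1 : star (spinMatrix N .minus) = spinMatrix N .plus := by
    ext j k
    simp only [spinMatrix, Matrix.star_apply, Matrix.of_apply]
    split_ifs <;> simp
  have h2 : star (spinMatrix N .plus) = spinMatrix N .minus := by
    rw [← h1, star_star]
  have h3 : ∀ r : ℝ, star (Complex.exp (Complex.I * (r : ℂ))) =
      Complex.exp (-(Complex.I * (r : ℂ))) := by
    intro r
    rw [Complex.star_def, ← Complex.exp_conj]
    simp
  have h4 : ∀ r : ℝ, star (Complex.exp (-(Complex.I * (r : ℂ)))) =
      Complex.exp (Complex.I * (r : ℂ)) := by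
    intro r
    rw [← h3, star_star]
  rw [coherentGenerator, star_smul, star_sub, star_smul, star_smul, h1, h2, h3, h4]
  rw [Complex.star_def, Complex.conj_ofReal, ← smul_neg, neg_sub]

theorem sum_coherentVector (N : ℕ) (v : Vec3) :
    ∑ k, star (coherentVector N v k) * coherentVector N v k = 1 := by
  set U : SpinMat N := NormedSpace.exp (coherentGenerator N v) with hU
  have hUU : star U * U = 1 := by
    rw [hU, NormedSpace.star_exp, star_coherentGenerator,
      ← Matrix.exp_add_of_commute _ _ (Commute.neg_left (Commute.refl (coherentGenerator N v)))]
    simp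
  have h := congrFun (congrFun hUU 0) 0
  rw [Matrix.mul_apply] at h
  simpa [coherentVector, ← hU] using h

section ProductStates

variable {d : ℕ} (N : ℕ)

/-- The product vector `|M_Λ⟩ = ⨂_{x ∈ Λ} |M(x)⟩`. -/
def productVector (M : Site d → Vec3) (Λ : Finset (Site d)) : (Λ → Fin (N + 1)) → ℂ :=
  fun σ => ∏ x : Λ, coherentVector N (M x) (σ x)

/-- The expectation `⟨M_Λ, 𝒜 M_Λ⟩` of a local observable. -/
def localState (M : Site d → Vec3) (Λ : Finset (Site d)) (A : LocalAlgebra N Λ) : ℂ :=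
  dotProduct (star (productVector N M Λ)) (Matrix.mulVec A (productVector N M Λ))

theorem sum_prod_coherentVector {ι : Type*} [Fintype ι] [DecidableEq ι] (c : ι → Vec3) :
    ∑ σ : ι → Fin (N + 1), star (∏ x, coherentVector N (c x) (σ x)) *
      ∏ x, coherentVector N (c x) (σ x) = 1 := by
  have h := Finset.prod_univ_sum (fun _ : ι => (Finset.univ : Finset (Fin (N + 1))))
    (fun x k => star (coherentVector N (c x) k) * coherentVector N (c x) k)
  simp only [sum_coherentVector, Finset.prod_const_one, Fintype.piFinset_univ] at h
  rw [h]
  refine Finset.sum_congr rfl fun σ _ => ?_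
  rw [star_prod, Finset.prod_mul_distrib]

theorem productVector_split (M : Site d → Vec3) {Λ₁ Λ₂ : Finset (Site d)} (h : Λ₁ ⊆ Λ₂)
    (p : (Λ₁ → Fin (N + 1)) × ({y : Λ₂ // (y : Site d) ∉ Λ₁} → Fin (N + 1))) :
    productVector N M Λ₂ ((splitConfig N h).symm p) =
      productVector N M Λ₁ p.1 * ∏ y, coherentVector N (M (y.1 : Site d)) (p.2 y) := by
  rw [productVector, productVector,
    ← Fintype.prod_subtype_mul_prod_subtype (fun y : Λ₂ => (y : Site d) ∈ Λ₁)]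
  congr 1
  · let e : {y : Λ₂ // (y : Site d) ∈ Λ₁} ≃ Λ₁ :=
      { toFun := fun y => ⟨y.1, y.2⟩
        invFun := fun x => ⟨⟨x, h x.2⟩, x.2⟩
        left_inv := fun _ => rfl
        right_inv := fun _ => rfl }
    refine Fintype.prod_equiv e _ _ fun y => ?_
    simp [splitConfig, e, y.2]
  · refine Finset.prod_congr rfl fun y _ => ?_
    simp [splitConfig, y.2]

theorem localState_localEmbed (M : Site d → Vec3) {Λ₁ Λ₂ : Finset (Site d)} (h : Λ₁ ⊆ Λ₂)
    (A : LocalAlgebra N Λ₁) :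
    localState N M Λ₁ A = localState N M Λ₂ (localEmbed h A) := by
  have hA : ∀ p q, localEmbed h A ((splitConfig N h).symm p) ((splitConfig N h).symm q) =
      if p.2 = q.2 then A p.1 q.1 else 0 := by
    intro p q
    change A _ _ * (1 : Matrix _ _ ℂ) (splitConfig N h ((splitConfig N h).symm p)).2
      (splitConfig N h ((splitConfig N h).symm q)).2 = _
    rw [Equiv.apply_symm_apply, Equiv.apply_symm_apply, Matrix.one_apply]
    have e1 : (splitConfig N h ((splitConfig N h).symm p)).1 = p.1 := by
      rw [Equiv.apply_symm_apply]
    have e2 : (splitConfig N h ((splitConfig N h).symm q)).1 = q.1 := by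
      rw [Equiv.apply_symm_apply]
    simp
  simp only [localState, dotProduct, Matrix.mulVec, Pi.star_apply]
  rw [← (splitConfig N h).symm.sum_comp, Fintype.sum_prod_type]
  refine Finset.sum_congr rfl fun a _ => ?_
  have h1 := sum_prod_coherentVector N
    (fun y : {y : Λ₂ // (y : Site d) ∉ Λ₁} => M (y.1 : Site d))
  calc star (productVector N M Λ₁ a) * ∑ a', A a a' * productVector N M Λ₁ a'
      = (star (productVector N M Λ₁ a) * ∑ a', A a a' * productVector N M Λ₁ a') * 1 := by
        rw [mul_one]
    _ = _ := by
        rw [← h1, Finset.mul_sum]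
        refine Finset.sum_congr rfl fun b _ => ?_
        rw [← (splitConfig N h).symm.sum_comp, Fintype.sum_prod_type]
        simp only [hA, productVector_split, ite_mul, zero_mul, Finset.sum_ite_eq,
          Finset.mem_univ, if_true, star_mul']
        simp only [← mul_assoc, ← Finset.sum_mul]
        ring

theorem norm_localState_le (M : Site d → Vec3) (Λ : Finset (Site d)) (A : LocalAlgebra N Λ) :
    ‖localState N M Λ A‖ ≤ ‖A‖ := by
  set ψ : EuclideanSpace ℂ (Λ → Fin (N + 1)) := WithLp.toLp 2 (productVector N M Λ) with hψ
  have h1 : ‖ψ‖ = 1 := by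
    have h2 := sum_prod_coherentVector N (fun x : Λ => M x)
    have h3 : ‖ψ‖ ^ 2 = 1 := by
      rw [EuclideanSpace.norm_sq_eq]
      have : ((∑ σ, ‖ψ σ‖ ^ 2 : ℝ) : ℂ) = 1 := by
        rw [← h2, Complex.ofReal_sum]
        refine Finset.sum_congr rfl fun σ _ => ?_
        rw [Complex.star_def, Complex.conj_mul', Complex.ofReal_pow]
        rfl
      exact_mod_cast this
    nlinarith [norm_nonneg ψ]
  have h4 : localState N M Λ A =
      inner ℂ ψ (WithLp.toLp 2 (Matrix.mulVec A (productVector N M Λ))) := by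
    rw [EuclideanSpace.inner_eq_star_dotProduct, dotProduct_comm]
    rfl
  rw [h4]
  refine (norm_inner_le_norm _ _).trans ?_
  have h5 := Matrix.l2_opNorm_mulVec A ψ
  rw [h1, mul_one] at h5
  rw [h1, one_mul]
  exact h5

/-- The state `ρ_M` on the union of the local algebras. -/
def unionState (M : Site d → Vec3) : LocalUnion d N →L[ℂ] ℂ :=
  LinearMap.mkContinuous
    { toFun := LocalUnion.lift (localState N M) fun _ _ h A => localState_localEmbed N M h A
      map_add' := fun a b => by
        obtain ⟨Λ, A, B, rfl, rfl⟩ := LocalUnion.exists_of₂ a b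
        rw [← map_add]
        simp only [LocalUnion.lift_of]
        simp [localState, Matrix.add_mulVec, dotProduct_add]
      map_smul' := fun c a => by
        obtain ⟨Λ, A, rfl⟩ := LocalUnion.exists_of a
        rw [← map_smul]
        simp only [LocalUnion.lift_of]
        simp [localState, Matrix.smul_mulVec, dotProduct_smul] }
    1 fun a => by
      obtain ⟨Λ, A, rfl⟩ := LocalUnion.exists_of a
      rw [one_mul, LocalUnion.norm_of]
      exact norm_localState_le N M Λ A

/-- The coherent product state `ρ_M`, extended by continuity to the quasi-local algebra. -/
def coherentState (M : Site d → Vec3) : QuasiLocal d N →L[ℂ] ℂ :=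
  (unionState N M).extend QuasiLocal.ofUnion.toContinuousLinearMap

theorem coherentState_ofLocal (M : Site d → Vec3) (Λ : Finset (Site d)) (A : LocalAlgebra N Λ) :
    coherentState N M (QuasiLocal.ofLocal Λ A) = localState N M Λ A :=
  (unionState N M).extend_eq (e := QuasiLocal.ofUnion.toContinuousLinearMap)
    QuasiLocal.denseRange_ofUnion
    (QuasiLocal.ofUnion (d := d) (N := N)).isometry.isUniformInducing (LocalUnion.of Λ A)

end ProductStates

end SpinSystem

end

/-!
Both evolutions are read off on words, that is on noncommutative monomials in the `M_i(x)`. The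
commutator with `s Ĥ` of the operator of a word, and the Poisson bracket with the energy of the
corresponding classical monomial, are given by the same Leibniz expansion. Hence the function which
takes a word to its operator at time `t` and the function which takes it to its value at `M(t)`
solve the same linear equation, which does not depend on the spin. The weight `e^n` in `‖V‖` makes
the power series in time of this equation converge for `|t| ‖V‖ < 1` and bounded initial data (for
`s = 1/2`, where the rescaled spin operators are not contractions, on a shorter interval), with
bounds uniform in the spin and the volume. This gives the thermodynamic limit and the uniqueness of
the classical solution for short times; as the bounds on the operators and on the classical values
do not deteriorate in time, all times follow by iteration.

The difference of the quantum and the classical expectation solves the same equation. At time `0`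
it is `O(|w| s^{-1/2})`, because the coherent vector at `m` is an eigenvector of the spin component
along `m`, so that the fluctuations of the three rescaled components have total variance `1 / s`.
The power series propagates this rate for `|t| ‖V‖ < 1`, and iterating it gives convergence, without
a rate, locally uniformly in time.

Classical solutions exist because the vector field, cut off outside the unit ball, is bounded and
Lipschitz, and is tangent to the spheres.
-/

noncomputable section

namespace SpinSystem

/-! ### Taylor series with analytic bounds -/

section Taylor

variable {E : Type*} [NormedAddCommGroup E] [NormedSpace ℝ E]

theorem norm_sub_taylorWithinEval_univ_le {f : ℝ → E} {n : ℕ} {C : ℝ}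
    (hf : ContDiff ℝ (n + 1) f) (hC : ∀ t, ‖iteratedDeriv (n + 1) f t‖ ≤ C) (a x : ℝ) :
    ‖f x - taylorWithinEval f n Set.univ a x‖ ≤ C * |x - a| ^ (n + 1) / n.factorial := by
  have hderiv : ∀ t ∈ Set.uIcc a x, HasDerivWithinAt (fun t => taylorWithinEval f n Set.univ t x)
      (((n.factorial : ℝ)⁻¹ * (x - t) ^ n) • iteratedDeriv (n + 1) f t) (Set.uIcc a x) t := by
    intro t _
    have h := hasDerivWithinAt_taylorWithinEval (x := x) uniqueDiffOn_univ
      (Filter.univ_mem (f := 𝓝[Set.univ] t)) trivial subset_rfl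
      (hf.of_le (by exact_mod_cast n.le_succ)).contDiffOn
      (hf.contDiffOn.differentiableOn_iteratedDerivWithin (by exact_mod_cast n.lt_succ_self)
        uniqueDiffOn_univ t trivial)
    rw [iteratedDerivWithin_univ] at h
    exact h.mono (Set.subset_univ _)
  have hbound : ∀ t ∈ Set.uIcc a x, ‖((n.factorial : ℝ)⁻¹ * (x - t) ^ n) •
      iteratedDeriv (n + 1) f t‖ ≤ (n.factorial : ℝ)⁻¹ * |x - a| ^ n * C := by
    intro t ht
    rw [norm_smul, norm_mul, norm_inv, Real.norm_natCast, norm_pow, Real.norm_eq_abs]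
    have hta : |x - t| ≤ |x - a| := Set.abs_sub_right_of_mem_uIcc ht
    have := hC t
    gcongr
  have hmean := (convex_uIcc a x).norm_image_sub_le_of_norm_hasDerivWithin_le hderiv hbound
    Set.left_mem_uIcc Set.right_mem_uIcc
  rw [taylorWithinEval_self, Real.norm_eq_abs] at hmean
  refine hmean.trans_eq ?_
  rw [pow_succ]
  field_simp

theorem tendsto_taylorWithinEval_univ {f : ℝ → E} (hf : ContDiff ℝ (⊤ : ℕ∞) f) {C q : ℝ}
    (hq : 0 ≤ q) (hC : ∀ k t, ‖iteratedDeriv k f t‖ ≤ C * (k.factorial * q ^ k)) {a x : ℝ}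
    (hx : |x - a| * q < 1) :
    Tendsto (fun n => taylorWithinEval f n Set.univ a x) atTop (𝓝 (f x)) := by
  have hrem : ∀ n : ℕ, ‖taylorWithinEval f n Set.univ a x - f x‖ ≤
      C * ((n + 1 : ℕ) * (|x - a| * q) ^ (n + 1)) := by
    intro n
    rw [norm_sub_rev]
    refine (norm_sub_taylorWithinEval_univ_le (hf.of_le (mod_cast le_top)) (hC (n + 1))
      a x).trans_eq ?_
    rw [Nat.factorial_succ, mul_pow, Nat.cast_mul]
    field_simp
  refine tendsto_iff_norm_sub_tendsto_zero.2
    (squeeze_zero (fun _ => norm_nonneg _) hrem ?_)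
  have hgeom := tendsto_self_mul_const_pow_of_abs_lt_one
    (r := |x - a| * q) (by rwa [abs_of_nonneg (by positivity)])
  simpa only [mul_zero] using ((tendsto_add_atTop_iff_nat 1).2 hgeom).const_mul C

variable {f : ℕ → ℝ → E}

theorem iteratedDeriv_eq_of_hasDerivAt_succ (hf : ∀ k t, HasDerivAt (f k) (f (k + 1) t) t)
    (k : ℕ) : iteratedDeriv k (f 0) = f k := by
  induction k with
  | zero => exact iteratedDeriv_zero
  | succ k ih => rw [iteratedDeriv_succ, ih]; exact funext fun t => (hf k t).deriv

theorem contDiff_of_hasDerivAt_succ (hf : ∀ k t, HasDerivAt (f k) (f (k + 1) t) t) :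
    ContDiff ℝ (⊤ : ℕ∞) (f 0) :=
  contDiff_of_differentiable_iteratedDeriv fun k _ => by
    rw [iteratedDeriv_eq_of_hasDerivAt_succ hf]
    exact fun t => (hf k t).differentiableAt

end Taylor

/-! ### Bounded Lipschitz vector fields -/

section GlobalFlow

variable {E : Type*} [NormedAddCommGroup E] [NormedSpace ℝ E] {G : E → E}
  {K B : NNReal}

theorem exists_hasDerivAt_Ioo_of_lipschitzWith_of_norm_le [CompleteSpace E]
    (hG : LipschitzWith K G) (hB : ∀ x, ‖G x‖ ≤ B) (x₀ : E) {T : ℝ} (hT : 0 < T) :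
    ∃ f : ℝ → E, f 0 = x₀ ∧ ∀ t ∈ Set.Ioo (-T) T, HasDerivAt f (G (f t)) t := by
  have h0 : (0 : ℝ) ∈ Set.Icc (-T) T := ⟨by linarith, hT.le⟩
  have hp : IsPicardLindelof (fun _ => G) (⟨0, h0⟩ : Set.Icc (-T) T) x₀
      (B * T.toNNReal) 0 B K :=
    IsPicardLindelof.of_time_independent (fun x _ => hB x) hG.lipschitzOnWith
      (by simp [hT.le])
  obtain ⟨f, hf0, hf⟩ := hp.exists_eq_forall_mem_Icc_hasDerivWithinAt₀
  exact ⟨f, hf0, fun t ht =>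
    (hf t (Set.Ioo_subset_Icc_self ht)).hasDerivAt (Icc_mem_nhds ht.1 ht.2)⟩

theorem eqOn_Ioo_of_hasDerivAt (hG : LipschitzWith K G) {f g : ℝ → E} {S T : ℝ} (hS : 0 < S)
    (hST : S ≤ T) (hf : ∀ t ∈ Set.Ioo (-S) S, HasDerivAt f (G (f t)) t)
    (hg : ∀ t ∈ Set.Ioo (-T) T, HasDerivAt g (G (g t)) t) (h0 : f 0 = g 0) :
    Set.EqOn f g (Set.Ioo (-S) S) :=
  ODE_solution_unique_of_mem_Ioo (v := fun _ => G) (s := fun _ => Set.univ) (t₀ := 0)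
    (fun _ _ => hG.lipschitzOnWith) ⟨by linarith, hS⟩ (fun t ht => ⟨hf t ht, trivial⟩)
    (fun t ht => ⟨hg t ⟨by linarith [ht.1], by linarith [ht.2]⟩, trivial⟩) h0

theorem exists_hasDerivAt_of_lipschitzWith_of_norm_le [CompleteSpace E]
    (hG : LipschitzWith K G) (hB : ∀ x, ‖G x‖ ≤ B) (x₀ : E) :
    ∃ f : ℝ → E, f 0 = x₀ ∧ ∀ t, HasDerivAt f (G (f t)) t := by
  choose f hf0 hf using fun n : ℕ =>
    exists_hasDerivAt_Ioo_of_lipschitzWith_of_norm_le hG hB x₀ (n.cast_add_one_pos (α := ℝ))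
  have hcompat : ∀ n k : ℕ, n ≤ k → Set.EqOn (f n) (f k) (Set.Ioo (-(n + 1 : ℝ)) (n + 1)) :=
    fun n k hnk => eqOn_Ioo_of_hasDerivAt hG n.cast_add_one_pos (by gcongr) (hf n) (hf k)
      ((hf0 n).trans (hf0 k).symm)
  have hmem : ∀ t : ℝ, t ∈ Set.Ioo (-((⌈|t|⌉₊ : ℝ) + 1)) ((⌈|t|⌉₊ : ℝ) + 1) := fun t =>
    abs_lt.1 ((Nat.le_ceil |t|).trans_lt (lt_add_one _))
  refine ⟨fun t => f ⌈|t|⌉₊ t, by simp [hf0], fun t => ?_⟩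
  refine (hf _ t (hmem t)).congr_of_eventuallyEq ?_
  filter_upwards [Ioo_mem_nhds (hmem t).1 (hmem t).2] with s hs
  rcases le_total ⌈|s|⌉₊ ⌈|t|⌉₊ with h | h
  · exact hcompat _ _ h (hmem s)
  · exact (hcompat _ _ h hs).symm

end GlobalFlow

section UnitBall

variable {E : Type*} [NormedAddCommGroup E] [NormedSpace ℝ E]

/-- The radial projection on the closed unit ball, the identity on the ball itself. It serves to
cut off vector fields which are Lipschitz only on the ball. -/
def unitBallProj (v : E) : E := (max 1 ‖v‖)⁻¹ • v

theorem norm_unitBallProj_le (v : E) : ‖unitBallProj v‖ ≤ 1 := by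
  have h : 0 < max 1 ‖v‖ := lt_max_of_lt_left one_pos
  rw [unitBallProj, norm_smul, norm_inv, Real.norm_of_nonneg h.le, inv_mul_le_one₀ h]
  exact le_max_right _ _

theorem unitBallProj_of_norm_le_one {v : E} (h : ‖v‖ ≤ 1) : unitBallProj v = v := by
  rw [unitBallProj, max_eq_left h, inv_one, one_smul]

theorem smul_unitBallProj (v : E) : (max 1 ‖v‖) • unitBallProj v = v := by
  have h : 0 < max 1 ‖v‖ := lt_max_of_lt_left one_pos
  rw [unitBallProj, smul_smul, mul_inv_cancel₀ h.ne', one_smul]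

theorem norm_unitBallProj_sub_le (v w : E) :
    ‖unitBallProj v - unitBallProj w‖ ≤ 2 * ‖v - w‖ := by
  set a := max 1 ‖v‖
  set b := max 1 ‖w‖
  have ha : 1 ≤ a := le_max_left _ _
  have hb : 1 ≤ b := le_max_left _ _
  have hwb : ‖w‖ ≤ b := le_max_right _ _
  have hba : |b - a| ≤ ‖v - w‖ := by
    refine (abs_max_sub_max_le_max 1 ‖w‖ 1 ‖v‖).trans (max_le (by simp) ?_)
    exact (abs_norm_sub_norm_le w v).trans_eq (norm_sub_rev w v)
  have hscalar : ‖(a⁻¹ - b⁻¹) • w‖ ≤ ‖v - w‖ := by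
    rw [norm_smul, inv_sub_inv (by positivity) (by positivity), norm_div, Real.norm_eq_abs,
      Real.norm_of_nonneg (by positivity), div_mul_eq_mul_div, div_le_iff₀ (by positivity)]
    calc |b - a| * ‖w‖ ≤ ‖v - w‖ * b := by gcongr
      _ ≤ ‖v - w‖ * (a * b) := by
        gcongr
        exact le_mul_of_one_le_left (by linarith) ha
  calc ‖unitBallProj v - unitBallProj w‖ = ‖a⁻¹ • (v - w) + (a⁻¹ - b⁻¹) • w‖ := by
        rw [unitBallProj, unitBallProj]
        congr 1
        module
    _ ≤ ‖a⁻¹ • (v - w)‖ + ‖(a⁻¹ - b⁻¹) • w‖ := norm_add_le _ _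
    _ ≤ ‖v - w‖ + ‖v - w‖ := by
        refine add_le_add ?_ hscalar
        rw [norm_smul, norm_inv, Real.norm_of_nonneg (by positivity)]
        exact mul_le_of_le_one_left (norm_nonneg _) (inv_le_one_of_one_le₀ ha)
    _ = 2 * ‖v - w‖ := (two_mul _).symm

end UnitBall

theorem norm_eq_of_hasDerivAt_of_inner_eq_zero {E : Type*} [NormedAddCommGroup E]
    [InnerProductSpace ℝ E] {f f' : ℝ → E} (h : ∀ t, HasDerivAt f (f' t) t)
    (inner_eq_zero : ∀ t, inner ℝ (f t) (f' t) = 0) (s t : ℝ) : ‖f s‖ = ‖f t‖ := by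
  have norm_sq_deriv (t : ℝ) : HasDerivAt (fun t => ‖f t‖ ^ 2) 0 t :=
    (h t).norm_sq.congr_deriv (by rw [inner_eq_zero, mul_zero])
  exact (sq_eq_sq₀ (norm_nonneg _) (norm_nonneg _)).1
    (is_const_of_deriv_eq_zero (fun t => (norm_sq_deriv t).differentiableAt)
      (fun t => (norm_sq_deriv t).deriv) s t)

/-! ### Commutators, exponentials and rotations -/

theorem sum_take_mul_commutator_mul_drop {α A : Type*} [Ring A] (f : α → A) (x : A)
    (w : List α) :
    ∑ b : Fin w.length, ((w.take b).map f).prod * (x * f w[b.1] - f w[b.1] * x) *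
      ((w.drop (b + 1)).map f).prod = x * (w.map f).prod - (w.map f).prod * x := by
  induction w with
  | nil => simp
  | cons y w ih =>
    refine (Fin.sum_univ_succ (n := w.length) _).trans ?_
    simp only [Fin.val_zero, List.take_zero, List.map_nil, List.prod_nil, one_mul,
      List.getElem_cons_zero, List.drop_succ_cons, List.drop_zero, Fin.val_succ,
      List.take_succ_cons, List.map_cons, List.prod_cons, List.getElem_cons_succ, zero_add]
    have factor_out (b : Fin w.length) :
        f y * ((w.take b).map f).prod * (x * f w[b.1] - f w[b.1] * x) *
          ((w.drop (b + 1)).map f).prod =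
        f y * (((w.take b).map f).prod * (x * f w[b.1] - f w[b.1] * x) *
          ((w.drop (b + 1)).map f).prod) := by
      simp only [mul_assoc]
    simp only [factor_out]
    rw [← Finset.mul_sum, ih]
    noncomm_ring

theorem star_noncommProd {ι A : Type*} [Monoid A] [StarMul A] (s : Finset ι)
    (f g : ι → A) (hf : (s : Set ι).Pairwise (Function.onFun Commute f))
    (hg : (s : Set ι).Pairwise (Function.onFun Commute g)) (h : ∀ x ∈ s, star (f x) = g x) :
    star (s.noncommProd f hf) = s.noncommProd g hg := by
  classical
  induction s using Finset.induction_on with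
  | empty => simp
  | insert a s ha ih =>
    rw [Finset.noncommProd_insert_of_notMem _ _ _ _ ha,
      Finset.noncommProd_insert_of_notMem' _ _ _ _ ha, star_mul,
      ih _ (hg.mono (by simp)) fun x hx => h x (Finset.mem_insert_of_mem hx),
      h a (Finset.mem_insert_self a s)]

theorem sum_norm_sq_mulVec {m n 𝕜 : Type*} [Fintype m] [Fintype n] [RCLike 𝕜]
    (B : Matrix m n 𝕜) (v : n → 𝕜) :
    ((∑ k, ‖B.mulVec v k‖ ^ 2 : ℝ) : 𝕜) =
      dotProduct (star v) ((B.conjTranspose * B).mulVec v) := by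
  rw [← Matrix.mulVec_mulVec, Matrix.dotProduct_mulVec, ← Matrix.star_mulVec, dotProduct,
    RCLike.ofReal_sum]
  refine Finset.sum_congr rfl fun k _ => ?_
  rw [Pi.star_apply, RCLike.star_def, RCLike.conj_mul, RCLike.ofReal_pow]

section Exponential

variable {A : Type*} [NormedRing A] [NormedAlgebra ℝ A] [CompleteSpace A]

theorem exp_smul_mul_exp_smul_neg (Y : A) (t : ℝ) :
    NormedSpace.exp (t • Y) * NormedSpace.exp (t • -Y) = 1 := by
  let := NormedAlgebra.restrictScalars ℚ ℝ A
  rw [← NormedSpace.exp_add_of_commute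
    ((((Commute.refl Y).neg_right).smul_left t).smul_right t), smul_neg, add_neg_cancel,
    NormedSpace.exp_zero]

theorem hasDerivAt_exp_conj (Y : A) {X : ℝ → A} {X' : A} {t : ℝ} (hX : HasDerivAt X X' t) :
    HasDerivAt (fun τ => NormedSpace.exp (τ • -Y) * X τ * NormedSpace.exp (τ • Y))
      (NormedSpace.exp (t • -Y) * (X' + (X t * Y - Y * X t)) * NormedSpace.exp (t • Y)) t := by
  refine (((hasDerivAt_exp_smul_const (𝕂 := ℝ) (-Y) t).mul hX).mul
    (hasDerivAt_exp_smul_const' (𝕂 := ℝ) Y t)).congr_deriv ?_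
  simp only [Pi.mul_apply]
  noncomm_ring

/-- If `ad Y` acts on the plane of `P` and `Z` as the generator of a rotation, then `exp (θ Y)`
rotates it by the angle `θ`. -/
theorem sin_smul_add_cos_smul_mul_exp {Y P Z : A} (hP : P * Y - Y * P = Z)
    (hZ : Z * Y - Y * Z = -P) (θ : ℝ) :
    (Real.sin θ • P + Real.cos θ • Z) * NormedSpace.exp (θ • Y) =
      NormedSpace.exp (θ • Y) * Z := by
  set X : ℝ → A := fun τ => Real.sin τ • P + Real.cos τ • Z with hXdef
  set F : ℝ → A := fun τ => NormedSpace.exp (τ • -Y) * X τ * NormedSpace.exp (τ • Y) with hF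
  have hX (τ : ℝ) : HasDerivAt X (Real.cos τ • P + -Real.sin τ • Z) τ :=
    ((Real.hasDerivAt_sin τ).smul_const P).add ((Real.hasDerivAt_cos τ).smul_const Z)
  have commutator (τ : ℝ) : X τ * Y - Y * X τ = -(Real.cos τ • P + -Real.sin τ • Z) := by
    calc X τ * Y - Y * X τ
        = Real.sin τ • (P * Y - Y * P) + Real.cos τ • (Z * Y - Y * Z) := by
          simp only [hXdef, mul_add, add_mul, mul_smul_comm, smul_mul_assoc, smul_sub]
          abel
      _ = _ := by
          rw [hP, hZ, smul_neg, neg_smul]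
          abel
  have hasDerivAt_F (τ : ℝ) : HasDerivAt F 0 τ := by
    simpa only [commutator, add_neg_cancel, mul_zero, zero_mul] using
      hasDerivAt_exp_conj Y (hX τ)
  have F_eq : F θ = Z := by
    rw [is_const_of_deriv_eq_zero (fun τ => (hasDerivAt_F τ).differentiableAt)
      (fun τ => (hasDerivAt_F τ).deriv) θ 0]
    simp [hF, hXdef]
  calc X θ * NormedSpace.exp (θ • Y) = NormedSpace.exp (θ • Y) * F θ := by
        simp only [hF, ← mul_assoc, exp_smul_mul_exp_smul_neg, one_mul]
    _ = _ := by rw [F_eq]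

end Exponential

/-! ### Words in the spin variables -/

/-- Noncommutative monomials in the variables `M_i(x)`. -/
abbrev Word (d : ℕ) : Type := List (Site d × Ladder)

/-- The index `k` with `ε̃ i j k ≠ 0`, if there is one. -/
def Ladder.bracket : Ladder → Ladder → Ladder
  | .plus, .z => .plus
  | .z, .plus => .plus
  | .minus, .z => .minus
  | .z, .minus => .minus
  | _, _ => .z

theorem Ladder.sum_univ {M : Type*} [AddCommMonoid M] (f : Ladder → M) :
    ∑ k, f k = f .plus + (f .z + f .minus) := by
  rw [show (Finset.univ : Finset Ladder) = {.plus, .z, .minus} from rfl,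
    Finset.sum_insert (by decide), Finset.sum_insert (by decide), Finset.sum_singleton]

theorem sum_epsTilde_smul {E : Type*} [AddCommMonoid E] [Module ℂ E] (i j : Ladder)
    (f : Ladder → E) :
    ∑ k, epsTilde i j k • f k = epsTilde i j (i.bracket j) • f (i.bracket j) := by
  cases i <;> cases j <;> simp [Ladder.sum_univ, epsTilde, Ladder.bracket]

theorem norm_epsTilde_le (i j k : Ladder) : ‖epsTilde i j k‖ ≤ 1 := by
  cases i <;> cases j <;> cases k <;> simp [epsTilde]

section NormalWord

variable {d : ℕ}

/-- The word `∏_x M_i(x)^{α_i(x)}`, with `x` running through `Λ` in an arbitrary order. -/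
def ladderWord (i : Ladder) (α : MultiIndex d) (Λ : Finset (Site d)) : Word d :=
  Λ.toList.flatMap fun x => List.replicate (α (x, i)) (x, i)

/-- The normal-ordered word of the monomial `M^α`. -/
def normalWord (α : MultiIndex d) : Word d :=
  ladderWord .plus α (sites α) ++ ladderWord .z α (sites α) ++ ladderWord .minus α (sites α)

theorem apply_eq_zero_of_notMem_sites {α : MultiIndex d} {x : Site d} (h : x ∉ sites α)
    (i : Ladder) : α (x, i) = 0 := by
  by_contra h'
  exact h (Finset.mem_image.2 ⟨(x, i), Finsupp.mem_support_iff.2 h', rfl⟩)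

theorem count_ladderWord (i : Ladder) (α : MultiIndex d) (p : Site d × Ladder) :
    Multiset.count p (ladderWord i α (sites α) : Multiset (Site d × Ladder)) =
      if p.2 = i then α p else 0 := by
  obtain ⟨x, j⟩ := p
  rw [ladderWord, ← Multiset.coe_bind, Multiset.count_bind, Finset.coe_toList]
  simp only [Multiset.coe_replicate, Multiset.count_replicate, Prod.mk.injEq]
  rw [← Finset.sum_eq_multiset_sum]
  by_cases h : j = i
  · subst h
    simp only [and_true, if_true]
    rw [Finset.sum_ite_eq']
    split_ifs with hx
    · rfl
    · exact (apply_eq_zero_of_notMem_sites hx j).symm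
  · simp [h, Ne.symm h]

theorem coe_normalWord (α : MultiIndex d) :
    (normalWord α : Multiset (Site d × Ladder)) = Finsupp.toMultiset α := by
  ext p
  rw [Finsupp.count_toMultiset, normalWord, ← Multiset.coe_add, ← Multiset.coe_add]
  simp only [Multiset.count_add, count_ladderWord]
  rcases p with ⟨x, _ | _ | _⟩ <;> simp

theorem length_normalWord (α : MultiIndex d) : (normalWord α).length = α.degree := by
  rw [← Multiset.coe_card, coe_normalWord, Finsupp.card_toMultiset]
  rfl

theorem sum_map_normalWord {M : Type*} [AddCommMonoid M] (α : MultiIndex d) (x : Site d)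
    (f : Ladder → M) :
    ((normalWord α).map fun p => if p.1 = x then f p.2 else 0).sum = ∑ j, α (x, j) • f j := by
  rw [← Multiset.sum_coe, ← Multiset.map_coe, coe_normalWord, Finset.sum_multiset_map_count,
    Finsupp.toFinset_toMultiset]
  simp only [Finsupp.count_toMultiset]
  set fiber : Finset (Site d × Ladder) := Finset.univ.image fun j => (x, j) with hfiber
  have sum_fiber :
      ∑ j, α (x, j) • f j = ∑ p ∈ fiber, α p • (if p.1 = x then f p.2 else 0) := by
    rw [hfiber, Finset.sum_image fun i _ j _ h => (Prod.mk.inj h).2]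
    simp only [if_true]
  rw [sum_fiber, Finset.sum_subset (Finset.subset_union_left (s₂ := fiber)),
    ← Finset.sum_subset (Finset.subset_union_right (s₁ := α.support))]
  · rintro ⟨y, j⟩ _ hp
    rw [if_neg, smul_zero]
    rintro rfl
    exact hp (Finset.mem_image_of_mem _ (Finset.mem_univ j))
  · intro p _ hp
    rw [Finsupp.notMem_support_iff.1 hp, zero_smul]

theorem sum_map_normalWord_eq_siteDegree (α : MultiIndex d) (x : Site d) :
    ((normalWord α).map fun p => if p.1 = x then (1 : ℕ) else 0).sum = siteDegree α x := by
  rw [sum_map_normalWord α x fun _ => 1]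
  simp [siteDegree]

end NormalWord

/-! ### The Liouville operator on functions of words -/

section Liouville

variable {d : ℕ}

/-- The term of the Leibniz expansion of the bracket of the words `u` and `w` in which the letters
`u_a` and `w_b` are contracted: `w` with `w_b` replaced by the letter `{u_a, w_b}`, put in the place
of `u_a` in `u`. -/
def exchange (u w : Word d) (a : Fin u.length) (b : Fin w.length) : Word d :=
  u.take a ++ (w.take b ++ (u[a.1].1, u[a.1].2.bracket w[b.1].2) :: w.drop (b + 1)) ++
    u.drop (a + 1)

theorem length_exchange (u w : Word d) (a : Fin u.length) (b : Fin w.length) :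
    (exchange u w a b).length = w.length + u.length - 1 := by
  have ha := a.2
  have hb := b.2
  simp only [exchange, List.length_append, List.length_take, List.length_cons, List.length_drop]
  omega

/-- The structure constant of the Poisson bracket of the letters `p` and `q`. -/
def exchangeCoeff (p q : Site d × Ladder) : ℂ :=
  if p.1 = q.1 then Complex.I * epsTilde p.2 q.2 (p.2.bracket q.2) else 0

theorem norm_exchangeCoeff_le (p q : Site d × Ladder) :
    ‖exchangeCoeff p q‖ ≤ if p.1 = q.1 then 1 else 0 := by
  rw [exchangeCoeff]
  split_ifs
  · simpa using norm_epsTilde_le _ _ _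
  · simp

/-- The Poisson bracket `{u, w}` of two words, a linear combination of words by the Leibniz rule,
evaluated with the function `φ` of words. -/
def bracketSum {E : Type*} [AddCommMonoid E] [Module ℂ E] (u w : Word d) (φ : Word d → E) : E :=
  ∑ a : Fin u.length, ∑ b : Fin w.length, exchangeCoeff u[a.1] w[b.1] • φ (exchange u w a b)

/-- The operator dual to `w ↦ ∑_α V(α) {M^α, w}` on functions of words: both the classical and
the quantum dynamics of words are governed by it. -/
def liouville {E : Type*} [NormedAddCommGroup E] [NormedSpace ℂ E] (V : MultiIndex d → ℂ)
    (φ : Word d → E) (w : Word d) : E :=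
  ∑' α, V α • bracketSum (normalWord α) w φ

/-- The contribution `sup_x ∑_{|α| = n} |α(x)| |V(α)|` of the degree `n` to the norm of `V`, without
the factor `e^n`. -/
def shellNorm (V : MultiIndex d → ℂ) (n : ℕ) : ℝ≥0∞ :=
  ⨆ x : Site d, ∑' α : {α : MultiIndex d // α.degree = n}, ‖V α.1‖ₑ * siteDegree α.1 x

theorem potentialENorm_eq_tsum_shellNorm (V : MultiIndex d → ℂ) :
    potentialENorm V = ∑' n : ℕ, shellNorm V n * ENNReal.ofReal (Real.exp n) := by
  refine tsum_congr fun n => ?_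
  rw [shellNorm, ENNReal.iSup_mul]
  refine iSup_congr fun x => ?_
  rw [← ENNReal.tsum_mul_right]
  refine tsum_congr fun α => ?_
  rw [ENNReal.ofReal_mul (by positivity), ENNReal.ofReal_mul (by positivity), ofReal_norm,
    ENNReal.ofReal_natCast, mul_comm (siteDegree α.1 x : ℝ≥0∞)]

/-- The operator on functions of the length of a word which dominates the Liouville operator;
`p + n - 1` is truncated only at `p = n = 0`, where the factor `p` vanishes. -/
def majorant (V : MultiIndex d → ℂ) (g : ℕ → ℝ≥0∞) (p : ℕ) : ℝ≥0∞ :=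
  p * ∑' n, shellNorm V n * g (p + n - 1)

/-- The bound of the term with index `α` of the Liouville operator. -/
def termMajorant (V : MultiIndex d → ℂ) (g : ℕ → ℝ≥0∞) (w : Word d) (α : MultiIndex d) : ℝ≥0∞ :=
  ‖V α‖ₑ * ∑ b : Fin w.length, siteDegree α w[b.1].1 * g (w.length + α.degree - 1)

variable {E : Type*} [NormedAddCommGroup E] [NormedSpace ℂ E]

theorem enorm_bracketSum_le {g : ℕ → ℝ≥0∞} {φ : Word d → E} (hφ : ∀ v, ‖φ v‖ₑ ≤ g v.length)
    (α : MultiIndex d) (w : Word d) :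
    ‖bracketSum (normalWord α) w φ‖ₑ ≤
      ∑ b : Fin w.length, siteDegree α w[b.1].1 * g (w.length + α.degree - 1) := by
  rw [bracketSum, Finset.sum_comm]
  refine (enorm_sum_le _ _).trans (Finset.sum_le_sum fun b _ => ?_)
  refine (enorm_sum_le _ _).trans ?_
  rw [← sum_map_normalWord_eq_siteDegree, ← Fin.sum_univ_fun_getElem, Nat.cast_sum, Finset.sum_mul]
  refine Finset.sum_le_sum fun a _ => ?_
  rw [enorm_smul]
  refine mul_le_mul' ?_ ?_
  · rw [← ofReal_norm]
    refine (ENNReal.ofReal_le_ofReal (norm_exchangeCoeff_le _ _)).trans ?_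
    split_ifs <;> simp
  · refine (hφ _).trans_eq ?_
    rw [length_exchange, length_normalWord]

theorem tsum_termMajorant_le (V : MultiIndex d → ℂ) (g : ℕ → ℝ≥0∞) (w : Word d) :
    ∑' α, termMajorant V g w α ≤ majorant V g w.length := by
  simp only [termMajorant, Finset.mul_sum]
  rw [Summable.tsum_finsetSum fun _ _ => ENNReal.summable]
  have tsum_at_site_le (x : Site d) :
      ∑' α : MultiIndex d, ‖V α‖ₑ * (siteDegree α x * g (w.length + α.degree - 1)) ≤
        ∑' n, shellNorm V n * g (w.length + n - 1) := by
    rw [← ENNReal.tsum_fiberwise _ (Finsupp.degree : MultiIndex d → ℕ)]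
    refine ENNReal.tsum_le_tsum fun n => ?_
    have term_eq : ∀ α : (Finsupp.degree : MultiIndex d → ℕ) ⁻¹' {n},
        ‖V α.1‖ₑ * (siteDegree α.1 x * g (w.length + α.1.degree - 1)) =
        ‖V α.1‖ₑ * siteDegree α.1 x * g (w.length + n - 1) := by
      rintro ⟨α, rfl⟩
      rw [mul_assoc]
    rw [tsum_congr term_eq, ENNReal.tsum_mul_right]
    refine mul_le_mul' ?_ le_rfl
    exact le_iSup (fun x => ∑' α : {α : MultiIndex d // α.degree = n},
      ‖V α.1‖ₑ * siteDegree α.1 x) x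
  refine (Finset.sum_le_sum fun b _ => tsum_at_site_le _).trans ?_
  rw [Finset.sum_const, Finset.card_univ, Fintype.card_fin, nsmul_eq_mul, majorant]

theorem enorm_smul_bracketSum_le {V V' : MultiIndex d → ℂ} (hV : ∀ α, ‖V' α‖ ≤ ‖V α‖) {g : ℕ → ℝ≥0∞}
    {φ : Word d → E} (hφ : ∀ v, ‖φ v‖ₑ ≤ g v.length) (w : Word d) (α : MultiIndex d) :
    ‖V' α • bracketSum (normalWord α) w φ‖ₑ ≤ termMajorant V g w α := by
  rw [enorm_smul]
  exact mul_le_mul' (enorm_le_iff_norm_le.2 (hV α)) (enorm_bracketSum_le hφ α w)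

theorem termMajorant_ne_top {V : MultiIndex d → ℂ} {g : ℕ → ℝ≥0∞} {w : Word d}
    (h : majorant V g w.length ≠ ⊤) (α : MultiIndex d) : termMajorant V g w α ≠ ⊤ :=
  ne_top_of_le_ne_top h ((ENNReal.le_tsum α).trans (tsum_termMajorant_le V g w))

theorem summable_termMajorant {V : MultiIndex d → ℂ} {g : ℕ → ℝ≥0∞} {w : Word d}
    (h : majorant V g w.length ≠ ⊤) : Summable fun α => (termMajorant V g w α).toReal :=
  ENNReal.summable_toReal (ne_top_of_le_ne_top h (tsum_termMajorant_le V g w))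

theorem norm_smul_bracketSum_le {V V' : MultiIndex d → ℂ} (hV : ∀ α, ‖V' α‖ ≤ ‖V α‖) {g : ℕ → ℝ≥0∞}
    {φ : Word d → E} (hφ : ∀ v, ‖φ v‖ₑ ≤ g v.length) {w : Word d}
    (h : majorant V g w.length ≠ ⊤) (α : MultiIndex d) :
    ‖V' α • bracketSum (normalWord α) w φ‖ ≤ (termMajorant V g w α).toReal := by
  rw [← toReal_enorm]
  exact ENNReal.toReal_mono (termMajorant_ne_top h α) (enorm_smul_bracketSum_le hV hφ w α)

theorem summable_smul_bracketSum [CompleteSpace E] {V V' : MultiIndex d → ℂ}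
    (hV : ∀ α, ‖V' α‖ ≤ ‖V α‖) {g : ℕ → ℝ≥0∞} {φ : Word d → E}
    (hφ : ∀ v, ‖φ v‖ₑ ≤ g v.length) {w : Word d}
    (h : majorant V g w.length ≠ ⊤) :
    Summable fun α => V' α • bracketSum (normalWord α) w φ :=
  .of_norm_bounded (summable_termMajorant h) (norm_smul_bracketSum_le hV hφ h)

theorem enorm_liouville_le {V V' : MultiIndex d → ℂ} (hV : ∀ α, ‖V' α‖ ≤ ‖V α‖)
    {g : ℕ → ℝ≥0∞} {φ : Word d → E} (hφ : ∀ v, ‖φ v‖ₑ ≤ g v.length) (w : Word d) :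
    ‖liouville V' φ w‖ₑ ≤ majorant V g w.length :=
  (enorm_tsum_le_tsum_enorm).trans
    ((ENNReal.tsum_le_tsum (enorm_smul_bracketSum_le hV hφ w)).trans (tsum_termMajorant_le V g w))

theorem enorm_iterate_liouville_le {V V' : MultiIndex d → ℂ}
    (hV : ∀ α, ‖V' α‖ ≤ ‖V α‖) {g : ℕ → ℝ≥0∞} {φ : Word d → E}
    (hφ : ∀ v, ‖φ v‖ₑ ≤ g v.length) (k : ℕ) :
    ∀ w, ‖(liouville V')^[k] φ w‖ₑ ≤ (majorant V)^[k] g w.length := by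
  induction k with
  | zero => exact hφ
  | succ k ih =>
    intro w
    rw [Function.iterate_succ_apply', Function.iterate_succ_apply']
    exact enorm_liouville_le hV ih w

/-! ### Weights -/

theorem majorant_mono (V : MultiIndex d → ℂ) : Monotone (majorant V) := by
  intro g g' h p
  exact mul_le_mul' le_rfl (ENNReal.tsum_le_tsum fun n => mul_le_mul' le_rfl (h _))

theorem majorant_tsum (V : MultiIndex d → ℂ) (c : ℕ → ℝ≥0∞) (g : ℕ → ℕ → ℝ≥0∞) :
    majorant V (fun p => ∑' n, c n * g n p) = fun p => ∑' n, c n * majorant V (g n) p := by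
  funext p
  simp only [majorant, ← ENNReal.tsum_mul_left]
  rw [ENNReal.tsum_comm]
  refine tsum_congr fun n => tsum_congr fun m => ?_
  ring

theorem iterate_majorant_tsum (V : MultiIndex d → ℂ) (k : ℕ) (c : ℕ → ℝ≥0∞)
    (g : ℕ → ℕ → ℝ≥0∞) :
    (majorant V)^[k] (fun p => ∑' n, c n * g n p) =
      fun p => ∑' n, c n * (majorant V)^[k] (g n) p := by
  induction k with
  | zero => rfl
  | succ k ih => simp only [Function.iterate_succ_apply', ih, majorant_tsum]

/-- The weight `(p + m)^j R^{p + m}` of words of length `p`. -/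
def weight (R : ℝ) (j m p : ℕ) : ℝ≥0∞ := ENNReal.ofReal (((p + m : ℕ) : ℝ) ^ j * R ^ (p + m))

theorem majorant_weight_le (V : MultiIndex d → ℂ) {R : ℝ} (hR : 1 ≤ R) (j m : ℕ) :
    majorant V (weight R j m) ≤ fun p => ∑' n, shellNorm V n * weight R (j + 1) (m + n) p := by
  intro p
  rw [majorant, ← ENNReal.tsum_mul_left]
  refine ENNReal.tsum_le_tsum fun n => ?_
  rw [mul_left_comm]
  refine mul_le_mul' le_rfl ?_
  rw [weight, weight, ← ENNReal.ofReal_natCast, ← ENNReal.ofReal_mul (by positivity)]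
  refine ENNReal.ofReal_le_ofReal ?_
  have exponent_le : p + n - 1 + m ≤ p + (m + n) := by omega
  rw [pow_succ, mul_comm _ (((p + (m + n) : ℕ) : ℝ)), mul_assoc]
  gcongr
  omega

theorem weight_le {R r : ℝ} (hR : 1 ≤ R) (hr : 0 < r) (hRr : R * Real.exp r ≤ Real.exp 1)
    (j m p : ℕ) :
    weight R j m p ≤ ENNReal.ofReal ((j.factorial : ℝ) / r ^ j * Real.exp ((p + m : ℕ) : ℝ)) := by
  refine ENNReal.ofReal_le_ofReal ?_
  set q := p + m
  have pow_le_exp : r ^ j * (q : ℝ) ^ j ≤ Real.exp (r * q) * j.factorial := by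
    rw [← mul_pow, ← div_le_iff₀ (by positivity)]
    exact Real.pow_div_factorial_le_exp (r * q) (by positivity) j
  have exp_le : R ^ q * Real.exp (r * q) ≤ Real.exp q := by
    have pow_le := pow_le_pow_left₀ (by positivity) hRr q
    rwa [mul_pow, ← Real.exp_nat_mul, ← Real.exp_nat_mul, mul_one, mul_comm (q : ℝ) r] at pow_le
  rw [div_mul_eq_mul_div, le_div_iff₀ (by positivity)]
  calc (q : ℝ) ^ j * R ^ q * r ^ j = r ^ j * (q : ℝ) ^ j * R ^ q := by ring
    _ ≤ Real.exp (r * q) * j.factorial * R ^ q := by gcongr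
    _ = j.factorial * (R ^ q * Real.exp (r * q)) := by ring
    _ ≤ _ := by gcongr

theorem iterate_majorant_weight_le (V : MultiIndex d → ℂ) {R r : ℝ} (hR : 1 ≤ R) (hr : 0 < r)
    (hRr : R * Real.exp r ≤ Real.exp 1) (k j m p : ℕ) :
    (majorant V)^[k] (weight R j m) p ≤
      ENNReal.ofReal (((k + j).factorial : ℝ) / r ^ (k + j) * Real.exp ((p + m : ℕ) : ℝ)) *
        potentialENorm V ^ k := by
  induction k generalizing j m with
  | zero => simpa using weight_le hR hr hRr j m p
  | succ k ih =>
    rw [Function.iterate_succ_apply]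
    refine ((majorant_mono V).iterate k (majorant_weight_le V hR j m) p).trans ?_
    rw [iterate_majorant_tsum]
    refine (ENNReal.tsum_le_tsum fun n => mul_le_mul' le_rfl (ih (j + 1) (m + n))).trans_eq ?_
    have term_eq (n : ℕ) : shellNorm V n * (ENNReal.ofReal (((k + (j + 1)).factorial : ℝ) /
          r ^ (k + (j + 1)) * Real.exp ((p + (m + n) : ℕ) : ℝ)) * potentialENorm V ^ k) =
        (ENNReal.ofReal (((k + (j + 1)).factorial : ℝ) /
          r ^ (k + (j + 1)) * Real.exp ((p + m : ℕ) : ℝ)) * potentialENorm V ^ k) *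
          (shellNorm V n * ENNReal.ofReal (Real.exp n)) := by
      rw [← add_assoc p m n, Nat.cast_add (p + m), Real.exp_add, ← mul_assoc (_ / _),
        ENNReal.ofReal_mul (by positivity)]
      simp only [mul_assoc, mul_comm, mul_left_comm]
    rw [tsum_congr term_eq, ENNReal.tsum_mul_left, ← potentialENorm_eq_tsum_shellNorm, pow_succ,
      mul_assoc, show k + 1 + j = k + (j + 1) by ring]

end Liouville

/-! ### The Liouville flow -/

section Flow

variable {d : ℕ} {E F : Type*} [NormedAddCommGroup E] [NormedSpace ℂ E]
  [NormedAddCommGroup F] [NormedSpace ℂ F]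

/-- The function `φ` of words is bounded by `c |w|^j R^{|w|}`. -/
structure HasGrowth (c : ℝ) (j : ℕ) (R : ℝ) (φ : Word d → E) : Prop where
  nonneg : 0 ≤ c
  norm_le : ∀ w, ‖φ w‖ ≤ c * ((w.length : ℝ) ^ j * R ^ w.length)

/-- The growth `R^{|w|}` of functions of words is compatible with the exponential weight in `‖V‖`:
it leads to a Liouville flow for times `|t| ‖V‖ < r`. -/
structure IsFlowRadius (V : MultiIndex d → ℂ) (R r : ℝ) : Prop where
  finite : potentialENorm V < ⊤
  one_le : 1 ≤ R
  pos : 0 < r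
  mul_exp_le : R * Real.exp r ≤ Real.exp 1

/-- The bound of `c |w|^j R^{|w|}` for words of length `p`, as an extended number. -/
def growthBound (c : ℝ) (j : ℕ) (R : ℝ) (p : ℕ) : ℝ≥0∞ := ENNReal.ofReal c * weight R j 0 p

/-- The bound of the `k`-th term of the Liouville flow at time `τ` and at a word of length `p`, for
functions of growth `|w|^j R^{|w|}`. -/
def flowBound (V : MultiIndex d → ℂ) (r τ : ℝ) (j p k : ℕ) : ℝ :=
  Real.exp p / r ^ j * (((k + j).descFactorial j : ℝ) * (τ * potentialNorm V / r) ^ k)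

/-- The flow generated by the Liouville operator, as a power series in time. -/
def flow (V : MultiIndex d → ℂ) (t : ℝ) (φ : Word d → E) (w : Word d) : E :=
  ∑' k : ℕ, (t ^ k / k.factorial : ℝ) • (liouville V)^[k] φ w

variable {V V' : MultiIndex d → ℂ} {R r c t τ : ℝ} {j : ℕ} {φ ψ : Word d → E}

theorem potentialNorm_nonneg (V : MultiIndex d → ℂ) : 0 ≤ potentialNorm V :=
  ENNReal.toReal_nonneg

theorem isFlowRadius_one (hV : potentialENorm V < ⊤) : IsFlowRadius V 1 1 :=
  ⟨hV, le_rfl, one_pos, by rw [one_mul]⟩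

theorem isFlowRadius_three_halves (hV : potentialENorm V < ⊤) :
    IsFlowRadius V (3 / 2) (1 / 2) := by
  refine ⟨hV, by norm_num, by norm_num, ?_⟩
  calc 3 / 2 * Real.exp (1 / 2) ≤ Real.exp (1 / 2) * Real.exp (1 / 2) := by
        gcongr
        linarith [Real.add_one_le_exp (1 / 2 : ℝ)]
    _ = Real.exp 1 := by rw [← Real.exp_add, add_halves]

theorem hasGrowth_of_norm_le_pow {E : Type*} [NormedAddCommGroup E] {φ : Word d → E}
    (h : ∀ w, ‖φ w‖ ≤ R ^ w.length) : HasGrowth 1 0 R φ :=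
  ⟨zero_le_one, fun w => by rw [one_mul, pow_zero, one_mul]; exact h w⟩

theorem HasGrowth.enorm_le {E : Type*} [NormedAddCommGroup E] {φ : Word d → E}
    (h : HasGrowth c j R φ) (w : Word d) :
    ‖φ w‖ₑ ≤ growthBound c j R w.length := by
  rw [← ofReal_norm, growthBound, weight, add_zero, ← ENNReal.ofReal_mul h.nonneg]
  exact ENNReal.ofReal_le_ofReal (h.norm_le w)

theorem iterate_majorant_const_mul (V : MultiIndex d → ℂ) (c : ℝ≥0∞) (g : ℕ → ℝ≥0∞) (k : ℕ) :
    (majorant V)^[k] (fun p => c * g p) = fun p => c * (majorant V)^[k] g p := by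
  induction k with
  | zero => rfl
  | succ k ih =>
    simp only [Function.iterate_succ_apply', ih]
    funext p
    simp only [majorant, mul_left_comm _ c, ENNReal.tsum_mul_left]

theorem IsFlowRadius.iterate_majorant_growthBound_le (h : IsFlowRadius V R r) (hc : 0 ≤ c)
    (j k p : ℕ) :
    (majorant V)^[k] (growthBound c j R) p ≤
      ENNReal.ofReal (c * (((k + j).factorial : ℝ) / r ^ (k + j) * Real.exp p) *
        potentialNorm V ^ k) := by
  have hr := h.pos
  refine (congrFun (iterate_majorant_const_mul V (ENNReal.ofReal c) (weight R j 0) k) p).trans_le ?_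
  rw [mul_assoc c, ENNReal.ofReal_mul hc, ENNReal.ofReal_mul (by positivity), potentialNorm,
    ENNReal.ofReal_pow ENNReal.toReal_nonneg, ENNReal.ofReal_toReal h.finite.ne]
  exact mul_le_mul' le_rfl (iterate_majorant_weight_le V h.one_le hr h.mul_exp_le k j 0 p)

theorem IsFlowRadius.iterate_majorant_growthBound_ne_top (h : IsFlowRadius V R r) (hc : 0 ≤ c)
    (j k p : ℕ) : (majorant V)^[k] (growthBound c j R) p ≠ ⊤ :=
  ne_top_of_le_ne_top ENNReal.ofReal_ne_top (h.iterate_majorant_growthBound_le hc j k p)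

theorem IsFlowRadius.majorant_iterate_majorant_ne_top (h : IsFlowRadius V R r) (hc : 0 ≤ c)
    (j k p : ℕ) : majorant V ((majorant V)^[k] (growthBound c j R)) p ≠ ⊤ := by
  rw [← Function.iterate_succ_apply' (majorant V)]
  exact h.iterate_majorant_growthBound_ne_top hc j (k + 1) p

theorem norm_iterate_liouville_le (h : IsFlowRadius V R r) (hV : ∀ α, ‖V' α‖ ≤ ‖V α‖)
    (hφ : HasGrowth c j R φ) (k : ℕ) (w : Word d) :
    ‖(liouville V')^[k] φ w‖ ≤
      c * (((k + j).factorial : ℝ) / r ^ (k + j) * Real.exp w.length) * potentialNorm V ^ k := by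
  have hr := h.pos
  have hc := hφ.nonneg
  have hV0 := potentialNorm_nonneg V
  rw [← ENNReal.ofReal_le_ofReal_iff (by positivity), ofReal_norm]
  exact (enorm_iterate_liouville_le hV hφ.enorm_le k w).trans
    (h.iterate_majorant_growthBound_le hc j k w.length)

theorem summable_iterate_liouville [CompleteSpace E] (h : IsFlowRadius V R r)
    (hV : ∀ α, ‖V' α‖ ≤ ‖V α‖) (hφ : HasGrowth c j R φ) (k : ℕ) (w : Word d) :
    Summable fun α => V' α • bracketSum (normalWord α) w ((liouville V')^[k] φ) :=
  summable_smul_bracketSum hV (enorm_iterate_liouville_le hV hφ.enorm_le k)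
    (h.majorant_iterate_majorant_ne_top hφ.nonneg j k w.length)

theorem summable_flowBound (hr : 0 < r) (hτ0 : 0 ≤ τ) (hτ : τ * potentialNorm V < r) (j p : ℕ) :
    Summable (flowBound V r τ j p) := by
  refine Summable.mul_left _ (summable_descFactorial_mul_geometric_of_norm_lt_one j ?_)
  have hV0 := potentialNorm_nonneg V
  rwa [Real.norm_of_nonneg (by positivity), div_lt_one hr]

theorem norm_flowTerm_le (h : IsFlowRadius V R r) (hV : ∀ α, ‖V' α‖ ≤ ‖V α‖)
    (hφ : HasGrowth c j R φ) (ht : |t| ≤ τ) (k : ℕ) (w : Word d) :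
    ‖(t ^ k / k.factorial : ℝ) • (liouville V')^[k] φ w‖ ≤ c * flowBound V r τ j w.length k := by
  have hr := h.pos
  have hτ0 : 0 ≤ τ := (abs_nonneg t).trans ht
  have factorial_eq : ((k + j).factorial : ℝ) = k.factorial * (k + j).descFactorial j := by
    have := Nat.factorial_mul_descFactorial (n := k + j) (k := j) (Nat.le_add_left _ _)
    rw [Nat.add_sub_cancel] at this
    exact_mod_cast this.symm
  calc ‖(t ^ k / k.factorial : ℝ) • (liouville V')^[k] φ w‖
      = |t| ^ k / k.factorial * ‖(liouville V')^[k] φ w‖ := by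
        rw [norm_smul, norm_div, norm_pow, Real.norm_eq_abs, Real.norm_natCast]
    _ ≤ τ ^ k / k.factorial * (c * (((k + j).factorial : ℝ) / r ^ (k + j) * Real.exp w.length) *
          potentialNorm V ^ k) := by
        gcongr
        exact norm_iterate_liouville_le h hV hφ k w
    _ = c * flowBound V r τ j w.length k := by
        rw [flowBound, factorial_eq, div_pow, mul_pow, pow_add]
        field_simp

theorem summable_flow [CompleteSpace E] (h : IsFlowRadius V R r) (hV : ∀ α, ‖V' α‖ ≤ ‖V α‖)
    (hφ : HasGrowth c j R φ) (ht : |t| * potentialNorm V < r) (w : Word d) :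
    Summable fun k : ℕ => (t ^ k / k.factorial : ℝ) • (liouville V')^[k] φ w :=
  .of_norm_bounded ((summable_flowBound h.pos (abs_nonneg t) ht j w.length).mul_left c)
    fun k => norm_flowTerm_le h hV hφ le_rfl k w

theorem norm_flow_le (h : IsFlowRadius V R r) (hV : ∀ α, ‖V' α‖ ≤ ‖V α‖)
    (hφ : HasGrowth c j R φ) (ht : |t| ≤ τ) (hτ : τ * potentialNorm V < r) (w : Word d) :
    ‖flow V' t φ w‖ ≤ c * ∑' k, flowBound V r τ j w.length k :=
  tsum_of_norm_bounded
    ((summable_flowBound h.pos ((abs_nonneg t).trans ht) hτ j w.length).hasSum.mul_left c)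
    fun k => norm_flowTerm_le h hV hφ ht k w

/-! ### Linearity of the flow -/

theorem bracketSum_map {E F : Type*} [AddCommMonoid E] [Module ℂ E] [AddCommMonoid F] [Module ℂ F]
    (L : E →ₗ[ℂ] F) (u w : Word d) (φ : Word d → E) :
    bracketSum u w (fun v => L (φ v)) = L (bracketSum u w φ) := by
  simp only [bracketSum, map_sum, map_smul]

theorem bracketSum_sub {E : Type*} [AddCommGroup E] [Module ℂ E] (u w : Word d)
    (φ ψ : Word d → E) :
    bracketSum u w (fun v => φ v - ψ v) = bracketSum u w φ - bracketSum u w ψ := by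
  simp only [bracketSum, smul_sub, Finset.sum_sub_distrib]

theorem iterate_liouville_zero (V : MultiIndex d → ℂ) (k : ℕ) :
    (liouville V)^[k] (fun _ => (0 : E)) = fun _ => 0 := by
  induction k with
  | zero => rfl
  | succ k ih =>
    rw [Function.iterate_succ_apply', ih]
    funext w
    simp only [liouville, bracketSum, smul_zero, Finset.sum_const_zero, tsum_zero]

theorem flow_zero (V : MultiIndex d → ℂ) (t : ℝ) (w : Word d) :
    flow V t (fun _ => (0 : E)) w = 0 := by
  simp only [flow, iterate_liouville_zero, smul_zero, tsum_zero]

theorem iterate_liouville_map [CompleteSpace E] (h : IsFlowRadius V R r)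
    (hV : ∀ α, ‖V' α‖ ≤ ‖V α‖) (L : E →L[ℂ] F) (hφ : HasGrowth c j R φ) (k : ℕ) :
    (liouville V')^[k] (fun v => L (φ v)) = fun w => L ((liouville V')^[k] φ w) := by
  induction k with
  | zero => rfl
  | succ k ih =>
    simp only [Function.iterate_succ_apply', ih]
    funext w
    rw [liouville, liouville, L.map_tsum (summable_iterate_liouville h hV hφ k w)]
    exact tsum_congr fun α => by
      rw [map_smul]
      exact congrArg _ (bracketSum_map L.toLinearMap _ w _)

theorem flow_map [CompleteSpace E] (h : IsFlowRadius V R r) (hV : ∀ α, ‖V' α‖ ≤ ‖V α‖)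
    (L : E →L[ℂ] F) (hφ : HasGrowth c j R φ) (ht : |t| * potentialNorm V < r) (w : Word d) :
    flow V' t (fun v => L (φ v)) w = L (flow V' t φ w) := by
  rw [flow, flow, L.map_tsum (summable_flow h hV hφ ht w)]
  exact tsum_congr fun k => by rw [iterate_liouville_map h hV L hφ, L.map_smul_of_tower]

theorem iterate_liouville_sub [CompleteSpace E] (h : IsFlowRadius V R r)
    (hV : ∀ α, ‖V' α‖ ≤ ‖V α‖) (hφ : HasGrowth c j R φ) (hψ : HasGrowth c j R ψ) (k : ℕ) :
    (liouville V')^[k] (fun v => φ v - ψ v) =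
      fun w => (liouville V')^[k] φ w - (liouville V')^[k] ψ w := by
  induction k with
  | zero => rfl
  | succ k ih =>
    simp only [Function.iterate_succ_apply', ih]
    funext w
    rw [liouville, liouville, liouville, ← (summable_iterate_liouville h hV hφ k w).tsum_sub
      (summable_iterate_liouville h hV hψ k w)]
    exact tsum_congr fun α => by rw [bracketSum_sub, smul_sub]

theorem flow_sub [CompleteSpace E] (h : IsFlowRadius V R r) (hV : ∀ α, ‖V' α‖ ≤ ‖V α‖)
    (hφ : HasGrowth c j R φ) (hψ : HasGrowth c j R ψ) (ht : |t| * potentialNorm V < r)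
    (w : Word d) :
    flow V' t (fun v => φ v - ψ v) w = flow V' t φ w - flow V' t ψ w := by
  rw [flow, flow, flow, ← (summable_flow h hV hφ ht w).tsum_sub (summable_flow h hV hψ ht w)]
  exact tsum_congr fun k => by rw [iterate_liouville_sub h hV hφ hψ, smul_sub]

/-! ### Continuity of the flow -/

section Convergence

variable {ι : Type*} {ℱ : Filter ι} {W : ι → MultiIndex d → ℂ} {Φ : ι → Word d → E}

theorem tendsto_bracketSum (hΦ : ∀ v, Tendsto (fun i => Φ i v) ℱ (𝓝 (φ v))) (u w : Word d) :
    Tendsto (fun i => bracketSum u w (Φ i)) ℱ (𝓝 (bracketSum u w φ)) :=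
  tendsto_finsetSum _ fun _ _ => tendsto_finsetSum _ fun _ _ => (hΦ _).const_smul _

theorem tendsto_iterate_liouville [CompleteSpace E] (h : IsFlowRadius V R r)
    (hW : ∀ i α, ‖W i α‖ ≤ ‖V α‖) (hWV : ∀ α, Tendsto (fun i => W i α) ℱ (𝓝 (V' α)))
    (hΦ : ∀ᶠ i in ℱ, HasGrowth c j R (Φ i))
    (hΦφ : ∀ v, Tendsto (fun i => Φ i v) ℱ (𝓝 (φ v))) (k : ℕ) (w : Word d) :
    Tendsto (fun i => (liouville (W i))^[k] (Φ i) w) ℱ (𝓝 ((liouville V')^[k] φ w)) := by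
  obtain rfl | _ := ℱ.eq_or_neBot
  · exact tendsto_bot
  obtain ⟨_, hi⟩ := hΦ.exists
  induction k generalizing w with
  | zero => exact hΦφ w
  | succ k ih =>
    simp only [Function.iterate_succ_apply']
    have ne_top := h.majorant_iterate_majorant_ne_top hi.nonneg j k w.length
    refine tendsto_tsum_of_dominated_convergence (summable_termMajorant ne_top)
      (fun α => (hWV α).smul (tendsto_bracketSum ih _ w)) ?_
    filter_upwards [hΦ] with i hi α
    exact norm_smul_bracketSum_le (hW i) (enorm_iterate_liouville_le (hW i) hi.enorm_le k) ne_top α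

theorem tendsto_flow [CompleteSpace E] (h : IsFlowRadius V R r)
    (hW : ∀ i α, ‖W i α‖ ≤ ‖V α‖) (hWV : ∀ α, Tendsto (fun i => W i α) ℱ (𝓝 (V' α)))
    (hΦ : ∀ᶠ i in ℱ, HasGrowth c j R (Φ i)) (hΦφ : ∀ v, Tendsto (fun i => Φ i v) ℱ (𝓝 (φ v)))
    (ht : |t| * potentialNorm V < r) (w : Word d) :
    Tendsto (fun i => flow (W i) t (Φ i) w) ℱ (𝓝 (flow V' t φ w)) := by
  refine tendsto_tsum_of_dominated_convergence
    ((summable_flowBound h.pos (abs_nonneg t) ht j w.length).mul_left c)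
    (fun k => (tendsto_iterate_liouville h hW hWV hΦ hΦφ k w).const_smul _) ?_
  filter_upwards [hΦ] with i hi k
  exact norm_flowTerm_le h (hW i) hi le_rfl k w

end Convergence

/-! ### Solutions of the Liouville equation -/

section Solutions

variable {φ φ' : ℝ → Word d → E}

theorem hasDerivAt_bracketSum (hφ : ∀ v, HasDerivAt (fun t => φ t v) (φ' t v) t) (u w : Word d) :
    HasDerivAt (fun t => bracketSum u w (φ t)) (bracketSum u w (φ' t)) t :=
  HasDerivAt.fun_sum fun _ _ => HasDerivAt.fun_sum fun _ _ => (hφ _).const_smul (_ : ℂ)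

theorem hasDerivAt_liouville [CompleteSpace E] {g g' : ℕ → ℝ≥0∞} (hV : ∀ α, ‖V' α‖ ≤ ‖V α‖)
    (hφ : ∀ t v, HasDerivAt (fun t => φ t v) (φ' t v) t) (hg : ∀ t v, ‖φ t v‖ₑ ≤ g v.length)
    (hg' : ∀ t v, ‖φ' t v‖ₑ ≤ g' v.length) (w : Word d) (h : majorant V g w.length ≠ ⊤)
    (h' : majorant V g' w.length ≠ ⊤) (t : ℝ) :
    HasDerivAt (fun t => liouville V' (φ t) w) (liouville V' (φ' t) w) t :=
  hasDerivAt_tsum (summable_termMajorant h')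
    (fun α t => (hasDerivAt_bracketSum (hφ t) _ w).const_smul (V' α))
    (fun α t => norm_smul_bracketSum_le hV (hg' t) h' α) (summable_smul_bracketSum hV (hg t) h) t

theorem hasDerivAt_iterate_liouville [CompleteSpace E] (h : IsFlowRadius V R r)
    (hV : ∀ α, ‖V' α‖ ≤ ‖V α‖) (hφ : ∀ t v, HasDerivAt (fun t => φ t v) (liouville V' (φ t) v) t)
    (growth : ∀ t, HasGrowth c j R (φ t)) (k : ℕ) (t : ℝ) (v : Word d) :
    HasDerivAt (fun t => (liouville V')^[k] (φ t) v) ((liouville V')^[k + 1] (φ t) v) t := by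
  have enorm_le (k : ℕ) (t : ℝ) := enorm_iterate_liouville_le hV (growth t).enorm_le k
  have ne_top (k p : ℕ) := h.majorant_iterate_majorant_ne_top (growth t).nonneg j k p
  induction k generalizing t v with
  | zero => exact hφ t v
  | succ k ih =>
    simp only [Function.iterate_succ_apply' (liouville V') k]
    rw [Function.iterate_succ_apply' (liouville V') (k + 1)]
    exact hasDerivAt_liouville hV ih (enorm_le k) (enorm_le (k + 1)) v (ne_top k _)
      (ne_top (k + 1) _) t

theorem eq_flow_of_hasDerivAt [CompleteSpace E] (h : IsFlowRadius V R r)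
    (hV : ∀ α, ‖V' α‖ ≤ ‖V α‖) (hφ : ∀ t v, HasDerivAt (fun t => φ t v) (liouville V' (φ t) v) t)
    (growth : ∀ t, HasGrowth c 0 R (φ t)) (t : ℝ) (hτ : |τ| * potentialNorm V < r) (w : Word d) :
    φ (t + τ) w = flow V' τ (φ t) w := by
  have hr := h.pos
  have hV0 := potentialNorm_nonneg V
  set f : ℕ → ℝ → E := fun k t => (liouville V')^[k] (φ t) w
  have hasDerivAt_f (k : ℕ) (t : ℝ) : HasDerivAt (f k) (f (k + 1) t) t :=
    hasDerivAt_iterate_liouville h hV hφ growth k t w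
  have norm_deriv_le (k : ℕ) (t : ℝ) : ‖iteratedDeriv k (f 0) t‖ ≤
      c * Real.exp w.length * (k.factorial * (potentialNorm V / r) ^ k) := by
    rw [iteratedDeriv_eq_of_hasDerivAt_succ hasDerivAt_f]
    refine (norm_iterate_liouville_le h hV (growth t) k w).trans_eq ?_
    rw [div_pow, add_zero]
    field_simp
  have taylor_eq (n : ℕ) : taylorWithinEval (f 0) n Set.univ t (t + τ) =
      ∑ k ∈ Finset.range (n + 1), (τ ^ k / k.factorial : ℝ) • f k t := by
    simp only [taylor_within_apply, iteratedDerivWithin_univ, add_sub_cancel_left,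
      iteratedDeriv_eq_of_hasDerivAt_succ hasDerivAt_f, div_eq_inv_mul]
  have tendsto_taylor := tendsto_taylorWithinEval_univ (contDiff_of_hasDerivAt_succ hasDerivAt_f)
    (by positivity) norm_deriv_le (a := t) (x := t + τ)
    (by rwa [add_sub_cancel_left, ← mul_div_assoc, div_lt_one hr])
  simp only [taylor_eq] at tendsto_taylor
  exact tendsto_nhds_unique tendsto_taylor ((tendsto_add_atTop_iff_nat 1).2
    (summable_flow h hV (growth t) hτ w).hasSum.tendsto_sum_nat)

end Solutions

end Flow

theorem forall_time_of_small_steps {P : ℝ → Prop} {b r : ℝ} (hr : 0 < r) (zero : P 0)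
    (add : ∀ t τ, |τ| * b < r → P t → P (t + τ)) (t : ℝ) : P t := by
  have step_tendsto := tendsto_const_div_atTop_nhds_zero_nat (|t| * b)
  obtain ⟨n, step_lt, n_pos⟩ :=
    ((step_tendsto.eventually_lt_const hr).and (eventually_gt_atTop 0)).exists
  have n_ne_zero : (n : ℝ) ≠ 0 := by exact_mod_cast n_pos.ne'
  have multiple (k : ℕ) : P (k * (t / n)) := by
    induction k with
    | zero => simpa only [Nat.cast_zero, zero_mul] using zero
    | succ k ih =>
      rw [Nat.cast_succ, add_one_mul]
      exact add _ _ (by rwa [abs_div, Nat.abs_cast, div_mul_eq_mul_div]) ih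
  simpa only [mul_div_cancel₀ t n_ne_zero] using multiple n

/-! ### Spin matrices -/

section SpinMatrices

theorem star_spinMatrix_minus (N : ℕ) : star (spinMatrix N .minus) = spinMatrix N .plus := by
  ext j k
  simp only [spinMatrix, Matrix.star_apply, Matrix.of_apply]
  split_ifs <;> simp

theorem star_spinMatrix (N : ℕ) (i : Ladder) : star (spinMatrix N i) = spinMatrix N i.conj := by
  cases i
  · exact star_eq_iff_star_eq.2 (star_spinMatrix_minus N)
  · simp [spinMatrix, Ladder.conj, Matrix.star_eq_conjTranspose, Matrix.diagonal_conjTranspose,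
      Pi.star_def]
  · exact star_spinMatrix_minus N

theorem spinMatrix_plus_mul_minus (N : ℕ) : spinMatrix N .plus * spinMatrix N .minus =
    Matrix.diagonal fun j : Fin (N + 1) => (((j + 1 : ℝ) * (N - j) / 2 : ℝ) : ℂ) := by
  ext j k
  rw [Matrix.mul_apply, Matrix.diagonal_apply]
  simp only [spinMatrix, Matrix.of_apply]
  obtain hj | hj := (Nat.lt_succ_iff.1 j.2).lt_or_eq
  · rw [Finset.sum_eq_single (⟨j + 1, by omega⟩ : Fin (N + 1))
      (fun l _ hl => by rw [if_neg fun h => hl (Fin.ext h.symm), zero_mul]) (by simp)]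
    by_cases hjk : j = k
    · subst hjk
      have hjN : (j : ℝ) ≤ N := by exact_mod_cast hj.le
      rw [if_pos rfl, if_pos rfl, ← Complex.ofReal_mul,
        Real.mul_self_sqrt (by push_cast; nlinarith)]
      push_cast
      ring
    · rw [if_neg hjk, if_neg fun h => hjk (Fin.ext (Nat.succ_injective h).symm), mul_zero]
  · rw [Finset.sum_eq_zero fun l _ => by rw [if_neg (by omega), zero_mul]]
    simp [hj]

theorem spinMatrix_minus_mul_plus (N : ℕ) : spinMatrix N .minus * spinMatrix N .plus =
    Matrix.diagonal fun j : Fin (N + 1) => (((j : ℝ) * (N + 1 - j) / 2 : ℝ) : ℂ) := by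
  ext j k
  rw [Matrix.mul_apply, Matrix.diagonal_apply]
  simp only [spinMatrix, Matrix.of_apply]
  obtain hj | hj := Nat.eq_zero_or_pos (j : ℕ)
  · rw [Finset.sum_eq_zero fun l _ => by rw [if_neg (by omega), zero_mul]]
    simp [hj]
  · rw [Finset.sum_eq_single (⟨j - 1, by omega⟩ : Fin (N + 1))
      (fun l _ hl => by rw [if_neg fun h => hl (Fin.ext (by simp; omega)), zero_mul]) (by simp)]
    have pred_add_one : (j : ℕ) - 1 + 1 = j := Nat.sub_add_cancel hj
    by_cases hjk : j = k
    · subst hjk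
      have hjN : (0 : ℝ) ≤ N + 1 - j := sub_nonneg.2 (by exact_mod_cast j.2.le)
      rw [if_pos pred_add_one, if_pos rfl, ← Complex.ofReal_mul,
        Real.mul_self_sqrt (by positivity)]
    · rw [if_neg hjk, if_neg (fun h => hjk (Fin.ext (pred_add_one.symm.trans h))), mul_zero]

theorem commutator_spinMatrix_plus_minus (N : ℕ) :
    spinMatrix N .plus * spinMatrix N .minus - spinMatrix N .minus * spinMatrix N .plus =
      spinMatrix N .z := by
  rw [spinMatrix_plus_mul_minus, spinMatrix_minus_mul_plus, Matrix.diagonal_sub, spinMatrix]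
  congr 1
  funext j
  push_cast
  ring

theorem commutator_spinMatrix_z_plus (N : ℕ) :
    spinMatrix N .z * spinMatrix N .plus - spinMatrix N .plus * spinMatrix N .z =
      spinMatrix N .plus := by
  ext j k
  simp only [spinMatrix, Matrix.sub_apply, Matrix.diagonal_mul, Matrix.mul_diagonal,
    Matrix.of_apply]
  split_ifs with h
  · rw [← h]
    push_cast
    ring
  · simp

theorem commutator_spinMatrix_z_minus (N : ℕ) :
    spinMatrix N .z * spinMatrix N .minus - spinMatrix N .minus * spinMatrix N .z =
      -spinMatrix N .minus := by
  ext j k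
  simp only [spinMatrix, Matrix.sub_apply, Matrix.diagonal_mul, Matrix.mul_diagonal,
    Matrix.of_apply, Matrix.neg_apply]
  split_ifs with h
  · rw [← h]
    push_cast
    ring
  · simp

theorem commutator_spinMatrix (N : ℕ) (i j : Ladder) :
    spinMatrix N i * spinMatrix N j - spinMatrix N j * spinMatrix N i =
      epsTilde i j (i.bracket j) • spinMatrix N (i.bracket j) := by
  have plus_minus := commutator_spinMatrix_plus_minus N
  have z_plus := commutator_spinMatrix_z_plus N
  have z_minus := commutator_spinMatrix_z_minus N
  cases i <;> cases j <;> simp only [epsTilde, Ladder.bracket, sub_self, zero_smul, one_smul,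
    neg_smul]
  · rw [← neg_sub, z_plus]
  · exact plus_minus
  · exact z_plus
  · exact z_minus
  · rw [← neg_sub, plus_minus]
  · rw [← neg_sub, z_minus, neg_neg]

theorem norm_spinMatrix_plus_le {N : ℕ} {b : ℝ} (hb : 0 ≤ b)
    (h : ∀ j : ℕ, j ≤ N → (j + 1 : ℝ) * (N - j) / 2 ≤ b ^ 2) : ‖spinMatrix N .plus‖ ≤ b := by
  have norm_sq : ‖spinMatrix N .plus * spinMatrix N .minus‖ =
      ‖spinMatrix N .plus‖ * ‖spinMatrix N .plus‖ := by
    rw [← CStarRing.norm_self_mul_star, star_spinMatrix, Ladder.conj]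
  refine le_of_sq_le_sq ?_ hb
  rw [sq, ← norm_sq, spinMatrix_plus_mul_minus, Matrix.l2_opNorm_diagonal,
    pi_norm_le_iff_of_nonneg (sq_nonneg b)]
  intro j
  have hj := Nat.lt_succ_iff.1 j.2
  have hjN : (0 : ℝ) ≤ N - j := sub_nonneg.2 (by exact_mod_cast hj)
  rw [Complex.norm_real, Real.norm_of_nonneg (by positivity)]
  exact h j hj

theorem norm_spinMatrix_z_le (N : ℕ) : ‖spinMatrix N .z‖ ≤ (N : ℝ) / 2 := by
  rw [spinMatrix, Matrix.l2_opNorm_diagonal, pi_norm_le_iff_of_nonneg (by positivity)]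
  intro j
  have hjN : (j : ℝ) ≤ N := by exact_mod_cast Nat.lt_succ_iff.1 j.2
  rw [show (N : ℂ) / 2 - (j : ℂ) = ((N / 2 - j : ℝ) : ℂ) by push_cast; rfl, Complex.norm_real,
    Real.norm_eq_abs, abs_le]
  constructor <;> linarith [(Nat.cast_nonneg j : (0 : ℝ) ≤ (j : ℕ))]

theorem norm_spinMatrix_le {N : ℕ} {b : ℝ} (hb : (N : ℝ) / 2 ≤ b)
    (h : ∀ j : ℕ, j ≤ N → (j + 1 : ℝ) * (N - j) / 2 ≤ b ^ 2) (i : Ladder) :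
    ‖spinMatrix N i‖ ≤ b := by
  have norm_plus_le := norm_spinMatrix_plus_le (le_trans (by positivity) hb) h
  cases i
  · exact norm_plus_le
  · exact (norm_spinMatrix_z_le N).trans hb
  · rwa [← norm_star, star_spinMatrix]

/-- `R` bounds the norms of the rescaled spin operators of spin `N / 2`. -/
structure IsSpinBound (N : ℕ) (R : ℝ) : Prop where
  one_le : 1 ≤ R
  norm_le : ∀ i, ‖((N : ℂ) / 2)⁻¹ • spinMatrix N i‖ ≤ R

theorem isSpinBound_of_forall_le {N : ℕ} (hN : 1 ≤ N) {R : ℝ} (hR : 1 ≤ R)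
    (h : ∀ j : ℕ, j ≤ N → (j + 1 : ℝ) * (N - j) / 2 ≤ (R * (N / 2)) ^ 2) : IsSpinBound N R := by
  refine ⟨hR, fun i => ?_⟩
  rw [norm_smul, norm_inv, norm_div, Complex.norm_natCast, Complex.norm_ofNat,
    inv_mul_le_iff₀ (half_pos (by exact_mod_cast hN)), mul_comm]
  exact norm_spinMatrix_le (le_mul_of_one_le_left (by positivity) hR) h i

theorem isSpinBound_three_halves {N : ℕ} (hN : 1 ≤ N) : IsSpinBound N (3 / 2) := by
  refine isSpinBound_of_forall_le hN (by norm_num) fun j _ => ?_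
  have hN1 : (1 : ℝ) ≤ N := by exact_mod_cast hN
  nlinarith [sq_nonneg ((2 * j + 1 : ℝ) - N)]

theorem isSpinBound_one {N : ℕ} (hN : 2 ≤ N) : IsSpinBound N 1 := by
  refine isSpinBound_of_forall_le (by omega) le_rfl fun j hj => ?_
  obtain rfl | hN := hN.eq_or_lt
  · interval_cases j <;> norm_num
  · have hN3 : (3 : ℝ) ≤ N := by exact_mod_cast hN
    nlinarith [sq_nonneg ((2 * j + 1 : ℝ) - N)]

end SpinMatrices

/-! ### Spin operators in the quasi-local algebra -/

section Operators

variable {d : ℕ} {N : ℕ} {Λ Λ₁ Λ₂ : Finset (Site d)}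

theorem tensorOp_mulSingle_apply (x : Λ) (A : SpinMat N) (σ τ : Λ → Fin (N + 1)) :
    tensorOp N (Pi.mulSingle x A) σ τ =
      A (σ x) (τ x) * ∏ y ∈ Finset.univ.erase x, (1 : SpinMat N) (σ y) (τ y) := by
  rw [tensorOp, Matrix.of_apply, ← Finset.mul_prod_erase _ _ (Finset.mem_univ x),
    Pi.mulSingle_eq_same]
  refine congrArg _ (Finset.prod_congr rfl fun y hy => ?_)
  rw [Pi.mulSingle_eq_of_ne (Finset.ne_of_mem_erase hy)]

theorem tensorOp_one : tensorOp N (1 : Λ → SpinMat N) = 1 := by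
  ext σ τ
  simp only [tensorOp, Matrix.of_apply, Pi.one_apply, Matrix.one_apply, funext_iff,
    Fintype.prod_ite_zero, Finset.prod_const_one]

theorem star_tensorOp (B : Λ → SpinMat N) : star (tensorOp N B) = tensorOp N (star B) := by
  ext σ τ
  simp only [tensorOp, Matrix.star_apply, Matrix.of_apply, star_prod, Pi.star_apply]

/-- The inclusion of the algebra of a single site `x ∈ Λ` in `𝔄_Λ`. -/
def siteHom (x : Λ) : SpinMat N →⋆ₐ[ℂ] LocalAlgebra N Λ where
  toFun A := tensorOp N (Pi.mulSingle x A)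
  map_one' := by rw [Pi.mulSingle_one, tensorOp_one]
  map_mul' A B := by rw [tensorOp_mul, Pi.mulSingle_mul]; rfl
  map_zero' := by
    ext σ τ
    rw [tensorOp_mulSingle_apply, Matrix.zero_apply, Matrix.zero_apply, zero_mul]
  map_add' A B := by
    ext σ τ
    simp only [Matrix.add_apply, tensorOp_mulSingle_apply, add_mul]
  commutes' c := by
    rw [Algebra.algebraMap_eq_smul_one, Algebra.algebraMap_eq_smul_one, ← tensorOp_one,
      ← Pi.mulSingle_one x]
    ext σ τ
    simp only [Matrix.smul_apply, tensorOp_mulSingle_apply, smul_mul_assoc]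
  map_star' A := by rw [star_tensorOp, Pi.star_mulSingle]

theorem spinOp_eq_siteHom (x : Λ) (i : Ladder) :
    spinOp N x i = siteHom x (((N : ℂ) / 2)⁻¹ • spinMatrix N i) := rfl

theorem star_spinOp (x : Λ) (i : Ladder) : star (spinOp N x i) = spinOp N x i.conj := by
  rw [spinOp_eq_siteHom, spinOp_eq_siteHom, ← map_star, star_smul, star_spinMatrix]
  simp only [star_inv₀, star_div₀, star_natCast, star_ofNat]

theorem localEmbed_tensorOp (h : Λ₁ ⊆ Λ₂) (B : Λ₁ → SpinMat N) :
    localEmbed h (tensorOp N B) =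
      tensorOp N fun y : Λ₂ => if hy : (y : Site d) ∈ Λ₁ then B ⟨y, hy⟩ else 1 := by
  ext σ τ
  rw [localEmbed_apply, tensorOp, tensorOp, Matrix.of_apply, Matrix.of_apply,
    ← Fintype.prod_subtype_mul_prod_subtype (fun y : Λ₂ => (y : Site d) ∈ Λ₁)]
  have prod_inside : ∏ y : {y : Λ₂ // (y : Site d) ∈ Λ₁},
      (if hy : (y.1 : Site d) ∈ Λ₁ then B ⟨y.1, hy⟩ else 1) (σ y) (τ y) =
        ∏ x, B x (σ ⟨x, h x.2⟩) (τ ⟨x, h x.2⟩) :=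
    Fintype.prod_equiv (Equiv.subtypeSubtypeEquivSubtype fun hx => h hx) _ _ fun y => by
      rw [dif_pos y.2]; rfl
  have prod_outside : ∏ y : {y : Λ₂ // ¬ (y : Site d) ∈ Λ₁},
      (if hy : (y.1 : Site d) ∈ Λ₁ then B ⟨y.1, hy⟩ else 1) (σ y) (τ y) =
        if ∀ y : Λ₂, (y : Site d) ∉ Λ₁ → σ y = τ y then 1 else 0 := by
    refine (Finset.prod_congr rfl fun y _ => ?_).trans
      ((Fintype.prod_ite_zero (p := fun y : {y : Λ₂ // ¬ (y : Site d) ∈ Λ₁} => σ y = τ y)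
        (f := fun _ => (1 : ℂ))).trans ?_)
    · rw [dif_neg y.2, Matrix.one_apply]
    · simp only [Finset.prod_const_one, Subtype.forall]
  rw [prod_inside, prod_outside, mul_ite, mul_one, mul_zero]

theorem localEmbed_spinOp (h : Λ₁ ⊆ Λ₂) (x : Λ₁) (i : Ladder) :
    localEmbed h (spinOp N x i) = spinOp N ⟨x, h x.2⟩ i := by
  rw [spinOp, spinOp, localEmbed_tensorOp]
  congr 1
  funext y
  by_cases hyx : (y : Site d) = x
  · obtain rfl : y = ⟨x, h x.2⟩ := Subtype.ext hyx
    rw [dif_pos x.2, Function.update_self, Function.update_self]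
  · rw [Function.update_of_ne fun hy => hyx (congrArg Subtype.val hy)]
    split_ifs
    · rw [Function.update_of_ne fun hy => hyx (congrArg Subtype.val hy)]
    · rfl

theorem norm_ofLocal (A : LocalAlgebra N Λ) : ‖QuasiLocal.ofLocal Λ A‖ = ‖A‖ :=
  (LinearIsometry.norm_map QuasiLocal.ofUnion _).trans (LocalUnion.norm_of Λ A)

theorem ofLocal_localEmbed (h : Λ₁ ⊆ Λ₂) (A : LocalAlgebra N Λ₁) :
    QuasiLocal.ofLocal Λ₂ (localEmbed h A) = QuasiLocal.ofLocal Λ₁ A :=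
  congrArg QuasiLocal.ofUnion (LocalUnion.of_localEmbed h A)

theorem norm_one_quasiLocal : ‖(1 : QuasiLocal d N)‖ = 1 := by
  rw [← map_one (QuasiLocal.ofLocal (∅ : Finset (Site d))), norm_ofLocal, CStarRing.norm_one]

variable (N) in
/-- The rescaled spin operator `Ŝ_i(x)` as an element of the quasi-local algebra. -/
def letterOp (p : Site d × Ladder) : QuasiLocal d N :=
  QuasiLocal.ofLocal {p.1} (spinOp N ⟨p.1, Finset.mem_singleton_self _⟩ p.2)

variable (N) in
/-- The operator of a word. -/
def wordOp (w : Word d) : QuasiLocal d N := (w.map (letterOp N)).prod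

theorem ofLocal_spinOp (x : Λ) (i : Ladder) :
    QuasiLocal.ofLocal Λ (spinOp N x i) = letterOp N ((x : Site d), i) := by
  have singleton_subset : ({(x : Site d)} : Finset (Site d)) ⊆ Λ :=
    Finset.singleton_subset_iff.2 x.2
  rw [letterOp, ← ofLocal_localEmbed singleton_subset, localEmbed_spinOp]

theorem norm_letterOp_le {R : ℝ} (hN : IsSpinBound N R) (p : Site d × Ladder) :
    ‖letterOp N p‖ ≤ R := by
  rw [letterOp, norm_ofLocal, spinOp_eq_siteHom]
  exact (NonUnitalStarAlgHom.norm_apply_le (siteHom _) _).trans (hN.norm_le p.2)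

theorem norm_wordOp_le {R : ℝ} (hN : IsSpinBound N R) (w : Word d) :
    ‖wordOp N w‖ ≤ R ^ w.length := by
  have hR : 0 ≤ R := zero_le_one.trans hN.one_le
  induction w with
  | nil => simp [wordOp, norm_one_quasiLocal]
  | cons p w ih =>
    rw [List.length_cons, pow_succ', wordOp, List.map_cons, List.prod_cons]
    exact (norm_mul_le _ _).trans
      (mul_le_mul (norm_letterOp_le hN p) ih (norm_nonneg _) hR)

theorem commute_letterOp {p q : Site d × Ladder} (h : p.1 ≠ q.1) :
    Commute (letterOp N p) (letterOp N q) := by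
  have ofLocal_left : QuasiLocal.ofLocal {p.1, q.1} (spinOp N ⟨p.1, by simp⟩ p.2) = letterOp N p :=
    ofLocal_spinOp _ _
  have ofLocal_right : QuasiLocal.ofLocal {p.1, q.1} (spinOp N ⟨q.1, by simp⟩ q.2) = letterOp N q :=
    ofLocal_spinOp _ _
  rw [← ofLocal_left, ← ofLocal_right]
  exact (commute_spinOp N (fun e => h (congrArg Subtype.val e)) _ _).map _

theorem letterOp_commutator (hN : 1 ≤ N) (p q : Site d × Ladder) :
    (Complex.I * ((N : ℂ) / 2)) • (letterOp N p * letterOp N q - letterOp N q * letterOp N p) =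
      exchangeCoeff p q • letterOp N (p.1, p.2.bracket q.2) := by
  obtain ⟨x, i⟩ := p
  obtain ⟨y, j⟩ := q
  by_cases h : x = y
  · subst h
    have hN0 : (N : ℂ) ≠ 0 := by exact_mod_cast (by omega : N ≠ 0)
    rw [exchangeCoeff, if_pos rfl]
    simp only [letterOp, spinOp_eq_siteHom, ← map_mul, ← map_sub, ← map_smul]
    congr 2
    rw [smul_mul_smul_comm, smul_mul_smul_comm, ← smul_sub, commutator_spinMatrix]
    simp only [smul_smul]
    congr 1
    field_simp
  · rw [(commute_letterOp (p := (x, i)) (q := (y, j)) h).eq, sub_self, smul_zero, exchangeCoeff,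
      if_neg h, zero_smul]

theorem sum_exchangeCoeff_smul_wordOp_exchange (hN : 1 ≤ N) (u w : Word d) (a : Fin u.length) :
    ∑ b : Fin w.length, exchangeCoeff u[a.1] w[b.1] • wordOp N (exchange u w a b) =
      (Complex.I * ((N : ℂ) / 2)) • (wordOp N (u.take a) *
        (letterOp N u[a.1] * wordOp N w - wordOp N w * letterOp N u[a.1]) *
          wordOp N (u.drop (a + 1))) := by
  have smul_comm_inside (z : ℂ) (A B X C D : QuasiLocal d N) :
      z • (A * (B * (X * C)) * D) = A * (B * (z • X * C)) * D := by
    simp only [smul_mul_assoc, mul_smul_comm]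
  simp only [wordOp]
  rw [← sum_take_mul_commutator_mul_drop, Finset.mul_sum, Finset.sum_mul, Finset.smul_sum]
  refine Finset.sum_congr rfl fun b _ => ?_
  simp only [exchange, List.map_append, List.map_cons, List.prod_append, List.prod_cons]
  rw [smul_comm_inside, ← letterOp_commutator hN, ← smul_comm_inside]
  simp only [mul_assoc]

theorem bracketSum_wordOp (hN : 1 ≤ N) (u w : Word d) :
    bracketSum u w (wordOp N) =
      (Complex.I * ((N : ℂ) / 2)) • (wordOp N u * wordOp N w - wordOp N w * wordOp N u) := by
  have sum_left : ∑ a : Fin u.length, wordOp N (u.take a) *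
      (wordOp N w * letterOp N u[a.1] - letterOp N u[a.1] * wordOp N w) *
        wordOp N (u.drop (a + 1)) = wordOp N w * wordOp N u - wordOp N u * wordOp N w :=
    sum_take_mul_commutator_mul_drop (letterOp N) (wordOp N w) u
  simp only [bracketSum, sum_exchangeCoeff_smul_wordOp_exchange hN, ← Finset.smul_sum]
  congr 1
  rw [← neg_sub, ← sum_left, ← Finset.sum_neg_distrib]
  refine Finset.sum_congr rfl fun a _ => ?_
  rw [← neg_mul, ← mul_neg, neg_sub]

theorem wordOp_append (u w : Word d) : wordOp N (u ++ w) = wordOp N u * wordOp N w := by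
  rw [wordOp, List.map_append, List.prod_append, wordOp, wordOp]

end Operators

/-! ### Normal ordering -/

section NormalOrder

variable {d : ℕ} {N : ℕ} {Λ : Finset (Site d)}

theorem pairwise_commute_letterOp_pow (i : Ladder) (α : MultiIndex d) (s : Set (Site d)) :
    s.Pairwise (Function.onFun Commute fun x => letterOp N (x, i) ^ α (x, i)) :=
  fun x _ y _ h => (commute_letterOp (N := N) (p := (x, i)) (q := (y, i)) h).pow_pow _ _

theorem wordOp_flatMap_replicate (f : Site d → ℕ) (i : Ladder) (l : List (Site d)) :
    wordOp N (l.flatMap fun x => List.replicate (f x) (x, i)) =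
      (l.map fun x => letterOp N (x, i) ^ f x).prod := by
  induction l with
  | nil => rfl
  | cons x l ih =>
    rw [List.flatMap_cons, wordOp_append, ih, List.map_cons, List.prod_cons, wordOp,
      List.map_replicate, List.prod_replicate]

theorem wordOp_ladderWord (i : Ladder) (α : MultiIndex d) (Λ : Finset (Site d)) :
    wordOp N (ladderWord i α Λ) = Λ.noncommProd (fun x => letterOp N (x, i) ^ α (x, i))
      (pairwise_commute_letterOp_pow i α _) := by
  rw [ladderWord, wordOp_flatMap_replicate (fun x => α (x, i)), ← Finset.noncommProd_toFinset
    Λ.toList _ (pairwise_commute_letterOp_pow i α _) Λ.nodup_toList]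
  exact Finset.noncommProd_congr Λ.toList_toFinset (fun _ _ => rfl) _

theorem wordOp_ladderWord_of_subset {α : MultiIndex d} (h : sites α ⊆ Λ) (i : Ladder) :
    wordOp N (ladderWord i α Λ) = wordOp N (ladderWord i α (sites α)) := by
  rw [wordOp_ladderWord, wordOp_ladderWord]
  have prod_union := Finset.noncommProd_union_of_disjoint
    (Finset.disjoint_sdiff (s := sites α) (t := Λ))
    (fun x => letterOp N (x, i) ^ α (x, i)) (pairwise_commute_letterOp_pow i α _)
  rw [Finset.noncommProd_eq_pow_card (Λ \ sites α) _ _ 1 fun x hx => by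
    rw [apply_eq_zero_of_notMem_sites (Finset.mem_sdiff.1 hx).2, pow_zero], one_pow,
    mul_one] at prod_union
  rw [← prod_union]
  exact Finset.noncommProd_congr (Finset.union_sdiff_of_subset h).symm (fun _ _ => rfl) _

theorem ofLocal_ladderProd (i : Ladder) (α : MultiIndex d) (Λ : Finset (Site d)) :
    QuasiLocal.ofLocal Λ (ladderProd N i α Λ) = wordOp N (ladderWord i α Λ) := by
  rw [wordOp_ladderWord]
  refine (Finset.map_noncommProd Finset.univ (fun x : Λ => spinOp N x i ^ α ((x : Site d), i))
    (fun _ _ _ _ h => (commute_spinOp N h i i).pow_pow _ _) (QuasiLocal.ofLocal Λ)).trans ?_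
  have map_val : (Finset.univ : Finset Λ).val.map
      (fun x : Λ => QuasiLocal.ofLocal Λ (spinOp N x i ^ α ((x : Site d), i))) =
      Λ.val.map fun x => letterOp N (x, i) ^ α (x, i) := by
    have attach_val : (Finset.univ : Finset Λ).val.map Subtype.val = Λ.val :=
      Multiset.attach_map_val _
    conv_rhs => rw [← attach_val, Multiset.map_map]
    refine Multiset.map_congr rfl fun x _ => ?_
    rw [map_pow, ofLocal_spinOp]
    rfl
  unfold Finset.noncommProd
  congr 1

theorem ofLocal_normalMonomial {α : MultiIndex d} (h : sites α ⊆ Λ) :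
    QuasiLocal.ofLocal Λ (normalMonomial N Λ α) = wordOp N (normalWord α) := by
  simp only [normalMonomial, map_mul, ofLocal_ladderProd, normalWord, wordOp_append,
    wordOp_ladderWord_of_subset h]

theorem quantize_eq_sum_wordOp (A : PolyObs d) :
    quantize N A = ∑ α ∈ A.support, A.coeff α • wordOp N (normalWord α) :=
  Finset.sum_congr rfl fun α _ => by rw [ofLocal_normalMonomial subset_rfl]

theorem Ladder.conj_conj (i : Ladder) : i.conj.conj = i := by cases i <;> rfl

theorem conjIndex_apply (α : MultiIndex d) (x : Site d) (i : Ladder) :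
    conjIndex α (x, i) = α (x, i.conj) := by
  have conj_injective : Function.Injective fun p : Site d × Ladder => (p.1, p.2.conj) :=
    Function.Injective.prodMap Function.injective_id (Function.LeftInverse.injective
      Ladder.conj_conj)
  simpa only [conjIndex, Ladder.conj_conj] using
    Finsupp.mapDomain_apply conj_injective α (x, i.conj)

theorem conjIndex_conjIndex (α : MultiIndex d) : conjIndex (conjIndex α) = α := by
  ext ⟨x, i⟩
  rw [conjIndex_apply, conjIndex_apply, Ladder.conj_conj]

theorem sites_conjIndex_subset (α : MultiIndex d) : sites (conjIndex α) ⊆ sites α := by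
  intro x hx
  obtain ⟨⟨y, i⟩, hp, rfl⟩ := Finset.mem_image.1 hx
  rw [Finsupp.mem_support_iff, conjIndex_apply] at hp
  by_contra h
  exact hp (apply_eq_zero_of_notMem_sites h _)

theorem star_ladderProd (i : Ladder) (α : MultiIndex d) :
    star (ladderProd N i α Λ) = ladderProd N i.conj (conjIndex α) Λ :=
  star_noncommProd _ _ _ _ _ fun x _ => by
    rw [star_pow, star_spinOp, conjIndex_apply, Ladder.conj_conj]

theorem star_normalMonomial (α : MultiIndex d) :
    star (normalMonomial N Λ α) = normalMonomial N Λ (conjIndex α) := by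
  simp only [normalMonomial, star_mul, star_ladderProd, Ladder.conj, mul_assoc]

end NormalOrder

/-! ### Finite-volume dynamics -/

section Dynamics

variable {d : ℕ} {N : ℕ} {V : MultiIndex d → ℂ} {Λ : Finset (Site d)} {R r : ℝ}

theorem star_quantumHamiltonian (hV : IsPotential V) (Λ : Finset (Site d)) :
    star (quantumHamiltonian N V Λ) = quantumHamiltonian N V Λ := by
  let conj (α : {α : MultiIndex d // sites α ⊆ Λ}) : {α : MultiIndex d // sites α ⊆ Λ} :=
    ⟨conjIndex α.1, (sites_conjIndex_subset α.1).trans α.2⟩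
  have conj_involutive : Function.Involutive conj := fun α =>
    Subtype.ext (conjIndex_conjIndex α.1)
  rw [quantumHamiltonian, tsum_star, ← (conj_involutive.toPerm conj).tsum_eq]
  refine tsum_congr fun α => ?_
  rw [star_smul, star_normalMonomial]
  change star (V (conjIndex α.1)) • normalMonomial N Λ (conjIndex (conjIndex α.1)) = _
  rw [hV.conj_eq, conjIndex_conjIndex, Complex.star_def, Complex.conj_conj]

/-- The part of the potential which contributes to the Hamiltonian of `Λ`. -/
def restrictPotential (V : MultiIndex d → ℂ) (Λ : Finset (Site d)) (α : MultiIndex d) : ℂ :=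
  if sites α ⊆ Λ then V α else 0

theorem norm_restrictPotential_le (V : MultiIndex d → ℂ) (Λ : Finset (Site d))
    (α : MultiIndex d) : ‖restrictPotential V Λ α‖ ≤ ‖V α‖ := by
  rw [restrictPotential]
  split_ifs <;> simp

theorem tendsto_restrictPotential (V : MultiIndex d → ℂ) (α : MultiIndex d) :
    Tendsto (fun Λ => restrictPotential V Λ α) atTop (𝓝 (V α)) := by
  refine tendsto_const_nhds.congr' ?_
  filter_upwards [eventually_ge_atTop (sites α)] with Λ hΛ
  exact (if_pos hΛ).symm

theorem hasGrowth_wordOp (hN : IsSpinBound N R) :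
    HasGrowth 1 0 R (wordOp N : Word d → QuasiLocal d N) :=
  hasGrowth_of_norm_le_pow (norm_wordOp_le hN)

theorem enorm_mul_le_sum_termMajorant (V : MultiIndex d → ℂ) (g : ℕ → ℝ≥0∞) {α : MultiIndex d}
    (hα : α ≠ 0) (hΛ : sites α ⊆ Λ) (i : Ladder) :
    ‖V α‖ₑ * g α.degree ≤ ∑ x ∈ Λ, termMajorant V g [(x, i)] α := by
  obtain ⟨⟨x, j⟩, hx⟩ := Finsupp.support_nonempty_iff.2 hα
  have x_mem : x ∈ Λ := hΛ (Finset.mem_image_of_mem Prod.fst hx)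
  have one_le_siteDegree : 1 ≤ siteDegree α x :=
    (Nat.one_le_iff_ne_zero.2 (Finsupp.mem_support_iff.1 hx)).trans
      (Finset.single_le_sum (f := fun i => α (x, i)) (fun _ _ => Nat.zero_le _)
        (Finset.mem_univ j))
  have term_eq : termMajorant V g [(x, i)] α = ‖V α‖ₑ * (siteDegree α x * g α.degree) := by
    simp [termMajorant]
  calc ‖V α‖ₑ * g α.degree ≤ ‖V α‖ₑ * (siteDegree α x * g α.degree) := by
        gcongr
        exact le_mul_of_one_le_left' (by exact_mod_cast one_le_siteDegree)
    _ = termMajorant V g [(x, i)] α := term_eq.symm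
    _ ≤ ∑ x ∈ Λ, termMajorant V g [(x, i)] α :=
        Finset.single_le_sum (f := fun x => termMajorant V g [(x, i)] α)
          (fun _ _ => zero_le) x_mem

theorem summable_norm_restrictPotential_smul_wordOp (h : IsFlowRadius V R r)
    (hN : IsSpinBound N R) (Λ : Finset (Site d)) :
    Summable fun α => ‖restrictPotential V Λ α • wordOp N (normalWord α)‖ := by
  have termMajorant_ne_top_of (x : Site d) (α : MultiIndex d) :
      termMajorant V (growthBound 1 0 R) [(x, .z)] α ≠ ⊤ :=
    termMajorant_ne_top (h.majorant_iterate_majorant_ne_top zero_le_one 0 0 _) α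
  refine Summable.of_norm_bounded_eventually
    (g := fun α => ∑ x ∈ Λ, (termMajorant V (growthBound 1 0 R) [(x, .z)] α).toReal)
    (summable_sum fun x _ =>
      summable_termMajorant (h.majorant_iterate_majorant_ne_top zero_le_one 0 0 _)) ?_
  filter_upwards [eventually_cofinite_ne 0] with α hα
  rw [norm_norm, ← ENNReal.toReal_sum fun x _ => termMajorant_ne_top_of x α, ← toReal_enorm]
  refine ENNReal.toReal_mono (ENNReal.sum_ne_top.2 fun x _ => termMajorant_ne_top_of x α) ?_
  by_cases hΛ : sites α ⊆ Λ
  · rw [restrictPotential, if_pos hΛ, enorm_smul]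
    refine le_trans ?_ (enorm_mul_le_sum_termMajorant V _ hα hΛ .z)
    rw [← length_normalWord]
    gcongr
    exact (hasGrowth_wordOp hN).enorm_le _
  · rw [restrictPotential, if_neg hΛ, zero_smul, enorm_zero]
    exact zero_le

theorem continuous_ofLocal (Λ : Finset (Site d)) :
    Continuous (QuasiLocal.ofLocal (N := N) Λ) :=
  AddMonoidHomClass.continuous_of_bound _ 1 fun A => by rw [one_mul, norm_ofLocal]

theorem hasSum_quantumHamiltonian (h : IsFlowRadius V R r) (hN : IsSpinBound N R)
    (Λ : Finset (Site d)) :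
    HasSum (fun α => restrictPotential V Λ α • wordOp N (normalWord α))
      (QuasiLocal.ofLocal Λ (quantumHamiltonian N V Λ)) := by
  have support_subset :
      Function.support (fun α => restrictPotential V Λ α • wordOp N (normalWord α)) ⊆
        {α | sites α ⊆ Λ} := fun α hα => by
    by_contra hΛ
    exact hα (by simp only [restrictPotential, if_neg (show ¬ sites α ⊆ Λ from hΛ), zero_smul])
  have ofLocal_term (α : {α : MultiIndex d // sites α ⊆ Λ}) :
      QuasiLocal.ofLocal Λ (V α.1 • normalMonomial N Λ α.1) =
        restrictPotential V Λ α.1 • wordOp N (normalWord α.1) := by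
    rw [restrictPotential, if_pos α.2, map_smul, ofLocal_normalMonomial α.2]
  have summable_local : Summable fun α : {α : MultiIndex d // sites α ⊆ Λ} =>
      V α.1 • normalMonomial N Λ α.1 := by
    refine .of_norm (((summable_norm_restrictPotential_smul_wordOp h hN Λ).comp_injective
      (Subtype.val_injective (p := fun α => sites α ⊆ Λ))).congr fun α => ?_)
    rw [Function.comp_apply, ← ofLocal_term, norm_ofLocal]
  rw [← hasSum_subtype_iff_of_support_subset support_subset]
  exact (summable_local.hasSum.map (QuasiLocal.ofLocal Λ) (continuous_ofLocal Λ)).congr_fun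
    fun α => (ofLocal_term α).symm

/-- The generator `-i s Ĥ_Λ` of the propagator, as an element of the quasi-local algebra. -/
def propagatorGenerator (N : ℕ) (V : MultiIndex d → ℂ) (Λ : Finset (Site d)) : QuasiLocal d N :=
  (-(Complex.I * ((N : ℂ) / 2))) • QuasiLocal.ofLocal Λ (quantumHamiltonian N V Λ)

theorem star_propagatorGenerator (hV : IsPotential V) (Λ : Finset (Site d)) :
    star (propagatorGenerator N V Λ) = -propagatorGenerator N V Λ := by
  rw [propagatorGenerator, star_smul, ← map_star, star_quantumHamiltonian hV, ← neg_smul]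
  congr 1
  simp

theorem ofLocal_propagator (t : ℝ) : QuasiLocal.ofLocal Λ (propagator N V Λ t) =
    NormedSpace.exp (t • propagatorGenerator N V Λ) := by
  let := NormedAlgebra.restrictScalars ℚ ℂ (LocalAlgebra N Λ)
  let := NormedAlgebra.restrictScalars ℚ ℂ (QuasiLocal d N)
  rw [propagator, NormedSpace.map_exp (QuasiLocal.ofLocal Λ) (continuous_ofLocal Λ), map_smul,
    propagatorGenerator, ← Complex.coe_smul, smul_smul, mul_neg, mul_comm (t : ℂ)]

theorem star_exp_propagatorGenerator (hV : IsPotential V) (Λ : Finset (Site d)) (t : ℝ) :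
    star (NormedSpace.exp (t • propagatorGenerator N V Λ)) =
      NormedSpace.exp (t • -propagatorGenerator N V Λ) := by
  rw [NormedSpace.star_exp, star_smul, star_propagatorGenerator hV, star_trivial]

theorem exp_propagatorGenerator_mem_unitary (hV : IsPotential V) (Λ : Finset (Site d)) (t : ℝ) :
    NormedSpace.exp (t • propagatorGenerator N V Λ) ∈ unitary (QuasiLocal d N) := by
  refine Unitary.mem_iff.2 ⟨?_, ?_⟩ <;> rw [star_exp_propagatorGenerator hV]
  · simpa only [neg_neg] using exp_smul_mul_exp_smul_neg (-propagatorGenerator N V Λ) t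
  · exact exp_smul_mul_exp_smul_neg _ t

theorem finiteVolumeEvolution_eq (t : ℝ) (a : QuasiLocal d N) :
    finiteVolumeEvolution N V Λ t a =
      star (NormedSpace.exp (t • propagatorGenerator N V Λ)) * a *
        NormedSpace.exp (t • propagatorGenerator N V Λ) := by
  rw [finiteVolumeEvolution, ofLocal_propagator]

theorem norm_finiteVolumeEvolution (hV : IsPotential V) (t : ℝ) (a : QuasiLocal d N) :
    ‖finiteVolumeEvolution N V Λ t a‖ = ‖a‖ := by
  have exp_mem := exp_propagatorGenerator_mem_unitary (N := N) hV Λ t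
  rw [finiteVolumeEvolution_eq, CStarRing.norm_mul_mem_unitary _ exp_mem,
    CStarRing.norm_mem_unitary_mul _ (Unitary.star_mem exp_mem)]

theorem finiteVolumeEvolution_zero (a : QuasiLocal d N) :
    finiteVolumeEvolution N V Λ 0 a = a := by
  simp [finiteVolumeEvolution_eq]

/-- The finite-volume dynamics at a fixed time as a continuous linear map. -/
def finiteVolumeEvolutionCLM (N : ℕ) (V : MultiIndex d → ℂ) (Λ : Finset (Site d)) (t : ℝ) :
    QuasiLocal d N →L[ℂ] QuasiLocal d N :=
  ((ContinuousLinearMap.mul ℂ _).flip (QuasiLocal.ofLocal Λ (propagator N V Λ t))).comp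
    (ContinuousLinearMap.mul ℂ _ (star (QuasiLocal.ofLocal Λ (propagator N V Λ t))))

theorem finiteVolumeEvolutionCLM_apply (t : ℝ) (a : QuasiLocal d N) :
    finiteVolumeEvolutionCLM N V Λ t a = finiteVolumeEvolution N V Λ t a := rfl

theorem hasDerivAt_finiteVolumeEvolution (hV : IsPotential V) (t : ℝ) (a : QuasiLocal d N) :
    HasDerivAt (fun t => finiteVolumeEvolution N V Λ t a)
      (finiteVolumeEvolution N V Λ t ((Complex.I * ((N : ℂ) / 2)) •
        (QuasiLocal.ofLocal Λ (quantumHamiltonian N V Λ) * a -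
          a * QuasiLocal.ofLocal Λ (quantumHamiltonian N V Λ)))) t := by
  simp only [finiteVolumeEvolution_eq, star_exp_propagatorGenerator hV]
  refine (hasDerivAt_exp_conj (propagatorGenerator N V Λ) (hasDerivAt_const t a)).congr_deriv ?_
  congr 2
  simp only [propagatorGenerator, neg_smul, mul_neg, neg_mul, mul_smul_comm, smul_mul_assoc,
    smul_sub]
  abel

theorem hasDerivAt_finiteVolumeEvolution_wordOp (hV : IsPotential V) (h : IsFlowRadius V R r)
    (hN1 : 1 ≤ N) (hN : IsSpinBound N R) (t : ℝ) (w : Word d) :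
    HasDerivAt (fun t => finiteVolumeEvolution N V Λ t (wordOp N w))
      (liouville (restrictPotential V Λ)
        (fun w => finiteVolumeEvolution N V Λ t (wordOp N w)) w) t := by
  refine (hasDerivAt_finiteVolumeEvolution hV t (wordOp N w)).congr_deriv ?_
  have hamiltonian := hasSum_quantumHamiltonian h hN Λ
  have commutator := (((hamiltonian.mul_right (wordOp N w)).sub
    (hamiltonian.mul_left (wordOp N w))).const_smul (Complex.I * ((N : ℂ) / 2))).mapL
      (finiteVolumeEvolutionCLM N V Λ t)
  rw [← finiteVolumeEvolutionCLM_apply, ← commutator.tsum_eq, liouville]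
  refine tsum_congr fun α => ?_
  simp only [← finiteVolumeEvolutionCLM_apply]
  rw [← ContinuousLinearMap.coe_coe, bracketSum_map, bracketSum_wordOp hN1, ← map_smul]
  congr 1
  rw [smul_mul_assoc, mul_smul_comm, ← smul_sub, smul_comm]

theorem hasGrowth_finiteVolumeEvolution_wordOp (hV : IsPotential V) (hN : IsSpinBound N R)
    (Λ : Finset (Site d)) (t : ℝ) :
    HasGrowth 1 0 R fun w => finiteVolumeEvolution N V Λ t (wordOp N w) :=
  hasGrowth_of_norm_le_pow fun w =>
    (norm_finiteVolumeEvolution hV t _).trans_le (norm_wordOp_le hN w)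

theorem finiteVolumeEvolution_add_wordOp (hV : IsPotential V) (h : IsFlowRadius V R r)
    (hN1 : 1 ≤ N) (hN : IsSpinBound N R) (Λ : Finset (Site d)) (t : ℝ) {τ : ℝ}
    (hτ : |τ| * potentialNorm V < r) (w : Word d) :
    finiteVolumeEvolution N V Λ (t + τ) (wordOp N w) =
      flow (restrictPotential V Λ) τ (fun w => finiteVolumeEvolution N V Λ t (wordOp N w)) w :=
  eq_flow_of_hasDerivAt (φ := fun t w => finiteVolumeEvolution N V Λ t (wordOp N w)) h
    (norm_restrictPotential_le V Λ) (hasDerivAt_finiteVolumeEvolution_wordOp hV h hN1 hN)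
    (hasGrowth_finiteVolumeEvolution_wordOp hV hN Λ) t hτ w

/-! ### Infinite-volume dynamics -/

theorem tendsto_finiteVolumeEvolution_add (hV : IsPotential V) (h : IsFlowRadius V R r)
    (hN1 : 1 ≤ N) (hN : IsSpinBound N R) {t : ℝ} {Φ : Word d → QuasiLocal d N}
    (hΦ : ∀ w, Tendsto (fun Λ => finiteVolumeEvolution N V Λ t (wordOp N w)) atTop (𝓝 (Φ w)))
    {τ : ℝ} (hτ : |τ| * potentialNorm V < r) (w : Word d) :
    Tendsto (fun Λ => finiteVolumeEvolution N V Λ (t + τ) (wordOp N w)) atTop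
      (𝓝 (flow V τ Φ w)) := by
  simp only [finiteVolumeEvolution_add_wordOp hV h hN1 hN _ t hτ]
  exact tendsto_flow h (norm_restrictPotential_le V) (tendsto_restrictPotential V)
    (.of_forall fun Λ => hasGrowth_finiteVolumeEvolution_wordOp hV hN Λ t) hΦ hτ w

theorem exists_tendsto_finiteVolumeEvolution_wordOp (hV : IsPotential V) (hN1 : 1 ≤ N) (t : ℝ) :
    ∀ w : Word d,
      ∃ a, Tendsto (fun Λ => finiteVolumeEvolution N V Λ t (wordOp N w)) atTop (𝓝 a) := by
  have h := isFlowRadius_three_halves hV.norm_lt_top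
  refine forall_time_of_small_steps
    (b := potentialNorm V) (P := fun t => ∀ w : Word d,
      ∃ a, Tendsto (fun Λ => finiteVolumeEvolution N V Λ t (wordOp N w)) atTop (𝓝 a)) h.pos
    (fun w => ⟨wordOp N w, by simp only [finiteVolumeEvolution_zero, tendsto_const_nhds]⟩)
    (fun t τ hτ exists_limit w => ?_) t
  choose Φ hΦ using exists_limit
  exact ⟨_, tendsto_finiteVolumeEvolution_add hV h hN1 (isSpinBound_three_halves hN1) hΦ hτ w⟩

theorem tendsto_finiteVolumeEvolution_wordOp (hV : IsPotential V) (hN1 : 1 ≤ N) (t : ℝ)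
    (w : Word d) :
    Tendsto (fun Λ => finiteVolumeEvolution N V Λ t (wordOp N w)) atTop
      (𝓝 (quantumEvolution N V t (wordOp N w))) :=
  tendsto_nhds_limUnder (exists_tendsto_finiteVolumeEvolution_wordOp hV hN1 t w)

theorem quantumEvolution_add (hV : IsPotential V) (h : IsFlowRadius V R r) (hN1 : 1 ≤ N)
    (hN : IsSpinBound N R) (t : ℝ) {τ : ℝ} (hτ : |τ| * potentialNorm V < r) (w : Word d) :
    quantumEvolution N V (t + τ) (wordOp N w) =
      flow V τ (fun w => quantumEvolution N V t (wordOp N w)) w :=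
  tendsto_nhds_unique (tendsto_finiteVolumeEvolution_wordOp hV hN1 (t + τ) w)
    (tendsto_finiteVolumeEvolution_add hV h hN1 hN
      (tendsto_finiteVolumeEvolution_wordOp hV hN1 t) hτ w)

theorem quantumEvolution_zero (a : QuasiLocal d N) : quantumEvolution N V 0 a = a :=
  Tendsto.limUnder_eq (by simp only [finiteVolumeEvolution_zero, tendsto_const_nhds])

theorem hasGrowth_quantumEvolution_wordOp (hV : IsPotential V) (hN1 : 1 ≤ N)
    (hN : IsSpinBound N R) (t : ℝ) :
    HasGrowth 1 0 R fun w : Word d => quantumEvolution N V t (wordOp N w) :=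
  ⟨zero_le_one, fun w => le_of_tendsto (tendsto_finiteVolumeEvolution_wordOp hV hN1 t w).norm
    (.of_forall fun Λ => (hasGrowth_finiteVolumeEvolution_wordOp hV hN Λ t).norm_le w)⟩

theorem tendsto_finiteVolumeEvolution_quantize (hV : IsPotential V) (hN1 : 1 ≤ N) (t : ℝ)
    (A : PolyObs d) :
    Tendsto (fun Λ => finiteVolumeEvolution N V Λ t (quantize N A)) atTop
      (𝓝 (∑ α ∈ A.support, A.coeff α • quantumEvolution N V t (wordOp N (normalWord α)))) := by
  simp only [← finiteVolumeEvolutionCLM_apply, quantize_eq_sum_wordOp, map_sum, map_smul]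
  exact tendsto_finsetSum _ fun α _ =>
    (tendsto_finiteVolumeEvolution_wordOp hV hN1 t _).const_smul _

theorem quantumEvolution_quantize (hV : IsPotential V) (hN1 : 1 ≤ N) (t : ℝ) (A : PolyObs d) :
    quantumEvolution N V t (quantize N A) =
      ∑ α ∈ A.support, A.coeff α • quantumEvolution N V t (wordOp N (normalWord α)) :=
  (tendsto_finiteVolumeEvolution_quantize hV hN1 t A).limUnder_eq

end Dynamics

/-! ### Ladder coordinates -/

section LadderCoord

theorem sqrt_two_mul_self : (Real.sqrt 2 : ℂ) * (Real.sqrt 2 : ℂ) = 2 := by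
  rw [← Complex.ofReal_mul, Real.mul_self_sqrt zero_le_two, Complex.ofReal_ofNat]

theorem star_ladderCoord (v : Vec3) (i : Ladder) :
    star (ladderCoord v i) = ladderCoord v i.conj := by
  cases i <;> simp [ladderCoord, Ladder.conj, sub_eq_add_neg]

theorem norm_sq_vec3 (v : Vec3) : ‖v‖ ^ 2 = v 0 ^ 2 + v 1 ^ 2 + v 2 ^ 2 := by
  simp only [EuclideanSpace.norm_sq_eq, Fin.sum_univ_three, Real.norm_eq_abs, sq_abs]

theorem inner_eq_sum_ladderCoord (v w : Vec3) :
    ((inner ℝ v w : ℝ) : ℂ) = ∑ i, ladderCoord v i.conj * ladderCoord w i := by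
  rw [PiLp.inner_apply, Fin.sum_univ_three, Ladder.sum_univ]
  simp only [RCLike.inner_apply, conj_trivial, Ladder.conj, ladderCoord, div_mul_div_comm,
    sqrt_two_mul_self]
  push_cast
  linear_combination (v 1 * w 1 : ℂ) * Complex.I_sq

theorem sum_norm_sq_ladderCoord (v : Vec3) : ∑ i, ‖ladderCoord v i‖ ^ 2 = ‖v‖ ^ 2 := by
  rw [← Complex.ofReal_inj, ← real_inner_self_eq_norm_sq, inner_eq_sum_ladderCoord,
    Complex.ofReal_sum]
  refine Finset.sum_congr rfl fun i _ => ?_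
  rw [← star_ladderCoord, Complex.star_def, Complex.conj_mul', Complex.ofReal_pow]

theorem norm_ladderCoord_le (v : Vec3) (i : Ladder) : ‖ladderCoord v i‖ ≤ ‖v‖ := by
  refine le_of_sq_le_sq ?_ (norm_nonneg v)
  rw [← sum_norm_sq_ladderCoord]
  exact Finset.single_le_sum (f := fun i => ‖ladderCoord v i‖ ^ 2) (fun _ _ => sq_nonneg _)
    (Finset.mem_univ i)

variable {d : ℕ}

/-- The value of a word at a configuration. -/
def evalWord (m : Site d → Vec3) (w : Word d) : ℂ :=
  (w.map fun p => ladderCoord (m p.1) p.2).prod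

theorem evalWord_append (m : Site d → Vec3) (u w : Word d) :
    evalWord m (u ++ w) = evalWord m u * evalWord m w := by
  rw [evalWord, List.map_append, List.prod_append, evalWord, evalWord]

theorem evalWord_cons (m : Site d → Vec3) (p : Site d × Ladder) (w : Word d) :
    evalWord m (p :: w) = ladderCoord (m p.1) p.2 * evalWord m w := by
  rw [evalWord, List.map_cons, List.prod_cons, evalWord]

theorem norm_evalWord_le {m : Site d → Vec3} {R : ℝ} (hm : ∀ x, ‖m x‖ ≤ R) (w : Word d) :
    ‖evalWord m w‖ ≤ R ^ w.length := by
  induction w with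
  | nil => simp [evalWord]
  | cons p w ih =>
    rw [evalWord_cons, norm_mul, List.length_cons, pow_succ']
    exact mul_le_mul ((norm_ladderCoord_le _ _).trans (hm _)) ih (norm_nonneg _)
      ((norm_nonneg _).trans (hm p.1))

theorem evalWord_normalWord (m : Site d → Vec3) (α : MultiIndex d) :
    evalWord m (normalWord α) = classicalMonomial m α := by
  rw [evalWord, ← Multiset.prod_coe, ← Multiset.map_coe, coe_normalWord,
    Finset.prod_multiset_map_count, Finsupp.toFinset_toMultiset]
  simp only [Finsupp.count_toMultiset]
  rfl

theorem evalAt_eq_sum_evalWord (A : PolyObs d) (m : Site d → Vec3) :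
    A.evalAt m = ∑ α ∈ A.support, A.coeff α * evalWord m (normalWord α) := by
  simp only [PolyObs.evalAt, MvPolynomial.eval_eq, evalWord_normalWord]
  rfl

end LadderCoord

/-! ### Coherent states of a single spin -/

section CoherentVector

variable (N : ℕ)

/-- The component of the spin in the direction `v`. -/
def spinComponent (v : Vec3) : SpinMat N := ∑ i, ladderCoord v i.conj • spinMatrix N i

/-- The horizontal component of the spin in the direction with azimuthal phase `u = e^{iφ}`. -/
def horizontalSpin (u : ℂ) : SpinMat N :=
  (Real.sqrt 2 : ℂ)⁻¹ • (star u • spinMatrix N .plus + u • spinMatrix N .minus)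

/-- The generator of the rotations which tilt the third axis towards the horizontal direction with
azimuthal phase `u = e^{iφ}`. -/
def tiltGenerator (u : ℂ) : SpinMat N :=
  (Real.sqrt 2 : ℂ)⁻¹ • (u • spinMatrix N .minus - star u • spinMatrix N .plus)

/-- The azimuthal phase `e^{iφ}` of a vector. -/
def azimuthPhase (v : Vec3) : ℂ :=
  Complex.exp (Complex.I * (Complex.arg ((v 0 : ℂ) + Complex.I * (v 1 : ℂ)) : ℂ))

theorem star_azimuthPhase (v : Vec3) : star (azimuthPhase v) =
    Complex.exp (-(Complex.I * (Complex.arg ((v 0 : ℂ) + Complex.I * (v 1 : ℂ)) : ℂ))) := by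
  rw [azimuthPhase, Complex.star_def, ← Complex.exp_conj, map_mul, Complex.conj_I,
    Complex.conj_ofReal, neg_mul]

theorem azimuthPhase_mul_star (v : Vec3) : azimuthPhase v * star (azimuthPhase v) = 1 := by
  rw [star_azimuthPhase, azimuthPhase, ← Complex.exp_add, add_neg_cancel, Complex.exp_zero]

theorem cos_arccos_apply_two {v : Vec3} (hv : ‖v‖ = 1) : Real.cos (Real.arccos (v 2)) = v 2 := by
  have abs_le_one : |v 2| ≤ 1 := by
    simpa only [hv, Real.norm_eq_abs] using PiLp.norm_apply_le v 2
  exact Real.cos_arccos (abs_le.1 abs_le_one).1 (abs_le.1 abs_le_one).2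

theorem sin_arccos_mul_azimuthPhase {v : Vec3} (hv : ‖v‖ = 1) :
    (Real.sin (Real.arccos (v 2)) : ℂ) * azimuthPhase v = (v 0 : ℂ) + Complex.I * (v 1 : ℂ) := by
  have norm_sq := norm_sq_vec3 v
  rw [hv, one_pow] at norm_sq
  have sin_eq : Real.sin (Real.arccos (v 2)) = ‖(v 0 : ℂ) + Complex.I * (v 1 : ℂ)‖ := by
    rw [Real.sin_arccos, mul_comm Complex.I, Complex.norm_add_mul_I]
    congr 1
    linarith
  rw [sin_eq, azimuthPhase, mul_comm Complex.I (Complex.arg _ : ℂ), Complex.norm_mul_exp_arg_mul_I]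

theorem coherentGenerator_eq_smul_tiltGenerator (v : Vec3) :
    coherentGenerator N v = Real.arccos (v 2) • tiltGenerator N (azimuthPhase v) := by
  rw [coherentGenerator, tiltGenerator, star_azimuthPhase, azimuthPhase, ← Complex.coe_smul,
    smul_smul, Complex.ofReal_div, div_eq_mul_inv]

theorem spinComponent_eq_sin_smul_add_cos_smul {v : Vec3} (hv : ‖v‖ = 1) :
    spinComponent N v = Real.sin (Real.arccos (v 2)) • horizontalSpin N (azimuthPhase v) +
      Real.cos (Real.arccos (v 2)) • spinMatrix N .z := by
  have plus_eq := sin_arccos_mul_azimuthPhase hv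
  have minus_eq : (Real.sin (Real.arccos (v 2)) : ℂ) * star (azimuthPhase v) =
      (v 0 : ℂ) - Complex.I * (v 1 : ℂ) := by
    have star_eq := congrArg star plus_eq
    simpa only [star_mul', star_add, Complex.star_def, Complex.conj_ofReal, Complex.conj_I, neg_mul,
      ← sub_eq_add_neg] using star_eq
  rw [spinComponent, Ladder.sum_univ, cos_arccos_apply_two hv, horizontalSpin,
    ← Complex.coe_smul, ← Complex.coe_smul]
  simp only [Ladder.conj, ladderCoord, ← plus_eq, ← minus_eq, div_eq_mul_inv]
  module

theorem commutator_horizontalSpin_tiltGenerator {u : ℂ} (hu : u * star u = 1) :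
    horizontalSpin N u * tiltGenerator N u - tiltGenerator N u * horizontalSpin N u =
      spinMatrix N .z := by
  have sqrt_two_inv_mul_self : (Real.sqrt 2 : ℂ)⁻¹ * (Real.sqrt 2 : ℂ)⁻¹ = 2⁻¹ := by
    rw [← mul_inv, sqrt_two_mul_self]
  have commutator_eq : (star u • spinMatrix N .plus + u • spinMatrix N .minus) *
        (u • spinMatrix N .minus - star u • spinMatrix N .plus) -
      (u • spinMatrix N .minus - star u • spinMatrix N .plus) *
        (star u • spinMatrix N .plus + u • spinMatrix N .minus) =
      (2 * (u * star u)) • (spinMatrix N .plus * spinMatrix N .minus -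
        spinMatrix N .minus * spinMatrix N .plus) := by
    simp only [add_mul, mul_add, sub_mul, mul_sub, smul_mul_smul_comm]
    module
  rw [horizontalSpin, tiltGenerator, smul_mul_smul_comm, smul_mul_smul_comm, ← smul_sub,
    commutator_eq, commutator_spinMatrix_plus_minus, hu, smul_smul, sqrt_two_inv_mul_self,
    mul_one, inv_mul_cancel₀ two_ne_zero, one_smul]

theorem commutator_spinMatrix_z_tiltGenerator (u : ℂ) :
    spinMatrix N .z * tiltGenerator N u - tiltGenerator N u * spinMatrix N .z =
      -horizontalSpin N u := by
  have commutator_eq : spinMatrix N .z * tiltGenerator N u - tiltGenerator N u * spinMatrix N .z =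
      (Real.sqrt 2 : ℂ)⁻¹ •
        (u • (spinMatrix N .z * spinMatrix N .minus - spinMatrix N .minus * spinMatrix N .z) -
          star u • (spinMatrix N .z * spinMatrix N .plus -
            spinMatrix N .plus * spinMatrix N .z)) := by
    simp only [tiltGenerator, mul_smul_comm, smul_mul_assoc, mul_sub, sub_mul]
    module
  rw [commutator_eq, commutator_spinMatrix_z_plus, commutator_spinMatrix_z_minus, horizontalSpin]
  module

theorem spinComponent_mul_exp_coherentGenerator {v : Vec3} (hv : ‖v‖ = 1) :
    spinComponent N v * NormedSpace.exp (coherentGenerator N v) =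
      NormedSpace.exp (coherentGenerator N v) * spinMatrix N .z := by
  rw [spinComponent_eq_sin_smul_add_cos_smul N hv, coherentGenerator_eq_smul_tiltGenerator]
  exact sin_smul_add_cos_smul_mul_exp
    (commutator_horizontalSpin_tiltGenerator N (azimuthPhase_mul_star v))
    (commutator_spinMatrix_z_tiltGenerator N _) _

theorem spinComponent_mulVec_coherentVector {v : Vec3} (hv : ‖v‖ = 1) :
    (spinComponent N v).mulVec (coherentVector N v) = ((N : ℂ) / 2) • coherentVector N v := by
  have highest_weight : (spinMatrix N .z).mulVec (Pi.single 0 1) =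
      ((N : ℂ) / 2) • Pi.single 0 1 := by
    ext j
    rw [spinMatrix, Matrix.mulVec_diagonal]
    obtain rfl | hj := eq_or_ne j 0
    · simp
    · simp [hj]
  rw [coherentVector, Matrix.mulVec_mulVec, spinComponent_mul_exp_coherentGenerator N hv,
    ← Matrix.mulVec_mulVec, highest_weight, Matrix.mulVec_smul]

theorem sum_norm_sq_coherentVector (v : Vec3) : ∑ k, ‖coherentVector N v k‖ ^ 2 = 1 := by
  have sum_eq := sum_coherentVector N v
  simp only [Complex.star_def, Complex.conj_mul'] at sum_eq
  exact_mod_cast sum_eq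

/-- The deviation `s⁻¹ S_i - v_i` of the rescaled spin from its classical value. -/
def spinFluctuation (v : Vec3) (i : Ladder) : SpinMat N :=
  ((N : ℂ) / 2)⁻¹ • spinMatrix N i - ladderCoord v i • (1 : SpinMat N)

theorem sum_star_spinMatrix_mul_self : ∑ i, star (spinMatrix N i) * spinMatrix N i =
    ((N : ℂ) / 2 * ((N : ℂ) / 2 + 1)) • (1 : SpinMat N) := by
  simp only [star_spinMatrix, Ladder.sum_univ, Ladder.conj]
  rw [spinMatrix_plus_mul_minus, spinMatrix_minus_mul_plus, spinMatrix,
    Matrix.diagonal_mul_diagonal, Matrix.diagonal_add, Matrix.diagonal_add,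
    Matrix.smul_one_eq_diagonal]
  congr 1
  funext j
  push_cast
  ring

theorem sum_star_ladderCoord_smul_spinMatrix (v : Vec3) :
    ∑ i, star (ladderCoord v i) • spinMatrix N i = spinComponent N v := by
  simp only [star_ladderCoord, spinComponent]

theorem sum_ladderCoord_smul_star_spinMatrix (v : Vec3) :
    ∑ i, ladderCoord v i • star (spinMatrix N i) = spinComponent N v := by
  simp only [star_spinMatrix, spinComponent, Ladder.sum_univ, Ladder.conj]
  abel

theorem star_spinFluctuation_mul_self (v : Vec3) (i : Ladder) :
    star (spinFluctuation N v i) * spinFluctuation N v i =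
      (((N : ℂ) / 2)⁻¹ * ((N : ℂ) / 2)⁻¹) • (star (spinMatrix N i) * spinMatrix N i) -
        ((N : ℂ) / 2)⁻¹ • (ladderCoord v i • star (spinMatrix N i)) -
        ((N : ℂ) / 2)⁻¹ • (star (ladderCoord v i) • spinMatrix N i) +
        ((‖ladderCoord v i‖ ^ 2 : ℝ) : ℂ) • (1 : SpinMat N) := by
  have star_inv_spin : star ((N : ℂ) / 2)⁻¹ = ((N : ℂ) / 2)⁻¹ := by simp
  have norm_sq_eq : ((‖ladderCoord v i‖ ^ 2 : ℝ) : ℂ) =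
      star (ladderCoord v i) * ladderCoord v i := by
    rw [Complex.star_def, Complex.conj_mul', Complex.ofReal_pow]
  rw [norm_sq_eq, spinFluctuation, star_sub, star_smul, star_smul, star_one, star_inv_spin]
  simp only [sub_mul, mul_sub, smul_mul_smul_comm, mul_one, one_mul]
  module

theorem sum_star_spinFluctuation_mul_self (hN : 1 ≤ N) {v : Vec3} (hv : ‖v‖ = 1) :
    ∑ i, star (spinFluctuation N v i) * spinFluctuation N v i =
      (((N : ℂ) / 2)⁻¹ + 2) • (1 : SpinMat N) - (2 * ((N : ℂ) / 2)⁻¹) • spinComponent N v := by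
  have N_ne_zero : (N : ℂ) ≠ 0 := Nat.cast_ne_zero.2 (by omega)
  have casimir_eq : ((N : ℂ) / 2)⁻¹ * ((N : ℂ) / 2)⁻¹ * ((N : ℂ) / 2 * ((N : ℂ) / 2 + 1)) =
      ((N : ℂ) / 2)⁻¹ + 1 := by
    field_simp
    ring
  simp only [star_spinFluctuation_mul_self, Finset.sum_add_distrib, Finset.sum_sub_distrib,
    ← Finset.smul_sum, ← Finset.sum_smul, ← Complex.ofReal_sum]
  rw [sum_star_spinMatrix_mul_self, sum_star_ladderCoord_smul_spinMatrix,
    sum_ladderCoord_smul_star_spinMatrix, sum_norm_sq_ladderCoord, hv, smul_smul, casimir_eq]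
  push_cast
  module

theorem sum_norm_sq_spinFluctuation_mulVec (hN : 1 ≤ N) {v : Vec3} (hv : ‖v‖ = 1) :
    ∑ i, ∑ k, ‖(spinFluctuation N v i).mulVec (coherentVector N v) k‖ ^ 2 =
      1 / ((N : ℝ) / 2) := by
  have N_ne_zero : (N : ℂ) ≠ 0 := Nat.cast_ne_zero.2 (by omega)
  have norm_coherentVector : dotProduct (star (coherentVector N v)) (coherentVector N v) = 1 :=
    sum_coherentVector N v
  rw [← Complex.ofReal_inj, Complex.ofReal_sum]
  simp only [← RCLike.ofReal_eq_complex_ofReal, sum_norm_sq_mulVec]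
  simp only [← Matrix.star_eq_conjTranspose]
  rw [← dotProduct_sum, ← Matrix.sum_mulVec, sum_star_spinFluctuation_mul_self N hN hv,
    Matrix.sub_mulVec, Matrix.smul_mulVec, Matrix.smul_mulVec, Matrix.one_mulVec,
    spinComponent_mulVec_coherentVector N hv, smul_smul, ← sub_smul, dotProduct_smul,
    norm_coherentVector, smul_eq_mul]
  push_cast
  field_simp
  ring

theorem sum_norm_sq_spinFluctuation_mulVec_le (hN : 1 ≤ N) {v : Vec3} (hv : ‖v‖ = 1)
    (i : Ladder) :
    ∑ k, ‖(spinFluctuation N v i).mulVec (coherentVector N v) k‖ ^ 2 ≤ 1 / ((N : ℝ) / 2) := by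
  rw [← sum_norm_sq_spinFluctuation_mulVec N hN hv]
  exact Finset.single_le_sum
    (f := fun i => ∑ k, ‖(spinFluctuation N v i).mulVec (coherentVector N v) k‖ ^ 2)
    (fun _ _ => Finset.sum_nonneg fun _ _ => sq_nonneg _) (Finset.mem_univ i)

end CoherentVector

/-! ### Coherent product states -/

section ProductVector

variable {d N : ℕ} {Λ : Finset (Site d)} (m : Site d → Vec3)

theorem tensorOp_mulVec_productVector (B : Λ → SpinMat N) (σ : Λ → Fin (N + 1)) :
    (tensorOp N B).mulVec (productVector N m Λ) σ =
      ∏ x, (B x).mulVec (coherentVector N (m x)) (σ x) := by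
  simp only [Matrix.mulVec, dotProduct, tensorOp, Matrix.of_apply, productVector,
    ← Finset.prod_mul_distrib]
  rw [Finset.prod_univ_sum, Fintype.piFinset_univ]

/-- The norm of `𝒜 |M_Λ⟩`, which measures how well `𝒜` annihilates the coherent product state. -/
def vectorNorm (A : LocalAlgebra N Λ) : ℝ :=
  ‖(WithLp.toLp 2 (A.mulVec (productVector N m Λ)) : EuclideanSpace ℂ (Λ → Fin (N + 1)))‖

theorem vectorNorm_nonneg (A : LocalAlgebra N Λ) : 0 ≤ vectorNorm m A := norm_nonneg _

theorem vectorNorm_add_le (A B : LocalAlgebra N Λ) :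
    vectorNorm m (A + B) ≤ vectorNorm m A + vectorNorm m B := by
  rw [vectorNorm, Matrix.add_mulVec, WithLp.toLp_add]
  exact norm_add_le _ _

theorem vectorNorm_smul (c : ℂ) (A : LocalAlgebra N Λ) :
    vectorNorm m (c • A) = ‖c‖ * vectorNorm m A := by
  rw [vectorNorm, Matrix.smul_mulVec, WithLp.toLp_smul, norm_smul, vectorNorm]

theorem vectorNorm_mul_le (A B : LocalAlgebra N Λ) :
    vectorNorm m (A * B) ≤ ‖A‖ * vectorNorm m B := by
  rw [vectorNorm, ← Matrix.mulVec_mulVec]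
  exact Matrix.l2_opNorm_mulVec A (WithLp.toLp 2 (B.mulVec (productVector N m Λ)))

theorem vectorNorm_mul_sub_smul_one_le (A B : LocalAlgebra N Λ) (a b : ℂ) :
    vectorNorm m (A * B - (a * b) • 1) ≤
      ‖A‖ * vectorNorm m (B - b • 1) + ‖b‖ * vectorNorm m (A - a • 1) := by
  have telescope : A * B - (a * b) • 1 = A * (B - b • 1) + b • (A - a • 1) := by
    rw [mul_sub, mul_smul_comm, mul_one, smul_sub, smul_smul, mul_comm b]
    abel
  rw [telescope, ← vectorNorm_smul]
  exact (vectorNorm_add_le m _ _).trans (by gcongr; exact vectorNorm_mul_le m _ _)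

theorem vectorNorm_tensorOp_sq (B : Λ → SpinMat N) :
    vectorNorm m (tensorOp N B) ^ 2 =
      ∏ x, ∑ k, ‖(B x).mulVec (coherentVector N (m x)) k‖ ^ 2 := by
  rw [vectorNorm, EuclideanSpace.norm_sq_eq, Finset.prod_univ_sum, Fintype.piFinset_univ]
  simp only [tensorOp_mulVec_productVector, norm_prod, Finset.prod_pow]

theorem vectorNorm_siteHom_sq (x : Λ) (B : SpinMat N) :
    vectorNorm m (siteHom x B) ^ 2 = ∑ k, ‖B.mulVec (coherentVector N (m x)) k‖ ^ 2 := by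
  refine (vectorNorm_tensorOp_sq m (Pi.mulSingle x B)).trans ?_
  rw [Finset.prod_eq_single x, Pi.mulSingle_eq_same]
  · intro y _ hy
    rw [Pi.mulSingle_eq_of_ne hy, Matrix.one_mulVec, sum_norm_sq_coherentVector]
  · exact fun hx => absurd (Finset.mem_univ x) hx

theorem vectorNorm_one : vectorNorm m (1 : LocalAlgebra N Λ) = 1 := by
  rw [← sq_eq_sq₀ (vectorNorm_nonneg m _) zero_le_one, ← tensorOp_one, vectorNorm_tensorOp_sq]
  simp only [Pi.one_apply, Matrix.one_mulVec, sum_norm_sq_coherentVector, Finset.prod_const_one,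
    one_pow]

theorem norm_localState_le_vectorNorm (A : LocalAlgebra N Λ) :
    ‖localState N m Λ A‖ ≤ vectorNorm m A := by
  have eq_inner : localState N m Λ A = inner ℂ
      (WithLp.toLp 2 (productVector N m Λ) : EuclideanSpace ℂ (Λ → Fin (N + 1)))
      (WithLp.toLp 2 (A.mulVec (productVector N m Λ))) := by
    rw [EuclideanSpace.inner_eq_star_dotProduct, dotProduct_comm, localState]
  have norm_productVector := vectorNorm_one (N := N) (Λ := Λ) m
  rw [vectorNorm, Matrix.one_mulVec] at norm_productVector
  rw [eq_inner]
  refine (norm_inner_le_norm _ _).trans_eq ?_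
  rw [norm_productVector, one_mul, vectorNorm]

theorem vectorNorm_spinOp_sub_le (hN : 1 ≤ N) (x : Λ) (hm : ‖m x‖ = 1) (i : Ladder) :
    vectorNorm m (spinOp N x i - ladderCoord (m x) i • 1) ≤ 1 / Real.sqrt ((N : ℝ) / 2) := by
  have eq_siteHom : spinOp N x i - ladderCoord (m x) i • 1 =
      siteHom x (spinFluctuation N (m x) i) := by
    rw [spinFluctuation, map_sub, ← spinOp_eq_siteHom, map_smul, map_one]
  refine le_of_sq_le_sq ?_ (by positivity)
  rw [eq_siteHom, vectorNorm_siteHom_sq, div_pow, one_pow, Real.sq_sqrt (by positivity)]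
  exact sum_norm_sq_spinFluctuation_mulVec_le N hN hm i

end ProductVector

section CoherentState

variable {d N : ℕ} (m : Site d → Vec3)

theorem exists_ofLocal_eq_wordOp {Λ : Finset (Site d)} (hN1 : 1 ≤ N) (hN : IsSpinBound N 1)
    (hm : ∀ x, ‖m x‖ = 1) (w : Word d) (hw : ∀ p ∈ w, p.1 ∈ Λ) :
    ∃ A : LocalAlgebra N Λ, QuasiLocal.ofLocal Λ A = wordOp N w ∧
      vectorNorm m (A - evalWord m w • 1) ≤ w.length * (1 / Real.sqrt ((N : ℝ) / 2)) := by
  induction w with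
  | nil => exact ⟨1, by simp [wordOp], by simp [evalWord, vectorNorm]⟩
  | cons p w ih =>
    obtain ⟨A, ofLocal_A, vectorNorm_A⟩ := ih fun q hq => hw q (List.mem_cons_of_mem _ hq)
    let x : Λ := ⟨p.1, hw p List.mem_cons_self⟩
    have norm_spinOp_le : ‖spinOp N x p.2‖ ≤ 1 := by
      rw [← norm_ofLocal, ofLocal_spinOp]
      exact norm_letterOp_le hN p
    have norm_evalWord_le_one : ‖evalWord m w‖ ≤ 1 := by
      simpa only [one_pow] using norm_evalWord_le (fun x => (hm x).le) w
    refine ⟨spinOp N x p.2 * A, ?_, ?_⟩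
    · rw [map_mul, ofLocal_spinOp, ofLocal_A, wordOp, wordOp, List.map_cons, List.prod_cons]
    · rw [evalWord_cons, List.length_cons]
      calc vectorNorm m (spinOp N x p.2 * A - (ladderCoord (m p.1) p.2 * evalWord m w) • 1)
          ≤ ‖spinOp N x p.2‖ * vectorNorm m (A - evalWord m w • 1) + ‖evalWord m w‖ *
              vectorNorm m (spinOp N x p.2 - ladderCoord (m p.1) p.2 • 1) :=
            vectorNorm_mul_sub_smul_one_le m _ _ _ _
        _ ≤ 1 * (w.length * (1 / Real.sqrt ((N : ℝ) / 2))) +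
              1 * (1 / Real.sqrt ((N : ℝ) / 2)) := by
            gcongr
            exacts [vectorNorm_nonneg m _, vectorNorm_nonneg m _,
              vectorNorm_spinOp_sub_le m hN1 x (hm p.1) p.2]
        _ = (w.length + 1 : ℕ) * (1 / Real.sqrt ((N : ℝ) / 2)) := by push_cast; ring

theorem coherentState_one : coherentState N m (1 : QuasiLocal d N) = 1 := by
  rw [← map_one (QuasiLocal.ofLocal (∅ : Finset (Site d))), coherentState_ofLocal, localState,
    Matrix.one_mulVec]
  exact sum_prod_coherentVector N fun x : (∅ : Finset (Site d)) => m x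

theorem norm_coherentState_wordOp_sub_le (hN1 : 1 ≤ N) (hN : IsSpinBound N 1)
    (hm : ∀ x, ‖m x‖ = 1) (w : Word d) :
    ‖coherentState N m (wordOp N w) - evalWord m w‖ ≤
      w.length * (1 / Real.sqrt ((N : ℝ) / 2)) := by
  obtain ⟨A, ofLocal_A, vectorNorm_A⟩ := exists_ofLocal_eq_wordOp
    (Λ := (w.map Prod.fst).toFinset) m hN1 hN hm w
    fun p hp => List.mem_toFinset.2 (List.mem_map_of_mem hp)
  have eq_localState : coherentState N m (wordOp N w) - evalWord m w =
      localState N m _ (A - evalWord m w • 1) := by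
    rw [← coherentState_ofLocal, map_sub, map_sub, ofLocal_A, map_smul, map_one, map_smul,
      coherentState_one, smul_eq_mul, mul_one]
  rw [eq_localState]
  exact (norm_localState_le_vectorNorm m _).trans vectorNorm_A

theorem norm_coherentState_le (a : QuasiLocal d N) : ‖coherentState N m a‖ ≤ ‖a‖ := by
  refine QuasiLocal.induction_on (p := fun a => ‖coherentState N m a‖ ≤ ‖a‖) a
    (isClosed_le (coherentState N m).continuous.norm continuous_norm) fun b => ?_
  obtain ⟨Λ, A, rfl⟩ := LocalUnion.exists_of b
  change ‖coherentState N m (QuasiLocal.ofLocal Λ A)‖ ≤ ‖QuasiLocal.ofLocal Λ A‖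
  rw [coherentState_ofLocal, norm_ofLocal]
  exact norm_localState_le N m Λ A

end CoherentState

/-! ### The classical equation of motion in terms of words -/

section ClassicalWords

variable {d : ℕ} {V : MultiIndex d → ℂ} {R r : ℝ} (m : Site d → Vec3)

theorem evalWord_eq_classicalMonomial {w : Word d} {α : MultiIndex d}
    (h : (w : Multiset (Site d × Ladder)) = Finsupp.toMultiset α) :
    evalWord m w = classicalMonomial m α := by
  rw [← evalWord_normalWord, evalWord, evalWord, ← Multiset.prod_coe, ← Multiset.prod_coe,
    ← Multiset.map_coe, ← Multiset.map_coe, h, coe_normalWord]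

theorem coe_take_append_cons_drop (u : Word d) (a : Fin u.length) (q : Site d × Ladder) :
    ((u.take a ++ q :: u.drop (a + 1) : Word d) : Multiset (Site d × Ladder)) =
      q ::ₘ (u : Multiset (Site d × Ladder)).erase u[a.1] := by
  rw [Multiset.coe_erase, Multiset.cons_coe, Multiset.coe_eq_coe]
  refine List.perm_middle.trans (List.Perm.cons q ?_)
  rw [← List.eraseIdx_eq_take_drop_succ]
  exact (@List.erase_getElem _ instBEqOfDecidableEq _ _ _ a.2).symm

theorem evalWord_take_append_cons_drop (α : MultiIndex d) (a : Fin (normalWord α).length)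
    (q : Site d × Ladder) :
    evalWord m ((normalWord α).take a ++ q :: (normalWord α).drop (a + 1)) =
      classicalMonomial m
        (α - Finsupp.single (normalWord α)[a.1] 1 + Finsupp.single q 1) := by
  refine evalWord_eq_classicalMonomial m ?_
  rw [coe_take_append_cons_drop, coe_normalWord]
  ext p
  rw [Multiset.count_cons, Finsupp.count_toMultiset, Finsupp.add_apply, Finsupp.tsub_apply,
    Finsupp.single_apply, Finsupp.single_apply]
  obtain rfl | hp := eq_or_ne p (normalWord α)[a.1]
  · rw [Multiset.count_erase_self, Finsupp.count_toMultiset, if_pos rfl]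
    simp only [eq_comm]
  · rw [Multiset.count_erase_of_ne hp, Finsupp.count_toMultiset, if_neg hp.symm, tsub_zero]
    simp only [eq_comm]

theorem bracketSum_singleton (u : Word d) (q : Site d × Ladder) :
    bracketSum u [q] (evalWord m) = ∑ a : Fin u.length, exchangeCoeff u[a.1] q *
      evalWord m (u.take a ++ (u[a.1].1, u[a.1].2.bracket q.2) :: u.drop (a + 1)) := by
  refine Finset.sum_congr rfl fun a _ => (Fin.sum_univ_one _).trans ?_
  simp [exchange]

theorem bracketSum_evalWord (u w : Word d) :
    bracketSum u w (evalWord m) = ∑ b : Fin w.length,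
      evalWord m (w.take b) * bracketSum u [w[b.1]] (evalWord m) * evalWord m (w.drop (b + 1)) := by
  simp only [bracketSum_singleton]
  rw [bracketSum, Finset.sum_comm]
  refine Finset.sum_congr rfl fun b _ => ?_
  rw [Finset.mul_sum, Finset.sum_mul]
  refine Finset.sum_congr rfl fun a _ => ?_
  simp only [exchange, evalWord_append, evalWord_cons, smul_eq_mul]
  ring

/-- The Poisson bracket `{M^α, M_i(x)}` at the configuration `m`, as it occurs in the equation of
motion. -/
def monomialBracket (x : Site d) (i : Ladder) (α : MultiIndex d) : ℂ :=
  ∑ j, ∑ k, Complex.I * epsTilde j i k * (α (x, j) : ℂ) *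
    classicalMonomial m (α - Finsupp.single (x, j) 1 + Finsupp.single (x, k) 1)

theorem monomialBracket_eq_sum_bracket (x : Site d) (i : Ladder) (α : MultiIndex d) :
    monomialBracket m x i α = ∑ j, α (x, j) • (Complex.I * epsTilde j i (j.bracket i) *
      classicalMonomial m (α - Finsupp.single (x, j) 1 + Finsupp.single (x, j.bracket i) 1)) := by
  refine Finset.sum_congr rfl fun j _ => ?_
  calc _ = ∑ k, epsTilde j i k • (Complex.I * (α (x, j) : ℂ) *
        classicalMonomial m (α - Finsupp.single (x, j) 1 + Finsupp.single (x, k) 1)) :=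
        Finset.sum_congr rfl fun k _ => by rw [smul_eq_mul]; ring
    _ = _ := by rw [sum_epsTilde_smul, smul_eq_mul, nsmul_eq_mul]; ring

theorem bracketSum_normalWord_singleton (x : Site d) (i : Ladder) (α : MultiIndex d) :
    bracketSum (normalWord α) [(x, i)] (evalWord m) = monomialBracket m x i α := by
  rw [monomialBracket_eq_sum_bracket, ← sum_map_normalWord α x, bracketSum_singleton,
    ← Fin.sum_univ_fun_getElem]
  refine Finset.sum_congr rfl fun a _ => ?_
  rw [evalWord_take_append_cons_drop, exchangeCoeff, ite_mul, zero_mul]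
  generalize (normalWord α)[a.1] = p
  obtain ⟨y, j⟩ := p
  by_cases y_eq : y = x
  · subst y_eq
    rfl
  · rw [if_neg y_eq, if_neg y_eq]

theorem hamiltonField_eq_liouville (x : Site d) (i : Ladder) :
    hamiltonField V m x i = liouville V (evalWord m) [(x, i)] :=
  tsum_congr fun α => by rw [bracketSum_normalWord_singleton, smul_eq_mul, monomialBracket]

variable {m}

theorem hasGrowth_evalWord (hm : ∀ x, ‖m x‖ ≤ R) : HasGrowth 1 0 R (evalWord m) :=
  hasGrowth_of_norm_le_pow (norm_evalWord_le hm)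

theorem liouville_evalWord (h : IsFlowRadius V R r) (hm : ∀ x, ‖m x‖ ≤ R) (w : Word d) :
    liouville V (evalWord m) w = ∑ b : Fin w.length,
      evalWord m (w.take b) * liouville V (evalWord m) [w[b.1]] *
        evalWord m (w.drop (b + 1)) := by
  have summable (b : Fin w.length) : Summable fun α => evalWord m (w.take b) *
      (V α • bracketSum (normalWord α) [w[b.1]] (evalWord m)) * evalWord m (w.drop (b + 1)) :=
    ((summable_iterate_liouville h (fun _ => le_rfl) (hasGrowth_evalWord hm) 0 _).mul_left
      _).mul_right _
  simp only [liouville, ← tsum_mul_left, ← tsum_mul_right]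
  rw [← Summable.tsum_finsetSum fun b _ => summable b]
  refine tsum_congr fun α => ?_
  rw [bracketSum_evalWord, Finset.smul_sum]
  refine Finset.sum_congr rfl fun b _ => ?_
  simp only [smul_eq_mul]
  ring

theorem hasDerivAt_evalWord {m : ℝ → Site d → Vec3} {D : Site d × Ladder → ℂ} {t : ℝ}
    (h : ∀ p, HasDerivAt (fun τ => ladderCoord (m τ p.1) p.2) (D p) t) (w : Word d) :
    HasDerivAt (fun τ => evalWord (m τ) w) (∑ b : Fin w.length,
      evalWord (m t) (w.take b) * D w[b.1] * evalWord (m t) (w.drop (b + 1))) t := by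
  refine (HasFDerivAt.list_prod' (l := w) fun p _ => (h p).hasFDerivAt).hasDerivAt.congr_deriv ?_
  simp [evalWord, mul_assoc, mul_comm (D _)]

end ClassicalWords

section ClassicalUniqueness

variable {d : ℕ} {V : MultiIndex d → ℂ} {M₀ : Site d → Metric.sphere (0 : Vec3) 1}
  {M M' : ℝ → lp (fun _ : Site d => Vec3) ∞}

theorem IsHamiltonianEvolution.hasDerivAt_evalWord (hV : potentialENorm V < ⊤)
    (hM : IsHamiltonianEvolution V M₀ M) (t : ℝ) (w : Word d) :
    HasDerivAt (fun t => evalWord (M t) w) (liouville V (evalWord (M t)) w) t := by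
  rw [liouville_evalWord (isFlowRadius_one hV) fun x => (hM.norm_eq_one t x).le]
  refine SpinSystem.hasDerivAt_evalWord (D := fun p => liouville V (evalWord (M t)) [p])
    (fun p => ?_) w
  rw [← hamiltonField_eq_liouville]
  exact hM.hasDerivAt t p.1 p.2

theorem IsHamiltonianEvolution.hasGrowth_evalWord (hM : IsHamiltonianEvolution V M₀ M) (t : ℝ) :
    HasGrowth 1 0 1 (evalWord (M t)) :=
  SpinSystem.hasGrowth_evalWord fun x => (hM.norm_eq_one t x).le

theorem IsHamiltonianEvolution.evalWord_add (hV : potentialENorm V < ⊤)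
    (hM : IsHamiltonianEvolution V M₀ M) (t : ℝ) {τ : ℝ} (hτ : |τ| * potentialNorm V < 1)
    (w : Word d) : evalWord (M (t + τ)) w = flow V τ (evalWord (M t)) w :=
  eq_flow_of_hasDerivAt (φ := fun t => evalWord (M t)) (isFlowRadius_one hV) (fun _ => le_rfl)
    (hM.hasDerivAt_evalWord hV) hM.hasGrowth_evalWord t hτ w

/-- A ladder coordinate as a linear functional. -/
def ladderCoordLM (i : Ladder) : Vec3 →ₗ[ℝ] ℂ where
  toFun v := ladderCoord v i
  map_add' v w := by cases i <;> simp [ladderCoord] <;> ring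
  map_smul' c v := by cases i <;> simp [ladderCoord] <;> ring

theorem ladderCoord_sub (v w : Vec3) (i : Ladder) :
    ladderCoord (v - w) i = ladderCoord v i - ladderCoord w i :=
  map_sub (ladderCoordLM i) v w

theorem hasDerivAt_ladderCoord {f : ℝ → Vec3} {f' : Vec3} {t : ℝ} (h : HasDerivAt f f' t)
    (i : Ladder) : HasDerivAt (fun τ => ladderCoord (f τ) i) (ladderCoord f' i) t :=
  (ladderCoordLM i).toContinuousLinearMap.hasFDerivAt.comp_hasDerivAt t h

theorem norm_le_two_mul_of_ladderCoord {v : Vec3} {b : ℝ} (h : ∀ i, ‖ladderCoord v i‖ ≤ b) :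
    ‖v‖ ≤ 2 * b := by
  have b_nonneg : 0 ≤ b := (norm_nonneg _).trans (h .z)
  have norm_sq_le (i) : ‖ladderCoord v i‖ ^ 2 ≤ b ^ 2 := pow_le_pow_left₀ (norm_nonneg _) (h i) 2
  refine le_of_sq_le_sq ?_ (by positivity)
  rw [← sum_norm_sq_ladderCoord, Ladder.sum_univ]
  nlinarith [norm_sq_le .plus, norm_sq_le .z, norm_sq_le .minus]

theorem eq_of_ladderCoord_eq {v w : Vec3} (h : ∀ i, ladderCoord v i = ladderCoord w i) :
    v = w := by
  have norm_sub_le : ‖v - w‖ ≤ 2 * 0 := norm_le_two_mul_of_ladderCoord fun i => by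
    rw [ladderCoord_sub, h, sub_self, norm_zero]
  rwa [mul_zero, norm_le_zero_iff, sub_eq_zero] at norm_sub_le

theorem IsHamiltonianEvolution.unique (hV : potentialENorm V < ⊤)
    (hM : IsHamiltonianEvolution V M₀ M) (hM' : IsHamiltonianEvolution V M₀ M') : M = M' := by
  have evalWord_zero_eq : evalWord (M 0) = evalWord (M' 0) :=
    congrArg evalWord (funext fun x => by rw [hM.initial, hM'.initial])
  have evalWord_eq := forall_time_of_small_steps (P := fun t => evalWord (M t) = evalWord (M' t))
    (b := potentialNorm V) one_pos evalWord_zero_eq fun t τ hτ evalWord_eq => funext fun w => by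
      rw [hM.evalWord_add hV t hτ, hM'.evalWord_add hV t hτ, evalWord_eq]
  funext t
  refine lp.ext (funext fun x => eq_of_ladderCoord_eq fun i => ?_)
  simpa [evalWord] using congrFun (evalWord_eq t) [(x, i)]

end ClassicalUniqueness

/-! ### Existence of the classical evolution -/

section VectorField

variable {d : ℕ} {V : MultiIndex d → ℂ} {m m' : Site d → Vec3} {R r : ℝ}

theorem norm_hamiltonField_le (hV : potentialENorm V < ⊤) (hm : ∀ x, ‖m x‖ ≤ 1) (x : Site d)
    (i : Ladder) : ‖hamiltonField V m x i‖ ≤ Real.exp 1 * potentialNorm V := by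
  rw [hamiltonField_eq_liouville]
  simpa using norm_iterate_liouville_le (isFlowRadius_one hV) (fun _ => le_rfl)
    (hasGrowth_evalWord hm) 1 [(x, i)]

theorem norm_evalWord_sub_le (hm : ∀ x, ‖m x‖ ≤ 1) (hm' : ∀ x, ‖m' x‖ ≤ 1) {δ : ℝ}
    (h : ∀ x, ‖m x - m' x‖ ≤ δ) (w : Word d) :
    ‖evalWord m w - evalWord m' w‖ ≤ δ * w.length := by
  induction w with
  | nil => simp [evalWord]
  | cons p w ih =>
    have norm_head_le : ‖ladderCoord (m p.1) p.2‖ ≤ 1 := (norm_ladderCoord_le _ _).trans (hm _)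
    have norm_head_sub_le : ‖ladderCoord (m p.1 - m' p.1) p.2‖ ≤ δ :=
      (norm_ladderCoord_le _ _).trans (h _)
    have norm_tail_le : ‖evalWord m' w‖ ≤ 1 := by simpa using norm_evalWord_le hm' w
    calc ‖evalWord m (p :: w) - evalWord m' (p :: w)‖
        = ‖ladderCoord (m p.1) p.2 * (evalWord m w - evalWord m' w) +
            ladderCoord (m p.1 - m' p.1) p.2 * evalWord m' w‖ := by
          rw [evalWord_cons, evalWord_cons, ladderCoord_sub]
          ring_nf
      _ ≤ 1 * (δ * w.length) + δ * 1 := by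
          refine norm_add_le_of_le ?_ ?_ <;> rw [norm_mul] <;>
            exact mul_le_mul ‹_› ‹_› (norm_nonneg _) ((norm_nonneg _).trans ‹_›)
      _ = δ * (p :: w).length := by
          rw [List.length_cons]
          push_cast
          ring

theorem norm_hamiltonField_sub_le (hV : potentialENorm V < ⊤) (hm : ∀ x, ‖m x‖ ≤ 1)
    (hm' : ∀ x, ‖m' x‖ ≤ 1) {δ : ℝ} (h : ∀ x, ‖m x - m' x‖ ≤ δ) (x : Site d) (i : Ladder) :
    ‖hamiltonField V m x i - hamiltonField V m' x i‖ ≤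
      δ * (2 * Real.exp 1 * potentialNorm V) := by
  have hasGrowth_sub : HasGrowth δ 1 1 fun w => evalWord m w - evalWord m' w :=
    ⟨(norm_nonneg _).trans (h x), fun w => by simpa using norm_evalWord_sub_le hm hm' h w⟩
  have liouville_sub := congrFun (iterate_liouville_sub (isFlowRadius_one hV) (fun _ => le_rfl)
    (hasGrowth_evalWord hm) (hasGrowth_evalWord hm') 1) [(x, i)]
  simp only [Function.iterate_one] at liouville_sub
  rw [hamiltonField_eq_liouville, hamiltonField_eq_liouville, ← liouville_sub]
  refine (norm_iterate_liouville_le (isFlowRadius_one hV) (fun _ => le_rfl) hasGrowth_sub 1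
    [(x, i)]).trans_eq ?_
  simp [mul_assoc]

/-! ### The vector field is real -/

theorem star_I_mul_epsTilde (j i k : Ladder) : star (Complex.I * epsTilde j i k) =
    Complex.I * epsTilde j.conj i.conj k.conj := by
  cases j <;> cases i <;> cases k <;> simp [epsTilde, Ladder.conj]

/-- The involution `i ↦ ī` of the ladder indices as a permutation. -/
def Ladder.conjEquiv : Ladder ≃ Ladder := ⟨Ladder.conj, Ladder.conj, conj_conj, conj_conj⟩

theorem conjIndex_single (x : Site d) (i : Ladder) (n : ℕ) :
    conjIndex (Finsupp.single (x, i) n) = Finsupp.single (x, i.conj) n :=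
  Finsupp.mapDomain_single

theorem conjIndex_sub_add (α β γ : MultiIndex d) :
    conjIndex (α - β + γ) = conjIndex α - conjIndex β + conjIndex γ := by
  ext ⟨x, i⟩
  simp only [Finsupp.add_apply, Finsupp.tsub_apply, conjIndex_apply]

theorem star_classicalMonomial (m : Site d → Vec3) (α : MultiIndex d) :
    star (classicalMonomial m α) = classicalMonomial m (conjIndex α) := by
  have conj_injective : Function.Injective fun p : Site d × Ladder => (p.1, p.2.conj) :=
    Function.injective_id.prodMap Ladder.conjEquiv.injective
  rw [classicalMonomial, classicalMonomial, conjIndex,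
    Finsupp.prod_mapDomain_index_inj conj_injective, Finsupp.prod, Finsupp.prod, star_prod]
  simp only [star_pow, star_ladderCoord]

theorem star_monomialBracket (m : Site d → Vec3) (x : Site d) (i : Ladder) (α : MultiIndex d) :
    star (monomialBracket m x i α) = monomialBracket m x i.conj (conjIndex α) := by
  rw [monomialBracket, monomialBracket, star_sum, ← Ladder.conjEquiv.sum_comp]
  refine Finset.sum_congr rfl fun j _ => ?_
  rw [star_sum, ← Ladder.conjEquiv.sum_comp]
  refine Finset.sum_congr rfl fun k _ => ?_
  rw [star_mul', star_mul', star_I_mul_epsTilde, star_natCast, star_classicalMonomial,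
    conjIndex_sub_add, conjIndex_single, conjIndex_single]
  simp only [Ladder.conjEquiv, Equiv.coe_fn_mk, conjIndex_apply, Ladder.conj_conj]

theorem star_hamiltonField (hV : IsPotential V) (m : Site d → Vec3) (x : Site d) (i : Ladder) :
    star (hamiltonField V m x i) = hamiltonField V m x i.conj := by
  have conj_involutive : Function.Involutive (conjIndex (d := d)) := conjIndex_conjIndex
  change star (∑' α, V α * monomialBracket m x i α) = ∑' α, V α * monomialBracket m x i.conj α
  rw [tsum_star]
  refine (tsum_congr fun α => ?_).trans ((conj_involutive.toPerm conjIndex).tsum_eq _)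
  rw [star_mul', star_monomialBracket, ← starRingEnd_apply, ← hV.conj_eq]
  rfl

/-! ### The vector field is tangent to the spheres -/

theorem sum_ladderCoord_mul_exchangeCoeff (m : Site d → Vec3) (x : Site d)
    (p : Site d × Ladder) : ∑ i, ladderCoord (m x) i.conj *
      (exchangeCoeff p (x, i) * ladderCoord (m p.1) (p.2.bracket i)) = 0 := by
  obtain ⟨y, j⟩ := p
  by_cases y_eq : y = x
  · subst y_eq
    cases j <;>
      simp [exchangeCoeff, Ladder.sum_univ, Ladder.conj, Ladder.bracket, epsTilde] <;> ring
  · simp [exchangeCoeff, y_eq]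

theorem sum_ladderCoord_mul_bracketSum_singleton (m : Site d → Vec3) (x : Site d) (u : Word d) :
    ∑ i, ladderCoord (m x) i.conj * bracketSum u [(x, i)] (evalWord m) = 0 := by
  simp only [bracketSum_singleton, Finset.mul_sum]
  rw [Finset.sum_comm]
  refine Finset.sum_eq_zero fun a _ => ?_
  calc _ = ∑ i, evalWord m (u.take a) * evalWord m (u.drop (a + 1)) *
        (ladderCoord (m x) i.conj *
          (exchangeCoeff u[a.1] (x, i) * ladderCoord (m u[a.1].1) (u[a.1].2.bracket i))) :=
        Finset.sum_congr rfl fun i _ => by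
          rw [evalWord_append, evalWord_cons]
          ring
    _ = 0 := by rw [← Finset.mul_sum, sum_ladderCoord_mul_exchangeCoeff, mul_zero]

theorem sum_ladderCoord_mul_hamiltonField (h : IsFlowRadius V R r) (hm : ∀ x, ‖m x‖ ≤ R)
    (x : Site d) : ∑ i, ladderCoord (m x) i.conj * hamiltonField V m x i = 0 := by
  have summable (i : Ladder) : Summable fun α =>
      ladderCoord (m x) i.conj * (V α • bracketSum (normalWord α) [(x, i)] (evalWord m)) :=
    (summable_iterate_liouville h (fun _ => le_rfl) (hasGrowth_evalWord hm) 0 _).mul_left _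
  simp only [hamiltonField_eq_liouville, liouville, ← tsum_mul_left]
  rw [← Summable.tsum_finsetSum fun i _ => summable i]
  simp only [smul_eq_mul, mul_left_comm _ (V _), ← Finset.mul_sum,
    sum_ladderCoord_mul_bracketSum_singleton, mul_zero, tsum_zero]

/-! ### Solutions of the equation of motion -/

/-- The vector with ladder coordinates `f`, if these are the coordinates of a real vector. -/
def vecOfLadder (f : Ladder → ℂ) : Vec3 :=
  !₂[Real.sqrt 2 * (f .plus).re, Real.sqrt 2 * (f .plus).im, (f .z).re]

theorem ladderCoord_vecOfLadder {f : Ladder → ℂ} (hf : ∀ i, star (f i) = f i.conj) (i : Ladder) :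
    ladderCoord (vecOfLadder f) i = f i := by
  have sqrt_two_ne_zero : (Real.sqrt 2 : ℂ) ≠ 0 := by simp
  have coord_plus : ladderCoord (vecOfLadder f) .plus = f .plus := by
    rw [ladderCoord, div_eq_iff sqrt_two_ne_zero]
    nth_rw 1 [← Complex.re_add_im (f .plus)]
    simp only [vecOfLadder, PiLp.toLp_apply, Matrix.cons_val, Complex.ofReal_mul]
    ring
  cases i with
  | plus => exact coord_plus
  | z => exact Complex.conj_eq_iff_re.1 (hf .z)
  | minus => exact (star_ladderCoord _ .plus).symm.trans ((congrArg star coord_plus).trans (hf _))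

theorem norm_vecOfLadder_hamiltonField_le (hV : IsPotential V) (hm : ∀ x, ‖m x‖ ≤ 1)
    (x : Site d) :
    ‖vecOfLadder (hamiltonField V m x)‖ ≤ 2 * (Real.exp 1 * potentialNorm V) :=
  norm_le_two_mul_of_ladderCoord fun i => by
    rw [ladderCoord_vecOfLadder (star_hamiltonField hV _ _)]
    exact norm_hamiltonField_le hV.norm_lt_top hm x i

/-- The Hamiltonian vector field on the space of bounded configurations, composed with the radial
projection of every spin on the unit ball. -/
def cutoffField (hV : IsPotential V) (m : lp (fun _ : Site d => Vec3) ∞) :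
    lp (fun _ : Site d => Vec3) ∞ :=
  ⟨fun x => vecOfLadder (hamiltonField V (fun y => unitBallProj (m y)) x),
    memℓp_infty ⟨2 * (Real.exp 1 * potentialNorm V), Set.forall_mem_range.2 fun x =>
      norm_vecOfLadder_hamiltonField_le hV (fun _ => norm_unitBallProj_le _) x⟩⟩

theorem ladderCoord_cutoffField (hV : IsPotential V) (m : lp (fun _ : Site d => Vec3) ∞)
    (x : Site d) (i : Ladder) : ladderCoord (cutoffField hV m x) i =
      hamiltonField V (fun y => unitBallProj (m y)) x i :=
  ladderCoord_vecOfLadder (star_hamiltonField hV _ x) i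

theorem norm_cutoffField_le (hV : IsPotential V) (m : lp (fun _ : Site d => Vec3) ∞) :
    ‖cutoffField hV m‖ ≤ 2 * (Real.exp 1 * potentialNorm V) := by
  have hV0 := potentialNorm_nonneg V
  exact lp.norm_le_of_forall_le (by positivity)
    (norm_vecOfLadder_hamiltonField_le hV fun _ => norm_unitBallProj_le _)

theorem lipschitzWith_cutoffField (hV : IsPotential V) :
    LipschitzWith (8 * Real.exp 1 * potentialNorm V).toNNReal (cutoffField hV) := by
  have hV0 := potentialNorm_nonneg V
  refine LipschitzWith.of_dist_le_mul fun m m' => ?_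
  rw [dist_eq_norm, dist_eq_norm, Real.coe_toNNReal _ (by positivity)]
  refine lp.norm_le_of_forall_le (by positivity) fun x => ?_
  have norm_proj_sub_le (y) : ‖unitBallProj (m y) - unitBallProj (m' y)‖ ≤ 2 * ‖m - m'‖ :=
    (norm_unitBallProj_sub_le _ _).trans
      (mul_le_mul_of_nonneg_left (lp.norm_apply_le_norm ENNReal.top_ne_zero (m - m') y) two_pos.le)
  refine (norm_le_two_mul_of_ladderCoord fun i => ?_).trans_eq
    (by ring : 2 * (2 * ‖m - m'‖ * (2 * Real.exp 1 * potentialNorm V)) = _)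
  rw [lp.coeFn_sub, Pi.sub_apply, ladderCoord_sub, ladderCoord_cutoffField,
    ladderCoord_cutoffField]
  exact norm_hamiltonField_sub_le hV.norm_lt_top (fun _ => norm_unitBallProj_le _)
    (fun _ => norm_unitBallProj_le _) norm_proj_sub_le x i

theorem inner_cutoffField (hV : IsPotential V) (m : lp (fun _ : Site d => Vec3) ∞) (x : Site d) :
    inner ℝ (m x) (cutoffField hV m x) = 0 := by
  rw [← smul_unitBallProj (m x), inner_smul_left]
  refine mul_eq_zero_of_right _ (Complex.ofReal_injective ?_)
  simp only [inner_eq_sum_ladderCoord, ladderCoord_cutoffField]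
  exact sum_ladderCoord_mul_hamiltonField (m := fun y => unitBallProj (m y))
    (isFlowRadius_one hV.norm_lt_top) (fun _ => norm_unitBallProj_le _) x

/-- On configurations of unit vectors the cutoff is invisible, and the flow of the cutoff field
preserves them. -/
theorem isHamiltonianEvolution_of_hasDerivAt_cutoffField (hV : IsPotential V)
    {M₀ : Site d → Metric.sphere (0 : Vec3) 1} {M : ℝ → lp (fun _ : Site d => Vec3) ∞}
    (initial : ∀ x, M 0 x = M₀ x) (hM : ∀ t, HasDerivAt M (cutoffField hV (M t)) t) :
    IsHamiltonianEvolution V M₀ M := by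
  have hasDerivAt_spin (x : Site d) (t : ℝ) :
      HasDerivAt (fun t => M t x) (cutoffField hV (M t) x) t :=
    (lp.evalCLM ℝ (fun _ : Site d => Vec3) ∞ x).hasFDerivAt.comp_hasDerivAt t (hM t)
  have norm_eq_one (t : ℝ) (x : Site d) : ‖M t x‖ = 1 := by
    rw [norm_eq_of_hasDerivAt_of_inner_eq_zero (hasDerivAt_spin x)
      (fun t => inner_cutoffField hV (M t) x) t 0, initial, norm_eq_of_mem_sphere]
  have deriv_eq : deriv M = fun t => cutoffField hV (M t) := funext fun t => (hM t).deriv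
  have continuous : Continuous M := continuous_iff_continuousAt.2 fun t => (hM t).continuousAt
  refine ⟨contDiff_one_iff_deriv.2 ⟨fun t => (hM t).differentiableAt, ?_⟩, initial, norm_eq_one,
    fun t x i => (hasDerivAt_ladderCoord (hasDerivAt_spin x t) i).congr_deriv ?_⟩
  · rw [deriv_eq]
    exact (lipschitzWith_cutoffField hV).continuous.comp continuous
  · rw [ladderCoord_cutoffField]
    exact congrArg (fun m => hamiltonField V m x i)
      (funext fun y => unitBallProj_of_norm_le_one (norm_eq_one t y).le)

theorem exists_hamiltonianEvolution (hV : IsPotential V)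
    (M₀ : Site d → Metric.sphere (0 : Vec3) 1) :
    ∃ M : ℝ → lp (fun _ : Site d => Vec3) ∞, IsHamiltonianEvolution V M₀ M := by
  let m₀ : lp (fun _ : Site d => Vec3) ∞ := ⟨fun x => M₀ x, memℓp_infty
    ⟨1, Set.forall_mem_range.2 fun x => (norm_eq_of_mem_sphere (M₀ x)).le⟩⟩
  obtain ⟨M, initial, hM⟩ := exists_hasDerivAt_of_lipschitzWith_of_norm_le
    (lipschitzWith_cutoffField hV)
    (fun m => (norm_cutoffField_le hV m).trans (Real.le_coe_toNNReal _)) m₀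
  exact ⟨M, isHamiltonianEvolution_of_hasDerivAt_cutoffField hV (fun x => by rw [initial]) hM⟩

end VectorField

/-! ### The classical limit -/

section ClassicalLimit

variable {d N : ℕ} {V : MultiIndex d → ℂ} {M₀ : Site d → Metric.sphere (0 : Vec3) 1}
  {M : ℝ → lp (fun _ : Site d => Vec3) ∞}

/-- The difference between the quantum and the classical expectation of a word at time `t`. -/
def deviation (V : MultiIndex d → ℂ) (M₀ : Site d → Metric.sphere (0 : Vec3) 1)
    (M : ℝ → lp (fun _ : Site d => Vec3) ∞) (N : ℕ) (t : ℝ) (w : Word d) : ℂ :=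
  coherentState N (fun x => (M₀ x : Vec3)) (quantumEvolution N V t (wordOp N w)) -
    evalWord (M t) w

theorem sub_evalAt_eq_sum_deviation (hV : IsPotential V) (hN : 1 ≤ N) (t : ℝ) (A : PolyObs d) :
    coherentState N (fun x => (M₀ x : Vec3)) (quantumEvolution N V t (quantize N A)) -
        A.evalAt (M t) =
      ∑ α ∈ A.support, A.coeff α * deviation V M₀ M N t (normalWord α) := by
  rw [quantumEvolution_quantize hV hN, evalAt_eq_sum_evalWord, map_sum, ← Finset.sum_sub_distrib]
  refine Finset.sum_congr rfl fun α _ => ?_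
  rw [map_smul, smul_eq_mul, deviation, mul_sub]

theorem hasGrowth_coherentState_quantumEvolution {R : ℝ} (hV : IsPotential V) (hN1 : 1 ≤ N)
    (hN : IsSpinBound N R) (m : Site d → Vec3) (t : ℝ) :
    HasGrowth 1 0 R fun w => coherentState N m (quantumEvolution N V t (wordOp N w)) :=
  ⟨zero_le_one, fun w => (norm_coherentState_le _ _).trans
    ((hasGrowth_quantumEvolution_wordOp hV hN1 hN t).norm_le w)⟩

theorem hasGrowth_deviation {R : ℝ} (hV : IsPotential V) (hM : IsHamiltonianEvolution V M₀ M)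
    (hN1 : 1 ≤ N) (hN : IsSpinBound N R) (hR : 1 ≤ R) (t : ℝ) :
    HasGrowth 2 0 R (deviation V M₀ M N t) := by
  refine ⟨zero_le_two, fun w => ?_⟩
  rw [← one_add_one_eq_two, add_mul]
  exact (norm_sub_le _ _).trans (add_le_add
    ((hasGrowth_coherentState_quantumEvolution hV hN1 hN _ t).norm_le w)
    ((hasGrowth_evalWord fun x => (hM.norm_eq_one t x).trans_le hR).norm_le w))

theorem hasGrowth_deviation_zero (hM : IsHamiltonianEvolution V M₀ M) (hN : 2 ≤ N) :
    HasGrowth (1 / √((N : ℝ) / 2)) 1 1 (deviation V M₀ M N 0) := by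
  refine ⟨by positivity, fun w => ?_⟩
  have initial : (M 0 : Site d → Vec3) = fun x => (M₀ x : Vec3) := funext hM.initial
  rw [deviation, quantumEvolution_zero, initial, pow_one, one_pow, mul_one, mul_comm]
  exact norm_coherentState_wordOp_sub_le _ (one_le_two.trans hN) (isSpinBound_one hN)
    (fun x => norm_eq_of_mem_sphere (M₀ x)) w

theorem deviation_add (hV : IsPotential V) (hM : IsHamiltonianEvolution V M₀ M) (hN : 2 ≤ N)
    (t : ℝ) {τ : ℝ} (hτ : |τ| * potentialNorm V < 1) (w : Word d) :
    deviation V M₀ M N (t + τ) w = flow V τ (deviation V M₀ M N t) w := by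
  have h := isFlowRadius_one hV.norm_lt_top
  have hN1 : 1 ≤ N := one_le_two.trans hN
  have bound := isSpinBound_one hN
  rw [deviation, quantumEvolution_add hV h hN1 bound t hτ, hM.evalWord_add hV.norm_lt_top t hτ,
    ← flow_map h (fun _ => le_rfl) (coherentState N fun x => (M₀ x : Vec3))
      (hasGrowth_quantumEvolution_wordOp hV hN1 bound t) hτ,
    ← flow_sub h (fun _ => le_rfl) (hasGrowth_coherentState_quantumEvolution hV hN1 bound _ t)
      (hM.hasGrowth_evalWord t) hτ]
  rfl

/-! ### The rate of convergence -/

/-- The constant in the short-time error bound for a word of length `p`. The first summand is only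
needed for spin `1/2`, where the letters are not contractions. -/
def rateConst (V : MultiIndex d → ℂ) (T : ℝ) (p : ℕ) : ℝ :=
  2 * (3 / 2) ^ p + ∑' k, flowBound V 1 T 1 p k

theorem norm_deviation_le_rateConst (hV : IsPotential V) (hM : IsHamiltonianEvolution V M₀ M)
    (hN : 1 ≤ N) {t T : ℝ} (ht : |t| ≤ T) (hT : T * potentialNorm V < 1) (w : Word d) :
    ‖deviation V M₀ M N t w‖ ≤ rateConst V T w.length / √((N : ℝ) / 2) := by
  have hV0 := potentialNorm_nonneg V
  have hT0 : 0 ≤ T := (abs_nonneg t).trans ht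
  have tsum_flowBound_nonneg : 0 ≤ ∑' k, flowBound V 1 T 1 w.length k := tsum_nonneg fun k => by
    rw [flowBound]
    positivity
  obtain rfl | hN2 := hN.eq_or_lt
  · have sqrt_le_one : √(((1 : ℕ) : ℝ) / 2) ≤ 1 := Real.sqrt_le_one.2 (by norm_num)
    have norm_le := (hasGrowth_deviation hV hM le_rfl (isSpinBound_three_halves le_rfl)
      (by norm_num) t).norm_le w
    rw [pow_zero, one_mul] at norm_le
    calc _ ≤ rateConst V T w.length := norm_le.trans (le_add_of_nonneg_right tsum_flowBound_nonneg)
      _ ≤ _ := le_div_self (by rw [rateConst]; positivity) (by positivity) sqrt_le_one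
  · calc _ = ‖flow V t (deviation V M₀ M N 0) w‖ := by
          rw [← deviation_add hV hM hN2 0 ((mul_le_mul_of_nonneg_right ht hV0).trans_lt hT),
            zero_add]
      _ ≤ 1 / √((N : ℝ) / 2) * ∑' k, flowBound V 1 T 1 w.length k :=
          norm_flow_le (isFlowRadius_one hV.norm_lt_top) (fun _ => le_rfl)
            (hasGrowth_deviation_zero hM hN2) ht hT w
      _ ≤ _ := by
          rw [one_div_mul_eq_div, rateConst]
          gcongr
          exact le_add_of_nonneg_left (by positivity)

theorem norm_sub_evalAt_le (hV : IsPotential V) (hM : IsHamiltonianEvolution V M₀ M)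
    (hN : 1 ≤ N) {t T : ℝ} (ht : |t| ≤ T) (hT : T * potentialNorm V < 1) (A : PolyObs d) :
    ‖coherentState N (fun x => (M₀ x : Vec3)) (quantumEvolution N V t (quantize N A)) -
        A.evalAt (M t)‖ ≤
      (∑ α ∈ A.support, ‖A.coeff α‖ * rateConst V T (normalWord α).length) /
        √((N : ℝ) / 2) := by
  rw [sub_evalAt_eq_sum_deviation hV hN, Finset.sum_div]
  refine norm_sum_le_of_le _ fun α _ => ?_
  rw [norm_mul, mul_div_assoc]
  exact mul_le_mul_of_nonneg_left (norm_deviation_le_rateConst hV hM hN ht hT _) (norm_nonneg _)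

/-! ### Convergence for all times -/

theorem tendsto_deviation_zero (hV : IsPotential V) (hM : IsHamiltonianEvolution V M₀ M)
    (w : Word d) :
    Tendsto (fun q : ℕ × ℝ => deviation V M₀ M q.1 q.2 w) (atTop ×ˢ 𝓝 0) (𝓝 0) := by
  have hV0 := potentialNorm_nonneg V
  set T := (potentialNorm V + 1)⁻¹
  have hT0 : 0 < T := by positivity
  have hT : T * potentialNorm V < 1 := by
    rw [inv_mul_lt_one₀ (by positivity)]
    exact lt_add_one _
  have sqrt_tendsto : Tendsto (fun N : ℕ => √((N : ℝ) / 2)) atTop atTop :=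
    Real.tendsto_sqrt_atTop.comp
      ((tendsto_natCast_atTop_atTop (R := ℝ)).atTop_div_const two_pos)
  refine squeeze_zero_norm' ?_
    ((sqrt_tendsto.const_div_atTop (rateConst V T w.length)).comp tendsto_fst)
  have abs_eventually_le : ∀ᶠ t : ℝ in 𝓝 0, |t| ≤ T :=
    (continuous_abs.tendsto' 0 0 abs_zero).eventually_le_const hT0
  filter_upwards [(eventually_ge_atTop 1).prod_mk abs_eventually_le] with q ⟨hN, ht⟩
  exact norm_deviation_le_rateConst hV hM hN ht hT w

theorem tendsto_deviation_add (hV : IsPotential V) (hM : IsHamiltonianEvolution V M₀ M) {t τ : ℝ}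
    (hτ : |τ| * potentialNorm V < 1)
    (tendsto_t : ∀ w, Tendsto (fun q : ℕ × ℝ => deviation V M₀ M q.1 q.2 w) (atTop ×ˢ 𝓝 t) (𝓝 0))
    (w : Word d) :
    Tendsto (fun q : ℕ × ℝ => deviation V M₀ M q.1 q.2 w) (atTop ×ˢ 𝓝 (t + τ)) (𝓝 0) := by
  have sub_tendsto : Tendsto (fun s => s - τ) (𝓝 (t + τ)) (𝓝 t) :=
    (continuous_sub_right τ).tendsto' _ _ (add_sub_cancel_right t τ)
  have shift_tendsto : Tendsto (fun q : ℕ × ℝ => (q.1, q.2 - τ)) (atTop ×ˢ 𝓝 (t + τ))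
      (atTop ×ˢ 𝓝 t) := tendsto_fst.prodMk (sub_tendsto.comp tendsto_snd)
  have eventually_two_le : ∀ᶠ q : ℕ × ℝ in atTop ×ˢ 𝓝 (t + τ), 2 ≤ q.1 :=
    tendsto_fst.eventually (eventually_ge_atTop 2)
  have deviation_tendsto (v : Word d) : Tendsto
      (fun q : ℕ × ℝ => deviation V M₀ M q.1 (q.2 - τ) v) (atTop ×ˢ 𝓝 (t + τ)) (𝓝 0) :=
    ((tendsto_t v).comp shift_tendsto :)
  have flow_tendsto : Tendsto
      (fun q : ℕ × ℝ => flow V τ (deviation V M₀ M q.1 (q.2 - τ)) w) (atTop ×ˢ 𝓝 (t + τ))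
      (𝓝 (flow V τ (fun _ => 0) w)) :=
    tendsto_flow (isFlowRadius_one hV.norm_lt_top) (fun _ _ => le_rfl)
      (fun _ => tendsto_const_nhds)
      (eventually_two_le.mono fun q hq =>
        hasGrowth_deviation hV hM (one_le_two.trans hq) (isSpinBound_one hq) le_rfl _)
      deviation_tendsto hτ w
  rw [flow_zero] at flow_tendsto
  refine flow_tendsto.congr' (eventually_two_le.mono fun q hq => ?_)
  rw [← deviation_add hV hM hq _ hτ, sub_add_cancel]

theorem tendsto_deviation (hV : IsPotential V) (hM : IsHamiltonianEvolution V M₀ M) (t : ℝ)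
    (w : Word d) :
    Tendsto (fun q : ℕ × ℝ => deviation V M₀ M q.1 q.2 w) (atTop ×ˢ 𝓝 t) (𝓝 0) :=
  forall_time_of_small_steps (b := potentialNorm V) (P := fun t => ∀ w,
    Tendsto (fun q : ℕ × ℝ => deviation V M₀ M q.1 q.2 w) (atTop ×ˢ 𝓝 t) (𝓝 0)) one_pos
    (tendsto_deviation_zero hV hM) (fun _ _ hτ => tendsto_deviation_add hV hM hτ) t w

theorem tendstoUniformlyOn_evalAt (hV : IsPotential V) (hM : IsHamiltonianEvolution V M₀ M)
    (A : PolyObs d) {K : Set ℝ} (hK : IsCompact K) :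
    TendstoUniformlyOn
      (fun (N : ℕ) (t : ℝ) => coherentState N (fun x => (M₀ x : Vec3))
        (quantumEvolution N V t (quantize N A)))
      (fun t => A.evalAt (M t)) atTop K := by
  refine (tendstoLocallyUniformlyOn_iff_tendstoUniformlyOn_of_compact hK).1
    (TendstoLocallyUniformly.tendstoLocallyUniformlyOn ?_)
  rw [tendstoLocallyUniformly_iff_forall_tendsto]
  intro t
  rw [tendsto_uniformity_iff_dist_tendsto_zero]
  have sum_tendsto : Tendsto (fun q : ℕ × ℝ => ∑ α ∈ A.support,
      A.coeff α * deviation V M₀ M q.1 q.2 (normalWord α)) (atTop ×ˢ 𝓝 t) (𝓝 0) := by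
    simpa only [mul_zero, Finset.sum_const_zero] using tendsto_finsetSum A.support fun α _ =>
      (tendsto_deviation hV hM t (normalWord α)).const_mul (A.coeff α)
  refine (tendsto_zero_iff_norm_tendsto_zero.1 sum_tendsto).congr' ?_
  filter_upwards [tendsto_fst.eventually (eventually_ge_atTop 1)] with q hN
  rw [← sub_evalAt_eq_sum_deviation hV hN, dist_comm, dist_eq_norm]

end ClassicalLimit

end SpinSystem

end

theorem mainTheorem3 (d : ℕ) (V : SpinSystem.MultiIndex d → ℂ) (hV : SpinSystem.IsPotential V) :
    -- the infinite-volume quantum dynamics of every quantized observable is a genuine norm limit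
    (∀ N : ℕ, 1 ≤ N → ∀ (t : ℝ) (A : SpinSystem.PolyObs d),
      Tendsto (fun Λ : Finset (SpinSystem.Site d) =>
          SpinSystem.finiteVolumeEvolution N V Λ t (SpinSystem.quantize N A))
        atTop (𝓝 (SpinSystem.quantumEvolution N V t (SpinSystem.quantize N A)))) ∧
    -- the classical evolution exists and is unique
    (∀ M₀ : SpinSystem.Site d → Metric.sphere (0 : SpinSystem.Vec3) 1,
      ∃! M : ℝ → lp (fun _ : SpinSystem.Site d => SpinSystem.Vec3) ∞,
        SpinSystem.IsHamiltonianEvolution V M₀ M) ∧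
    -- the large-spin limit `s = N / 2 → ∞`, uniformly on compact time intervals
    (∀ (A : SpinSystem.PolyObs d) (M₀ : SpinSystem.Site d → Metric.sphere (0 : SpinSystem.Vec3) 1)
      (M : ℝ → lp (fun _ : SpinSystem.Site d => SpinSystem.Vec3) ∞),
      SpinSystem.IsHamiltonianEvolution V M₀ M →
      ∀ a b : ℝ, TendstoUniformlyOn
        (fun (N : ℕ) (t : ℝ) => SpinSystem.coherentState N (fun x => (M₀ x : SpinSystem.Vec3))
          (SpinSystem.quantumEvolution N V t (SpinSystem.quantize N A)))
        (fun t => A.evalAt (M t)) atTop (Set.Icc a b)) ∧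
    -- the rate `O(s^{-1/2})` for short times
    (∀ (A : SpinSystem.PolyObs d) (T : ℝ), T * SpinSystem.potentialNorm V < 1 →
      ∃ C : ℝ, ∀ (M₀ : SpinSystem.Site d → Metric.sphere (0 : SpinSystem.Vec3) 1)
        (M : ℝ → lp (fun _ : SpinSystem.Site d => SpinSystem.Vec3) ∞),
        SpinSystem.IsHamiltonianEvolution V M₀ M →
        ∀ t : ℝ, |t| ≤ T → ∀ N : ℕ, 1 ≤ N →
          ‖SpinSystem.coherentState N (fun x => (M₀ x : SpinSystem.Vec3))
              (SpinSystem.quantumEvolution N V t (SpinSystem.quantize N A)) -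
            A.evalAt (M t)‖ ≤ C / Real.sqrt ((N : ℝ) / 2)) := by
  refine ⟨fun N hN t A => ?_, fun M₀ => ?_, fun A M₀ M hM a b => ?_, fun A T hT =>
    ⟨_, fun M₀ M hM t ht N hN => SpinSystem.norm_sub_evalAt_le hV hM hN ht hT A⟩⟩
  · rw [SpinSystem.quantumEvolution_quantize hV hN]
    exact SpinSystem.tendsto_finiteVolumeEvolution_quantize hV hN t A
  · obtain ⟨M, hM⟩ := SpinSystem.exists_hamiltonianEvolution hV M₀
    exact ⟨M, hM, fun M' hM' => hM'.unique hV.norm_lt_top hM⟩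
  · exact SpinSystem.tendstoUniformlyOn_evalAt hV hM A isCompact_Icc
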